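/- Let $\Omega=(0,1)^3$, with surface measure $d\omega$ and outward unit normal $\mathbf n$ on $\partial\Omega$; let $T>0$ and let $\lambda,\mu\in\mathbb R$ satisfy $\mu>0$, $\lambda+2\mu>0$. **The system.** Data are quadruples $I=(\varphi,X,g,h)$ with $\varphi\in L^1(0,T)$, $X\in (L^1(0,T;L^1(\partial\Omega)))^3$, $g,h\in (L^2(\Omega))^3$ (real-valued). A solution for the data $I$ is a pair $(u,f)$ with $u\in (C^2([0,T];L^2(\Omega))\cap L^2(0,T;H^2(\Omega)))^3$, $f\in(L^2(\Omega))^3$ such that $$\partial_t^2u-\mu\Delta u-(\lambda+\mu)\nabla(\operatorname{div}u)=\varphi(t)f(x)\ \text{ in }\Omega\times(0,T),\qquad u(0)=g,\ \partial_tu(0)=h\ \text{ in }\Omega,$$ $$u=0,\qquad \sum_{k=1}^3 S_{jk}\mathbf n_k=X_j\ (j=1,2,3)\ \text{ on }\partial\Omega\times(0,T),$$ where $S_{jk}=\mu(\partial_ku_j+\partial_ju_k)$ for $j\neq k$ and $S_{jj}=\lambda\operatorname{div}u+2\mu\,\partial_ju_j$ (the equation and boundary conditions hold for a.e. $t$,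 the latter in the sense of traces). **Assumptions on the exact data.** Let $I_0=(\varphi^0,X^0,g^0,h^0)$ be such that (W1) there are $\Lambda\in(0,T)$ and $C>0$ such that either $\varphi^0\ge C$ a.e. on $(0,\Lambda)$ or $\varphi^0\le -C$ a.e. on $(0,\Lambda)$; (W2') $T>12\sqrt5\,\max\{1/\sqrt\mu,\,1/\sqrt{\lambda+2\mu}\}$; and let $(u^0,f^0)$ be a solution for the data $I_0$. **The functional $H_j$.** For $\alpha\in\mathbb C^3$ and $x\in\mathbb R^3$ put $\alpha\cdot\alpha=\alpha_1^2+\alpha_2^2+\alpha_3^2$, $|\alpha|_0=\sqrt{|\alpha\cdot\alpha|}$; let $G^j_j(\alpha,x)=G(\alpha,x)=\prod_{i=1}^3\cos(\alpha_ix_i)$, and for $j\ne k$ let $G^j_k(\alpha,x)=-\sin(\alpha_jx_j)\sin(\alpha_kx_k)\cos(\alpha_lx_l)$, where $\{j,k,l\}=\{1,2,3\}$. Put $c_1=\sqrt{\lambda+2\mu}$, $c_2=\sqrt\mu$, $K_e(t)=\sinh(c_e|\alpha|_0(T-t))/\cosh(c_e|\alpha|_0T)$, and for data $I=(\varphi,X,g,h)$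 and $\alpha\cdot\alpha<0$ $$D_e(I)(\alpha)=-|\alpha|_0^2\int_0^T\varphi(t)K_e(t)\,dt\qquad(e=1,2),$$ $$E_{1j}(I)(\alpha)=-c_1|\alpha|_0\,\alpha_j\int_\Omega\sum_k\alpha_kg_kG^j_k\,dx-\tanh(c_1|\alpha|_0T)\,\alpha_j\int_\Omega\sum_k\alpha_kh_kG^j_k\,dx-\int_0^T\!\!\int_{\partial\Omega}K_1(t)\,\alpha_j\sum_k\alpha_kX_kG^j_k\,d\omega\,dt,$$ $$E_{2j}(I)(\alpha)=-c_2|\alpha|_0\int_\Omega\Bigl(-|\alpha|_0^2g_jG-\alpha_j\sum_k\alpha_kg_kG^j_k\Bigr)dx-\tanh(c_2|\alpha|_0T)\int_\Omega\Bigl(-|\alpha|_0^2h_jG-\alpha_j\sum_k\alpha_kh_kG^j_k\Bigr)dx$$ $$\qquad\qquad+\int_0^T\!\!\int_{\partial\Omega}K_2(t)\Bigl(|\alpha|_0^2X_jG+\alpha_j\sum_k\alpha_kX_kG^j_k\Bigr)d\omega\,dt,$$ and $H_j(I)(\alpha)=\dfrac{E_{1j}(I)(\alpha)}{D_1(I)(\alpha)}+\dfrac{E_{2j}(I)(\alpha)}{D_2(I)(\alpha)}$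 if $D_1(I)(\alpha)D_2(I)(\alpha)\neq0$, $H_j(I)(\alpha)=0$ otherwise. **The regularized solution.** For $\varepsilon>0$ let $I_\varepsilon=(\varphi^\varepsilon,X^\varepsilon,g^\varepsilon,h^\varepsilon)$ be any data with, for all $j\in\{1,2,3\}$, $$\|\varphi^\varepsilon-\varphi^0\|_{L^1}\le\varepsilon,\quad\|X^\varepsilon_j-X^0_j\|_{L^1}\le\varepsilon,\quad\|g^\varepsilon_j-g^0_j\|_{L^2}\le\varepsilon,\quad\|h^\varepsilon_j-h^0_j\|_{L^2}\le\varepsilon .$$ Let $r_\varepsilon$ be the integer in $\bigl(\tfrac{\ln(\varepsilon^{-1})}{60},\tfrac{\ln(\varepsilon^{-1})}{60}+1\bigr]$, let $B_{r}=\{\pm(5r+i):i=1,\dots,24r\}$, and for a finite set $A\subset\mathbb C$ let $L[A;w]$ be the Lagrange interpolation polynomial of $w$ at the points of $A$. Put $$f^\varepsilon_j(x)=\sum_{0\le m,n,p\le r_\varepsilon}\kappa(m,n,p)\,\mathcal F_\varepsilon(m,n,p)\cos(m\pi x_1)\cos(n\pi x_2)\cos(p\pi x_3),$$ where $\kappa(m,n,p)=(1+1_{\{m\ne0\}})(1+1_{\{n\neq0\}})(1+1_{\{p\ne0\}})$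 and $\mathcal F_\varepsilon(m,n,p)=L\bigl[B_{r_\varepsilon};\,z\mapsto H_j(I_\varepsilon)(-iz,n\pi,p\pi)\bigr](im\pi)$. **Conclusion.** There are constants $\varepsilon_0>0$, $C_0>0$ depending only on the exact data ($\lambda,\mu,T,I_0$) such that for all $j\in\{1,2,3\}$: (i) $f^\varepsilon_j\in C^\infty(\mathbb R^3)$, and $f^\varepsilon_j\to f^0_j$ in $L^2(\Omega)$ as $\varepsilon\to0$. (ii) If $f^0_j\in H^1(\Omega)$, then $f^\varepsilon_j\to f^0_j$ in $H^1(\Omega)$ as $\varepsilon\to0$, and for all $\varepsilon\in(0,\varepsilon_0)$ $$\|f^\varepsilon_j-f^0_j\|_{L^2(\Omega)}\le C_0\bigl(\ln(\varepsilon^{-1})\bigr)^{-1/2}.$$ (iii) If $f^0_j\in H^2(\Omega)$, then for all $\varepsilon\in(0,\varepsilon_0)$ $$\|f^\varepsilon_j-f^0_j\|_{H^1(\Omega)}\le C_0\bigl(\ln(\varepsilon^{-1})\bigr)^{-1/4}.$$ -/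

import Mathlib

open MeasureTheory Set

namespace Lame

noncomputable section

/-! ### The cube, its boundary, and the function spaces -/

/-- Points of `ℝ³`. -/
abbrev Pt := Fin 3 → ℝ

/-- The open unit cube `Ω = (0,1)³`. -/
def Omega : Set Pt := Set.pi Set.univ fun _ => Ioo (0 : ℝ) 1

/-- Lebesgue measure on `Ω`. -/
abbrev volOmega : Measure Pt := volume.restrict Omega

/-- The real space `L²(Ω)`. -/
abbrev L2Omega := Lp ℝ 2 volOmega

/-- Two-dimensional Lebesgue measure on the open face `{x ∈ ∂Ω : x i = s}`, for `s ∈ {0, 1}`. -/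
def faceMeasure (i : Fin 3) (s : ℝ) : Measure Pt :=
  Measure.map (fun y : Fin 2 → ℝ => Fin.insertNth (α := fun _ => ℝ) i s y)
    (volume.restrict (Set.pi Set.univ fun _ => Ioo (0 : ℝ) 1))

/-- The surface measure `dω` of `∂Ω` (sum over the six faces; the edges are null). -/
def surf : Measure Pt :=
  ∑ i : Fin 3, (faceMeasure i 0 + faceMeasure i 1)

/-- The outward unit normal of `∂Ω`; at a point of an open face it is `± e_i`. Its values on the
edges, which are null, play no role. -/
def normal (x : Pt) (k : Fin 3) : ℝ :=
  if x k = 1 then 1 else if x k = 0 then -1 else 0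

/-- Lebesgue measure on `(0,T)`. -/
abbrev volTime (T : ℝ) : Measure ℝ := volume.restrict (Ioo 0 T)

/-- The measure `dt dω` on `(0,T) × ∂Ω`. -/
abbrev volLateral (T : ℝ) : Measure (ℝ × Pt) := (volTime T).prod surf

section Sobolev

variable {F : Type*} [NormedAddCommGroup F] [NormedSpace ℝ F]

/-- `v` is the weak partial derivative `∂w/∂x_i` on `Ω` (for `w`, `v` integrable on `Ω`). -/
def HasWeakPartial (i : Fin 3) (w v : Pt → F) : Prop :=
  ∀ ψ : Pt → ℝ, ContDiff ℝ ((⊤ : ℕ∞) : WithTop ℕ∞) ψ → HasCompactSupport ψ → tsupport ψ ⊆ Omega →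
    ∫ x in Omega, fderiv ℝ ψ x (Pi.single i 1) • w x = -∫ x in Omega, ψ x • v x

/-- `v 0, v 1, v 2` are the weak first partial derivatives of `w`, and all are in `L²(Ω)`. -/
def HasL2Gradient (w : Pt → F) (v : Fin 3 → Pt → F) : Prop :=
  MemLp w 2 volOmega ∧ ∀ i, MemLp (v i) 2 volOmega ∧ HasWeakPartial i w (v i)

/-- `w ∈ H¹(Ω)`. -/
def MemH1 (w : Pt → F) : Prop := ∃ v : Fin 3 → Pt → F, HasL2Gradient w v

/-- `w ∈ H²(Ω)`. -/
def MemH2 (w : Pt → F) : Prop :=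
  ∃ v : Fin 3 → Pt → F, HasL2Gradient w v ∧ ∀ i, MemH1 (v i)

/-- The norm `‖w‖_{H¹(Ω)} = (‖w‖² + ‖∂₁w‖² + ‖∂₂w‖² + ‖∂₃w‖²)^{1/2}`. The weak gradient is unique up
to null sets, so that the infimum only selects it; the value is `∞` if `w` is not in `H¹(Ω)`. -/
def H1norm (w : Pt → F) : ENNReal :=
  ⨅ (v : Fin 3 → Pt → F) (_ : HasL2Gradient w v),
    (eLpNorm w 2 volOmega ^ 2 + ∑ i, eLpNorm (v i) 2 volOmega ^ 2) ^ (1 / 2 : ℝ)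

/-- `b ∈ L²(∂Ω)` is the trace of `w ∈ H¹(Ω)` on `∂Ω`: some functions that are smooth up to the
boundary converge to `w` in `H¹(Ω)` while their restrictions to `∂Ω` converge to `b` in `L²(∂Ω)`. -/
def HasTrace (w b : Pt → F) : Prop :=
  MemLp b 2 surf ∧ ∃ ψ : ℕ → Pt → F, (∀ n, ContDiff ℝ ((⊤ : ℕ∞) : WithTop ℕ∞) (ψ n)) ∧
    Filter.Tendsto (fun n => H1norm (fun x => ψ n x - w x)) Filter.atTop (nhds 0) ∧
    Filter.Tendsto (fun n => eLpNorm (fun x => ψ n x - b x) 2 surf) Filter.atTop (nhds 0)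

end Sobolev

/-! ### Data, the Lamé system, and the assumptions -/

/-- Data `I = (φ, X, g, h)` with `φ ∈ L¹(0,T)`, `X ∈ (L¹(0,T;L¹(∂Ω)))³`, `g, h ∈ (L²(Ω))³`. -/
structure Data (T : ℝ) where
  phi : Lp ℝ 1 (volTime T)
  X : Fin 3 → Lp ℝ 1 (volLateral T)
  g : Fin 3 → L2Omega
  h : Fin 3 → L2Omega

/-- The inexact data `I'` differ from `I` by at most `ε` in each component. -/
def Close {T : ℝ} (I I' : Data T) (ε : ℝ) : Prop :=
  ‖I'.phi - I.phi‖ ≤ ε ∧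
    ∀ j, ‖I'.X j - I.X j‖ ≤ ε ∧ ‖I'.g j - I.g j‖ ≤ ε ∧ ‖I'.h j - I.h j‖ ≤ ε

/-- The stress tensor for the displacement gradient `d` (where `d j k = ∂u_j/∂x_k`): off the diagonal
`τ_{jk}`, on the diagonal `σ_j`. -/
def stress (lam mu : ℝ) (d : Fin 3 → Fin 3 → L2Omega) (j k : Fin 3) : L2Omega :=
  if j = k then lam • (∑ l, d l l) + (2 * mu) • d j j else mu • (d j k + d k j)

/-- `(u, f)` solves the Lamé system with data `I`, where
`u ∈ (C²([0,T];L²(Ω)) ∩ L²(0,T;H²(Ω)))³` and `f ∈ (L²(Ω))³`. Here `du j k t = ∂u_j(t)/∂x_k` and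
`ddu j k l t = ∂²u_j(t)/∂x_l∂x_k`. -/
def IsSolution (lam mu T : ℝ) (I : Data T) (u : Fin 3 → ℝ → L2Omega) (f : Fin 3 → L2Omega) :
    Prop :=
  (∀ j, ContDiffOn ℝ 2 (u j) (Icc 0 T)) ∧
  ∃ (du : Fin 3 → Fin 3 → ℝ → L2Omega) (ddu : Fin 3 → Fin 3 → Fin 3 → ℝ → L2Omega),
    -- `u ∈ L²(0,T;H²(Ω))`
    (∀ j k, MemLp (du j k) 2 (volTime T)) ∧
    (∀ j k l, MemLp (ddu j k l) 2 (volTime T)) ∧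
    (∀ᵐ t ∂(volTime T), ∀ j k, HasWeakPartial k (u j t) (du j k t)) ∧
    (∀ᵐ t ∂(volTime T), ∀ j k l, HasWeakPartial l (du j k t) (ddu j k l t)) ∧
    -- `u_tt - μ Δu - (λ + μ) ∇ div u = φ f`
    (∀ᵐ t ∂(volTime T), ∀ j,
      iteratedDerivWithin 2 (u j) (Icc 0 T) t - mu • (∑ k, ddu j k k t)
        - (lam + mu) • (∑ k, ddu k k j t) = I.phi t • f j) ∧
    -- initial conditions
    (∀ j, u j 0 = I.g j ∧ derivWithin (u j) (Icc 0 T) 0 = I.h j) ∧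
    -- Dirichlet boundary condition
    (∀ᵐ t ∂(volTime T), ∀ j, HasTrace (u j t) (fun _ => (0 : ℝ))) ∧
    -- surface stress
    (∀ᵐ t ∂(volTime T), ∃ S : Fin 3 → Fin 3 → Pt → ℝ,
      (∀ j k, HasTrace (stress lam mu (fun a b => du a b t) j k) (S j k)) ∧
      ∀ j, ∀ᵐ x ∂surf, ∑ k, S j k x * normal x k = I.X j (t, x))

/-- Condition (W1): near `t = 0`, `φ` keeps its sign and is bounded away from `0`. -/
def W1 {T : ℝ} (I : Data T) : Prop :=
  ∃ Λ ∈ Ioo 0 T, ∃ C > 0,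
    (∀ᵐ t ∂(volTime Λ), C ≤ I.phi t) ∨ (∀ᵐ t ∂(volTime Λ), I.phi t ≤ -C)

/-- Condition (W2'): the observation time is long enough. -/
def W2' (lam mu T : ℝ) : Prop :=
  12 * Real.sqrt 5 * max (1 / Real.sqrt mu) (1 / Real.sqrt (lam + 2 * mu)) < T

/-! ### The information functional `H_j(I)` -/

/-- `|α|₀ = √|α·α|`. -/
def abs0 (α : Fin 3 → ℂ) : ℝ := Real.sqrt ‖∑ i, α i ^ 2‖

/-- The functions `G_k^j(α, x)`. -/
def G (j k : Fin 3) (α : Fin 3 → ℂ) (x : Pt) : ℂ :=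
  if j = k then ∏ i, Complex.cos (α i * x i)
  else -∏ i, if i = j ∨ i = k then Complex.sin (α i * x i) else Complex.cos (α i * x i)

/-- `sinh (c |α|₀ (T - t)) / cosh (c |α|₀ T)`. -/
def K (c T : ℝ) (α : Fin 3 → ℂ) (t : ℝ) : ℝ :=
  Real.sinh (c * abs0 α * (T - t)) / Real.cosh (c * abs0 α * T)

/-- `D₁(I)(α)` is `D √(λ+2μ) I α`, and `D₂(I)(α)` is `D √μ I α`. -/
def D {T : ℝ} (c : ℝ) (I : Data T) (α : Fin 3 → ℂ) : ℝ :=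
  -(abs0 α) ^ 2 * ∫ t in Ioo 0 T, I.phi t * K c T α t

/-- `E_{1j}(I)(α)`, with `c = √(λ+2μ)`. -/
def E1 {T : ℝ} (c : ℝ) (I : Data T) (j : Fin 3) (α : Fin 3 → ℂ) : ℂ :=
  -((c * abs0 α : ℝ) : ℂ) * α j * (∫ x in Omega, ∑ k, α k * (I.g k x : ℂ) * G j k α x)
  - (Real.tanh (c * abs0 α * T) : ℂ) * α j *
      (∫ x in Omega, ∑ k, α k * (I.h k x : ℂ) * G j k α x)
  - ∫ q, (K c T α q.1 : ℂ) * (α j * ∑ k, α k * (I.X k q : ℂ) * G j k α q.2) ∂(volLateral T)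

/-- `E_{2j}(I)(α)`, with `c = √μ`. -/
def E2 {T : ℝ} (c : ℝ) (I : Data T) (j : Fin 3) (α : Fin 3 → ℂ) : ℂ :=
  -((c * abs0 α : ℝ) : ℂ) *
      (∫ x in Omega, (-((abs0 α : ℂ) ^ 2) * (I.g j x : ℂ) * G j j α x
        - α j * ∑ k, α k * (I.g k x : ℂ) * G j k α x))
  - (Real.tanh (c * abs0 α * T) : ℂ) *
      (∫ x in Omega, (-((abs0 α : ℂ) ^ 2) * (I.h j x : ℂ) * G j j α x
        - α j * ∑ k, α k * (I.h k x : ℂ) * G j k α x))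
  + ∫ q, (K c T α q.1 : ℂ) * ((abs0 α : ℂ) ^ 2 * (I.X j q : ℂ) * G j j α q.2
        + α j * ∑ k, α k * (I.X k q : ℂ) * G j k α q.2) ∂(volLateral T)

open Classical in
/-- `H_j(I)(α)`. -/
def H {T : ℝ} (lam mu : ℝ) (I : Data T) (j : Fin 3) (α : Fin 3 → ℂ) : ℂ :=
  if D (Real.sqrt (lam + 2 * mu)) I α * D (Real.sqrt mu) I α ≠ 0 then
    E1 (Real.sqrt (lam + 2 * mu)) I j α / (D (Real.sqrt (lam + 2 * mu)) I α : ℂ)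
      + E2 (Real.sqrt mu) I j α / (D (Real.sqrt mu) I α : ℂ)
  else 0

/-! ### The regularized solution -/

/-- The unique integer of `(ln(ε⁻¹)/60, ln(ε⁻¹)/60 + 1]` (replaced by `0` where it is negative,
which happens only for `ε > 1`). -/
def rEps (ε : ℝ) : ℕ := (⌊Real.log ε⁻¹ / 60⌋ + 1).toNat

open Classical in
/-- The interpolation points `B_r = {±(5r + j) : j = 1, …, 24r}`. -/
def B (r : ℕ) : Finset ℂ :=
  (Finset.Icc 1 (24 * r)).image (fun j : ℕ => (5 * r + j : ℂ)) ∪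
    (Finset.Icc 1 (24 * r)).image (fun j : ℕ => -(5 * r + j : ℂ))

open Classical in
/-- The Lagrange interpolation polynomial `L[A; w]`. -/
def lagrange (A : Finset ℂ) (w : ℂ → ℂ) : Polynomial ℂ := Lagrange.interpolate A id w

/-- `𝓕_ε(m,n,p) = L[B_{r_ε}; H_j(I_ε)(-i·, nπ, pπ)](imπ)`. -/
def FEps {T : ℝ} (lam mu : ℝ) (I : Data T) (j : Fin 3) (ε : ℝ) (m n p : ℕ) : ℂ :=
  (lagrange (B (rEps ε)) fun z =>
      H lam mu I j ![-Complex.I * z, (n : ℂ) * (Real.pi : ℂ), (p : ℂ) * (Real.pi : ℂ)]).eval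
    (Complex.I * (m : ℂ) * (Real.pi : ℂ))

/-- `κ(m,n,p)`. -/
def kappa (m n p : ℕ) : ℂ :=
  (1 + if m ≠ 0 then 1 else 0) * (1 + if n ≠ 0 then 1 else 0) * (1 + if p ≠ 0 then 1 else 0)

/-- The regularized solution `f_j^ε`, constructed from the data `I`. -/
def fEps {T : ℝ} (lam mu : ℝ) (I : Data T) (ε : ℝ) (j : Fin 3) (x : Pt) : ℂ :=
  ∑ m ∈ Finset.range (rEps ε + 1), ∑ n ∈ Finset.range (rEps ε + 1),
    ∑ p ∈ Finset.range (rEps ε + 1),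
      kappa m n p * FEps lam mu I j ε m n p *
        G 0 0 ![(m : ℂ) * (Real.pi : ℂ), (n : ℂ) * (Real.pi : ℂ), (p : ℂ) * (Real.pi : ℂ)] x

/-- The error `f_j^ε - f_j⁰`. -/
def err {T : ℝ} (lam mu : ℝ) (I : Data T) (ε : ℝ) (f : Fin 3 → L2Omega) (j : Fin 3) (x : Pt) : ℂ :=
  fEps lam mu I ε j x - (f j x : ℂ)

end

end Lame

/-!
Fix a solution `(u, f)` for the exact data. If `V` is a smooth real eigenfield of the Lamé operator,
`μ ΔV + (λ + μ) ∇ div V = a² V`, then testing the system with `V(x) sinh (a (T - t)) / cosh (a T)`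
gives an identity that expresses `(∫ φ(t) sinh (a (T - t)) / cosh (a T) dt) (∫ f · V)` through `g`,
`h`, `X` and a remainder with `u(T)` that is exponentially small in `a T` (`IsSolution.identity`).
By (W1) the integral over `φ` is at least of order `1/a` (`W1.exists_le_abs_phiInt`), so that one
may divide by it, also for inexact data (`IsSolution.exists_stability`). At `α = (-iz, b, d)` the
functional `H_j` is the difference of these quotients for a gradient and a divergence-free
eigenfield, the difference of which is `|α|₀² G` in the component `j` and zero in the others. By
(W2') the remainders are `O(e^{-12 |z|})`, whence `H_j` is `∫ f_j cosh (z x₀) cos (b x₁) cos (d x₂)`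
up to `O(z² e^{|z|} (ε + e^{-12 |z|}))` (`IsSolution.exists_H_bound`).

The cosine coefficients of `f_j` are values of this entire function of `z` at `z = i m π`, and they
are recovered by Lagrange interpolation from the real points `B r`. The basis polynomials are at
most `24 r e^{29 r}` there (`norm_lagBasis_le`), which the choice `ε ≈ e^{-60 r}` outweighs, and the
interpolation error of the kernel `cosh (z x₀)` is `O(e^{-r})` by Cauchy's formula on the circle of
radius `55 r` (`norm_cosh_sub_sum_lagBasis_le`). Thus all coefficients with frequencies up to `r`
are found with an error `O(r⁴ e^{-r})` (`IsSolution.exists_FEps_bound`), and the error of the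
regularized solution is that of the partial sums of the cosine series of `f_j`, up to `O(1/r)`
(`IsSolution.exists_err_bound`).

The rest is Fourier analysis with the orthonormal bases `trigBasis σ` of `L²(Ω)`, made of a sine or
a cosine in each coordinate. The derivative `∂_i` turns the partial cosine sum of `f_j` into the
partial sum of `∂_i f_j` with sines in the coordinate `i` (`sum_mul_pd_trigProd`), which yields
convergence in `H¹`. The rates come from Bessel's inequality for the weak derivatives
(`sum_trigCoeff_sq_le_of_hasWeakPartial`). In the sine direction boundary terms occur, since
`∂_i f_j` need not vanish on the faces; they reduce the rate for `∂_i f_j` from `r⁻¹` to `r^{-1/2}`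
(`sum_trigCoeff_sq_le_of_sin`). As `r` is proportional to `ln (ε⁻¹)`, this is more than is claimed.
Finally, convergence shows that the data determine the source (`IsSolution.unique`), so that the
constants do not depend on the solution that was fixed.
-/

namespace Lame
noncomputable section

/-! ### Lebesgue measure on the cube -/

lemma Omega_subset_Icc : Omega ⊆ Icc (0 : Pt) 1 := by
  intro x hx
  exact ⟨fun i => (hx i trivial).1.le, fun i => (hx i trivial).2.le⟩

lemma isOpen_Omega : IsOpen Omega := isOpen_set_pi Set.finite_univ fun _ _ => isOpen_Ioo

lemma measurableSet_Omega : MeasurableSet Omega := isOpen_Omega.measurableSet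

lemma volume_Omega : volume Omega = 1 := by
  rw [Omega, volume_pi_pi]; simp

instance : IsProbabilityMeasure volOmega :=
  ⟨by rw [Measure.restrict_apply_univ, volume_Omega]⟩

lemma volOmega_eq_pi : volOmega = Measure.pi fun _ : Fin 3 => volume.restrict (Ioo (0 : ℝ) 1) := by
  rw [volOmega, Omega, volume_pi, Measure.restrict_pi_pi]

lemma exists_bound_Icc {F : Type*} [NormedAddCommGroup F] {f : Pt → F} (hf : Continuous f) :
    ∃ C : ℝ, 0 ≤ C ∧ ∀ x ∈ Icc (0 : Pt) 1, ‖f x‖ ≤ C := by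
  obtain ⟨C, hC⟩ := (isCompact_Icc (a := (0 : Pt)) (b := 1)).exists_bound_of_continuousOn
    hf.continuousOn
  exact ⟨max C 0, le_max_right _ _, fun x hx => (hC x hx).trans (le_max_left _ _)⟩

lemma _root_.Continuous.memLp_volOmega {F : Type*} [NormedAddCommGroup F] {f : Pt → F}
    (hf : Continuous f) (p : ENNReal) : MemLp f p volOmega := by
  obtain ⟨C, -, hC⟩ := exists_bound_Icc hf
  refine MemLp.of_bound hf.aestronglyMeasurable C ?_
  filter_upwards [ae_restrict_mem measurableSet_Omega] with x hx
  exact hC x (Omega_subset_Icc hx)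

lemma integrable_mul_of_continuous {f g : Pt → ℝ} (hf : Integrable f volOmega)
    (hg : Continuous g) : Integrable (fun x => f x * g x) volOmega := by
  obtain ⟨C, -, hC⟩ := exists_bound_Icc hg
  refine (hf.bdd_mul (c := C) hg.aestronglyMeasurable ?_).congr
    (Filter.Eventually.of_forall fun x => mul_comm _ _)
  filter_upwards [ae_restrict_mem measurableSet_Omega] with x hx
  exact hC x (Omega_subset_Icc hx)

/-- A function orthogonal to all test functions vanishes. -/
lemma ae_eq_zero_of_forall_integral {f : Pt → ℝ} (hf : Integrable f volOmega)
    (h : ∀ ψ : Pt → ℝ, ContDiff ℝ ((⊤ : ℕ∞) : WithTop ℕ∞) ψ → HasCompactSupport ψ →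
      tsupport ψ ⊆ Omega → ∫ x in Omega, ψ x * f x = 0) : f =ᵐ[volOmega] 0 := by
  have h1 := isOpen_Omega.ae_eq_zero_of_integral_contDiff_smul_eq_zero (μ := volume) (f := f)
    (IntegrableOn.locallyIntegrableOn hf) (fun g hg hc hs => by
      rw [← h g hg hc hs, ← setIntegral_eq_integral_of_forall_compl_eq_zero (s := Omega)]
      · rfl
      · intro x hx
        rw [image_eq_zero_of_notMem_tsupport (fun hx' => hx (hs hx')), zero_smul])
  exact (ae_restrict_iff' measurableSet_Omega).2 h1

/-! ### Trigonometric bases of `L²(Ω)` -/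

/-- The orthonormal cosine (`τ = false`) and sine (`τ = true`) systems of `L²(0,1)`. The sine system
is indexed from `0`, so that its `m`-th member has frequency `m + 1`. -/
def trig (τ : Bool) (m : ℕ) (x : ℝ) : ℝ :=
  if τ then √2 * Real.sin ((m + 1) * Real.pi * x)
  else (if m = 0 then 1 else √2) * Real.cos (m * Real.pi * x)

/-- The product functions `∏ i, trig (σ i) (k i) (x i)`: a sine in the coordinates with
`σ i = true`, a cosine in the others. -/
def trigProd (σ : Fin 3 → Bool) (k : Fin 3 → ℕ) (x : Pt) : ℝ := ∏ i, trig (σ i) (k i) (x i)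

lemma contDiff_trig (τ : Bool) (m : ℕ) {n : WithTop ℕ∞} : ContDiff ℝ n (trig τ m) := by
  unfold trig
  cases τ <;> simp only [Bool.false_eq_true, if_true, if_false] <;> fun_prop

lemma contDiff_trigProd (σ : Fin 3 → Bool) (k : Fin 3 → ℕ) {n : WithTop ℕ∞} :
    ContDiff ℝ n (trigProd σ k) := by
  unfold trigProd
  exact contDiff_prod fun i _ => (contDiff_trig _ _).comp (contDiff_apply ℝ ℝ i)

lemma continuous_trigProd (σ : Fin 3 → Bool) (k : Fin 3 → ℕ) : Continuous (trigProd σ k) :=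
  (contDiff_trigProd σ k (n := 0)).continuous

lemma integral_cos_int (k : ℤ) :
    ∫ x in (0 : ℝ)..1, Real.cos (k * Real.pi * x) = if k = 0 then 1 else 0 := by
  split_ifs with h
  · simp [h]
  · have hk : (k : ℝ) * Real.pi ≠ 0 := mul_ne_zero (by exact_mod_cast h) Real.pi_ne_zero
    rw [intervalIntegral.integral_comp_mul_left (fun x => Real.cos x) hk, integral_cos]
    simp [Real.sin_int_mul_pi]

lemma integral_trig_mul (τ : Bool) (m n : ℕ) :
    ∫ x in Ioo (0 : ℝ) 1, trig τ m x * trig τ n x = if m = n then 1 else 0 := by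
  have h2 : (√2 : ℝ) * √2 = 2 := Real.mul_self_sqrt (by norm_num)
  have hint : ∀ a : ℤ, IntervalIntegrable (fun x : ℝ => Real.cos (a * Real.pi * x)) volume 0 1 :=
    fun a => (by fun_prop : Continuous fun x : ℝ => Real.cos (a * Real.pi * x)).intervalIntegrable _ _
  rw [← integral_Ioc_eq_integral_Ioo, ← intervalIntegral.integral_of_le zero_le_one]
  cases τ
  · have e : ∀ x, trig false m x * trig false n x =
        ((if m = 0 then 1 else √2) * (if n = 0 then 1 else √2) / 2) *
          (Real.cos (((m - n : ℤ) : ℝ) * Real.pi * x)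
            + Real.cos (((m + n : ℤ) : ℝ) * Real.pi * x)) := by
      intro x
      have h1 := Real.cos_sub (m * Real.pi * x) (n * Real.pi * x)
      have h3 := Real.cos_add (m * Real.pi * x) (n * Real.pi * x)
      simp only [trig, Bool.false_eq_true, if_false]
      push_cast
      rw [show ((m : ℝ) - n) * Real.pi * x = m * Real.pi * x - n * Real.pi * x by ring,
        show ((m : ℝ) + n) * Real.pi * x = m * Real.pi * x + n * Real.pi * x by ring, h1, h3]
      ring
    simp_rw [e]
    rw [intervalIntegral.integral_const_mul, intervalIntegral.integral_add (hint _) (hint _),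
      integral_cos_int, integral_cos_int]
    by_cases hmn : m = n
    · subst hmn
      by_cases hm : m = 0
      · simp [hm]; norm_num
      · have : ¬ ((m : ℤ) + m = 0) := by omega
        simp [hm, this, h2]
    · have h1 : ¬ ((m : ℤ) - n = 0) := by omega
      have h3 : ¬ ((m : ℤ) + n = 0) := by omega
      simp [hmn, h1, h3]
  · have e : ∀ x, trig true m x * trig true n x =
        Real.cos (((m - n : ℤ) : ℝ) * Real.pi * x)
            - Real.cos (((m + n + 2 : ℤ) : ℝ) * Real.pi * x) := by
      intro x
      have h1 := Real.cos_sub ((m + 1) * Real.pi * x) ((n + 1) * Real.pi * x)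
      have h3 := Real.cos_add ((m + 1) * Real.pi * x) ((n + 1) * Real.pi * x)
      simp only [trig, if_true]
      push_cast
      rw [show ((m : ℝ) - n) * Real.pi * x = (m + 1) * Real.pi * x - (n + 1) * Real.pi * x by ring,
        show ((m : ℝ) + n + 2) * Real.pi * x = (m + 1) * Real.pi * x + (n + 1) * Real.pi * x by ring,
        h1, h3]
      linear_combination (Real.sin ((m + 1) * Real.pi * x) * Real.sin ((n + 1) * Real.pi * x)) * h2
    simp_rw [e]
    rw [intervalIntegral.integral_sub (hint _) (hint _), integral_cos_int, integral_cos_int]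
    have h3 : ¬ ((m : ℤ) + n + 2 = 0) := by omega
    by_cases hmn : m = n
    · subst hmn; simp [h3]
    · have h1 : ¬ ((m : ℤ) - n = 0) := by omega
      simp [hmn, h1, h3]

/-- Fubini for products of functions of one variable. -/
lemma integral_Omega_prod (a : Fin 3 → ℝ → ℝ) :
    ∫ x in Omega, ∏ i, a i (x i) = ∏ i, ∫ t in Ioo (0 : ℝ) 1, a i t := by
  rw [← integral_fintype_prod_eq_prod (fun i => a i), ← volOmega_eq_pi]

lemma integral_trigProd_mul (σ : Fin 3 → Bool) (k l : Fin 3 → ℕ) :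
    ∫ x in Omega, trigProd σ k x * trigProd σ l x = if k = l then 1 else 0 := by
  simp_rw [trigProd, ← Finset.prod_mul_distrib]
  rw [integral_Omega_prod (fun i t => trig (σ i) (k i) t * trig (σ i) (l i) t)]
  simp_rw [integral_trig_mul]
  rw [Finset.prod_ite_zero]
  simp [funext_iff]

/-- A continuous function as an element of `L²(Ω)`. -/
def contToL2 (f : Pt → ℝ) (hf : Continuous f) : L2Omega := (hf.memLp_volOmega 2).toLp f

/-- The class of `trigProd σ k` in `L²(Ω)`. -/
def trigL2 (σ : Fin 3 → Bool) (k : Fin 3 → ℕ) : L2Omega :=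
  contToL2 (trigProd σ k) (continuous_trigProd σ k)

lemma inner_contToL2 (f : Pt → ℝ) (hf : Continuous f) (v : L2Omega) :
    inner ℝ (contToL2 f hf) v = ∫ x in Omega, f x * v x := by
  rw [L2.inner_def]
  refine integral_congr_ae ?_
  filter_upwards [(hf.memLp_volOmega 2).coeFn_toLp] with x hx
  simp only [contToL2]
  rw [hx]
  simp [mul_comm]

lemma orthonormal_trigL2 (σ : Fin 3 → Bool) : Orthonormal ℝ (trigL2 σ) := by
  rw [orthonormal_iff_ite]
  intro k l
  rw [trigL2, inner_contToL2, ← integral_trigProd_mul σ k l]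
  refine integral_congr_ae ?_
  filter_upwards [((continuous_trigProd σ l).memLp_volOmega 2).coeFn_toLp] with x hx
  simp only [trigL2, contToL2]
  rw [hx]

/-- The product-to-sum formulas: multiplication by `cos (π x)` keeps the span of each of the two
systems, so that their spans are modules over the algebra generated by `cos (π x)`. -/
lemma cos_mul_trig (τ : Bool) (m : ℕ) : ∃ (a b : ℝ) (m' n' : ℕ), ∀ x,
    Real.cos (Real.pi * x) * trig τ m x = a * trig τ m' x + b * trig τ n' x := by
  have h2 : (√2 : ℝ) ≠ 0 := by positivity
  cases τ
  · rcases m with _ | m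
    · refine ⟨1 / √2, 0, 1, 0, fun x => ?_⟩
      simp [trig]
    · refine ⟨1 / 2, (if m = 0 then √2 else 1) / 2, m + 2, m, fun x => ?_⟩
      have h1 := Real.cos_add ((m + 1) * Real.pi * x) (Real.pi * x)
      have h3 := Real.cos_sub ((m + 1) * Real.pi * x) (Real.pi * x)
      rw [show (m + 1) * Real.pi * x + Real.pi * x = (m + 2) * Real.pi * x by ring] at h1
      rw [show (m + 1) * Real.pi * x - Real.pi * x = m * Real.pi * x by ring] at h3
      simp only [trig, Bool.false_eq_true, if_false]
      by_cases hm : m = 0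
      · subst hm
        simp at h1 h3 ⊢
        rw [h1]
        linear_combination (-√2 / 2) * h3
      · simp [hm]
        rw [h1, h3]; ring
  · rcases m with _ | m
    · refine ⟨1 / 2, 0, 1, 0, fun x => ?_⟩
      have h1 := Real.sin_two_mul (Real.pi * x)
      simp only [trig, if_true]
      norm_num
      rw [mul_assoc 2, h1]; ring
    · refine ⟨1 / 2, 1 / 2, m + 2, m, fun x => ?_⟩
      have h1 := Real.sin_add ((m + 2) * Real.pi * x) (Real.pi * x)
      have h3 := Real.sin_sub ((m + 2) * Real.pi * x) (Real.pi * x)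
      rw [show (m + 2) * Real.pi * x + Real.pi * x = (m + 2 + 1) * Real.pi * x by ring] at h1
      rw [show (m + 2) * Real.pi * x - Real.pi * x = (m + 1) * Real.pi * x by ring] at h3
      simp only [trig, if_true]
      push_cast
      rw [h1, h3, show ((m : ℝ) + 1 + 1) = m + 2 by ring]; ring

lemma cos_mul_trigProd (σ : Fin 3 → Bool) (k : Fin 3 → ℕ) (i : Fin 3) :
    (fun x : Pt => Real.cos (Real.pi * x i) * trigProd σ k x) ∈
      Submodule.span ℝ (range (trigProd σ)) := by
  obtain ⟨a, b, m', n', h⟩ := cos_mul_trig (σ i) (k i)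
  have key : (fun x : Pt => Real.cos (Real.pi * x i) * trigProd σ k x) =
      a • trigProd σ (Function.update k i m') + b • trigProd σ (Function.update k i n') := by
    funext x
    have e : ∀ l, trigProd σ (Function.update k i l) x =
        trig (σ i) l (x i) * ∏ q ∈ Finset.univ.erase i, trig (σ q) (k q) (x q) := by
      intro l
      rw [trigProd, ← Finset.mul_prod_erase _ _ (Finset.mem_univ i)]
      rw [Function.update_self]
      congr 1
      refine Finset.prod_congr rfl fun q hq => ?_
      rw [Function.update_of_ne (Finset.ne_of_mem_erase hq)]
    have e2 := e (k i)
    rw [Function.update_eq_self] at e2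
    simp only [Pi.add_apply, Pi.smul_apply, smul_eq_mul]
    rw [e, e, e2, ← mul_assoc, h]; ring
  rw [key]
  exact Submodule.add_mem _ (Submodule.smul_mem _ _ (Submodule.subset_span ⟨_, rfl⟩))
    (Submodule.smul_mem _ _ (Submodule.subset_span ⟨_, rfl⟩))

/-- The coordinate functions `cos (π x i)` on the closed cube. -/
def cosCoord (i : Fin 3) : C(Icc (0 : Pt) 1, ℝ) :=
  ⟨fun x => Real.cos (Real.pi * (x : Pt) i), Real.continuous_cos.comp
    (continuous_const.mul ((continuous_apply i).comp continuous_subtype_val))⟩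

/-- By the Stone–Weierstrass theorem, polynomials in `cos (π x i)` are dense in the continuous
functions on the closed cube. -/
lemma adjoin_cosCoord_dense :
    (Algebra.adjoin ℝ (range cosCoord)).topologicalClosure = ⊤ := by
  apply ContinuousMap.subalgebra_topologicalClosure_eq_top_of_separatesPoints
  intro x y hxy
  have : ∃ i, (x : Pt) i ≠ (y : Pt) i := by
    by_contra! h
    exact hxy (Subtype.ext (funext h))
  obtain ⟨i, hi⟩ := this
  refine ⟨_, ⟨cosCoord i, Algebra.subset_adjoin ⟨i, rfl⟩, rfl⟩, fun h => hi ?_⟩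
  have hx := x.2; have hy := y.2
  have h' := Real.injOn_cos (x₁ := Real.pi * (x : Pt) i) (x₂ := Real.pi * (y : Pt) i)
    ⟨mul_nonneg Real.pi_pos.le (hx.1 i), by simpa using mul_le_mul_of_nonneg_left (hx.2 i) Real.pi_pos.le⟩
    ⟨mul_nonneg Real.pi_pos.le (hy.1 i), by simpa using mul_le_mul_of_nonneg_left (hy.2 i) Real.pi_pos.le⟩ h
  exact mul_left_cancel₀ Real.pi_ne_zero h'

lemma trigProd_zero_pos (σ : Fin 3 → Bool) {x : Pt} (hx : x ∈ Omega) : 0 < trigProd σ 0 x := by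
  refine Finset.prod_pos fun i _ => ?_
  have hi := hx i trivial
  cases h : σ i
  · simp [trig]
  · simp only [trig, if_true, Pi.zero_apply, Nat.cast_zero, zero_add, one_mul]
    refine mul_pos (by positivity) (Real.sin_pos_of_pos_of_lt_pi (mul_pos Real.pi_pos hi.1) ?_)
    simpa using mul_lt_mul_of_pos_left hi.2 Real.pi_pos

/-- Completeness of the system `trigProd σ`: its span is stable under multiplication by the
functions `cos (π x i)`, hence contains `trigProd σ 0` times a dense set of continuous functions. -/
lemma ae_eq_zero_of_orthogonal_trigProd (σ : Fin 3 → Bool) {v : Pt → ℝ} (hv : Integrable v volOmega)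
    (h : ∀ k, ∫ x in Omega, trigProd σ k x * v x = 0) : v =ᵐ[volOmega] 0 := by
  set W := Submodule.span ℝ (range (trigProd σ)) with hW
  have hWc : ∀ w ∈ W, Continuous w := by
    intro w hw
    induction hw using Submodule.span_induction with
    | mem x hx => obtain ⟨k, rfl⟩ := hx; exact continuous_trigProd σ k
    | zero => exact continuous_const
    | add x y _ _ hx hy => exact hx.add hy
    | smul a x _ hx => exact hx.const_smul a
  have hvW : ∀ w ∈ W, Integrable (fun x => w x * v x) volOmega := fun w hw => by
    simpa only [mul_comm] using integrable_mul_of_continuous hv (hWc w hw)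
  have hW0 : ∀ w ∈ W, ∫ x in Omega, w x * v x = 0 := by
    intro w hw
    induction hw using Submodule.span_induction with
    | mem x hx => obtain ⟨k, rfl⟩ := hx; exact h k
    | zero => simp
    | add x y hx' hy' hx hy =>
      simp only [Pi.add_apply, add_mul]
      rw [integral_add (hvW x hx') (hvW y hy'), hx, hy, add_zero]
    | smul a x _ hx =>
      simp only [Pi.smul_apply, smul_eq_mul, mul_assoc]
      rw [integral_const_mul, hx, mul_zero]
  -- the algebra generated by the cosines maps `W` to itself
  have hstab : ∀ a ∈ Algebra.adjoin ℝ (range cosCoord), ∀ w ∈ W, ∃ w' ∈ W,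
      ∀ x : Icc (0 : Pt) 1, w' x = a x * w x := by
    intro a ha
    induction ha using Algebra.adjoin_induction with
    | mem a ha =>
      obtain ⟨i, rfl⟩ := ha
      intro w hw
      refine ⟨fun x => Real.cos (Real.pi * x i) * w x, ?_, fun x => rfl⟩
      induction hw using Submodule.span_induction with
      | mem x hx => obtain ⟨k, rfl⟩ := hx; exact cos_mul_trigProd σ k i
      | zero => convert W.zero_mem using 1; funext z; simp
      | add x y _ _ hx hy => convert W.add_mem hx hy using 1; funext z; simp [mul_add]
      | smul c x _ hx =>
        convert W.smul_mem c hx using 1; funext z; simp [mul_left_comm]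
    | algebraMap c => intro w hw; exact ⟨c • w, W.smul_mem c hw, fun x => rfl⟩
    | add a b _ _ iha ihb =>
      intro w hw
      obtain ⟨w1, h1, e1⟩ := iha w hw
      obtain ⟨w2, h2, e2⟩ := ihb w hw
      exact ⟨w1 + w2, W.add_mem h1 h2, fun x => by simp [e1, e2, add_mul]⟩
    | mul a b _ _ iha ihb =>
      intro w hw
      obtain ⟨w2, h2, e2⟩ := ihb w hw
      obtain ⟨w1, h1, e1⟩ := iha w2 h2
      exact ⟨w1, h1, fun x => by simp [e1, e2, mul_assoc]⟩
  have hw0 : trigProd σ 0 ∈ W := Submodule.subset_span ⟨0, rfl⟩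
  obtain ⟨M, hM0, hM⟩ := exists_bound_Icc (continuous_trigProd σ 0)
  have hv0 : (fun x => trigProd σ 0 x * v x) =ᵐ[volOmega] 0 := by
    refine ae_eq_zero_of_forall_integral (hvW _ hw0) fun ψ hψ _ _ => ?_
    rw [← norm_le_zero_iff]
    refine le_of_forall_pos_le_add fun δ hδ => ?_
    set N := M * ∫ x in Omega, ‖v x‖ with hN
    have hN0 : 0 ≤ N := mul_nonneg hM0 (integral_nonneg fun _ => norm_nonneg _)
    set ψc : C(Icc (0 : Pt) 1, ℝ) := ⟨fun x => ψ x, hψ.continuous.comp continuous_subtype_val⟩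
    have hmem : ψc ∈ (Algebra.adjoin ℝ (range cosCoord)).topologicalClosure := by
      rw [adjoin_cosCoord_dense]; trivial
    obtain ⟨a, ha, hda⟩ := Metric.mem_closure_iff.1 hmem (δ / (N + 1)) (by positivity)
    obtain ⟨w, hw, ew⟩ := hstab a ha _ hw0
    have hi1 : Integrable (fun x => ψ x * (trigProd σ 0 x * v x)) volOmega := by
      simpa only [mul_comm] using integrable_mul_of_continuous (hvW _ hw0) hψ.continuous
    have : ∫ x in Omega, ψ x * (trigProd σ 0 x * v x) =
        ∫ x in Omega, (ψ x * (trigProd σ 0 x * v x) - w x * v x) := by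
      rw [integral_sub hi1 (hvW w hw), hW0 w hw, sub_zero]
    rw [this]
    have hb : ‖∫ x in Omega, (ψ x * (trigProd σ 0 x * v x) - w x * v x)‖ ≤
        ∫ x in Omega, (δ / (N + 1) * M) * ‖v x‖ := by
      refine norm_integral_le_of_norm_le (hv.norm.const_mul _) ?_
      filter_upwards [ae_restrict_mem measurableSet_Omega] with x hx
      have hx' := Omega_subset_Icc hx
      have e : w x = a ⟨x, hx'⟩ * trigProd σ 0 x := ew ⟨x, hx'⟩
      have hd : |ψ x - a ⟨x, hx'⟩| ≤ δ / (N + 1) :=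
        (ContinuousMap.dist_apply_le_dist (f := ψc) (g := a) ⟨x, hx'⟩).trans hda.le
      rw [e, show ψ x * (trigProd σ 0 x * v x) - a ⟨x, hx'⟩ * trigProd σ 0 x * v x =
        (ψ x - a ⟨x, hx'⟩) * trigProd σ 0 x * v x by ring, norm_mul, norm_mul]
      gcongr
      · exact hd
      · exact hM x hx'
    rw [integral_const_mul, mul_assoc, ← hN] at hb
    refine hb.trans ?_
    rw [zero_add, div_mul_eq_mul_div, div_le_iff₀ (by positivity)]
    nlinarith
  filter_upwards [hv0, ae_restrict_mem measurableSet_Omega] with x hx hxm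
  exact (mul_eq_zero.1 hx).resolve_left (trigProd_zero_pos σ hxm).ne'

/-- The Hilbert basis of `L²(Ω)` formed by the functions `trigProd σ k`. -/
def trigBasis (σ : Fin 3 → Bool) : HilbertBasis (Fin 3 → ℕ) ℝ L2Omega :=
  HilbertBasis.mkOfOrthogonalEqBot (orthonormal_trigL2 σ) (by
    rw [Submodule.eq_bot_iff]
    intro v hv
    rw [Submodule.mem_orthogonal] at hv
    have hvi : Integrable v volOmega := (Lp.memLp v).integrable (by norm_num)
    have := ae_eq_zero_of_orthogonal_trigProd σ hvi fun k => by
      rw [← inner_contToL2 _ (continuous_trigProd σ k)]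
      exact hv _ (Submodule.subset_span ⟨k, rfl⟩)
    exact (Lp.eq_zero_iff_ae_eq_zero).2 this)

lemma trigBasis_apply (σ : Fin 3 → Bool) (k : Fin 3 → ℕ) : trigBasis σ k = trigL2 σ k := by
  simp [trigBasis]

/-! ### Weak derivatives -/

section WeakDerivatives

variable {F : Type*} [NormedAddCommGroup F] [NormedSpace ℝ F]

/-- The classical partial derivative `∂f/∂x_i`. -/
def pd (i : Fin 3) (f : Pt → F) (x : Pt) : F := fderiv ℝ f x (Pi.single i 1)

lemma _root_.ContDiff.pd {i : Fin 3} {f : Pt → F}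
    (hf : ContDiff ℝ ((⊤ : ℕ∞) : WithTop ℕ∞) f) :
    ContDiff ℝ ((⊤ : ℕ∞) : WithTop ℕ∞) (Lame.pd i f) :=
  (hf.fderiv_right (m := ((⊤ : ℕ∞) : WithTop ℕ∞)) (by simp)).clm_apply contDiff_const

lemma pd_mul {i : Fin 3} {f g : Pt → ℝ} (hf : Differentiable ℝ f) (hg : Differentiable ℝ g)
    (x : Pt) : pd i (fun y => f y * g y) x = f x * pd i g x + g x * pd i f x := by
  simp [pd, fderiv_fun_mul (hf x) (hg x)]

lemma hasWeakPartial_of_contDiff {i : Fin 3} {f : Pt → F}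
    (hf : ContDiff ℝ ((⊤ : ℕ∞) : WithTop ℕ∞) f) : HasWeakPartial i f (pd i f) := by
  intro ψ hψ hc hs
  have hψ1 : Differentiable ℝ ψ := hψ.differentiable (by simp)
  have hf1 : Differentiable ℝ f := hf.differentiable (by simp)
  have hdψ : ContDiff ℝ ((⊤ : ℕ∞) : WithTop ℕ∞) (fun x => fderiv ℝ ψ x (Pi.single i 1)) := hψ.pd
  have hcd : HasCompactSupport (fun x => fderiv ℝ ψ x (Pi.single i 1)) :=
    hc.fderiv_apply (𝕜 := ℝ) _
  have h1 : ∀ x ∉ Omega, fderiv ℝ ψ x (Pi.single i 1) • f x = 0 := fun x hx => by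
    rw [image_eq_zero_of_notMem_tsupport (f := fun x => fderiv ℝ ψ x (Pi.single i 1))
      (fun h' => hx (hs (tsupport_fderiv_apply_subset ℝ _ h'))), zero_smul]
  have h2 : ∀ x ∉ Omega, ψ x • pd i f x = 0 := fun x hx => by
    rw [image_eq_zero_of_notMem_tsupport (fun h' => hx (hs h')), zero_smul]
  rw [setIntegral_eq_integral_of_forall_compl_eq_zero h1,
    setIntegral_eq_integral_of_forall_compl_eq_zero h2]
  rw [show (∫ x, ψ x • pd i f x) = ∫ x, ψ x • fderiv ℝ f x (Pi.single i 1) from rfl,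
    integral_smul_fderiv_eq_neg_fderiv_smul_of_integrable, neg_neg]
  · exact (hdψ.continuous.smul hf.continuous).integrable_of_hasCompactSupport hcd.smul_right
  · exact (hψ.continuous.smul hf.pd.continuous).integrable_of_hasCompactSupport hc.smul_right
  · exact (hψ.continuous.smul hf.continuous).integrable_of_hasCompactSupport hc.smul_right
  · exact fun x _ => hψ1 x
  · exact fun x _ => hf1 x

/-- Integrability of a test function or of its derivative against an integrable function. -/
lemma integrable_smul_of_continuous {f : Pt → F} {g : Pt → ℝ} (hf : Integrable f volOmega)
    (hg : Continuous g) : Integrable (fun x => g x • f x) volOmega := by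
  obtain ⟨C, -, hC⟩ := exists_bound_Icc hg
  refine hf.bdd_smul C hg.aestronglyMeasurable ?_
  filter_upwards [ae_restrict_mem measurableSet_Omega] with x hx
  exact hC x (Omega_subset_Icc hx)

lemma HasWeakPartial.sub {i : Fin 3} {w v w' v' : Pt → F} (h : HasWeakPartial i w v)
    (h' : HasWeakPartial i w' v') (hw : Integrable w volOmega) (hv : Integrable v volOmega)
    (hw' : Integrable w' volOmega) (hv' : Integrable v' volOmega) :
    HasWeakPartial i (fun x => w x - w' x) (fun x => v x - v' x) := by
  intro ψ hψ hc hs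
  have hdψ : Continuous (fun x => fderiv ℝ ψ x (Pi.single i 1)) :=
    (ContDiff.pd (i := i) hψ).continuous
  simp only [smul_sub]
  rw [integral_sub (integrable_smul_of_continuous hw hdψ) (integrable_smul_of_continuous hw' hdψ),
    integral_sub (integrable_smul_of_continuous hv hψ.continuous)
      (integrable_smul_of_continuous hv' hψ.continuous), h ψ hψ hc hs, h' ψ hψ hc hs]
  abel

lemma HasWeakPartial.ofReal {i : Fin 3} {w v : Pt → ℝ} (h : HasWeakPartial i w v) :
    HasWeakPartial i (fun x => (w x : ℂ)) (fun x => (v x : ℂ)) := by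
  intro ψ hψ hc hs
  have := h ψ hψ hc hs
  simp only [smul_eq_mul, Complex.real_smul, ← Complex.ofReal_mul, integral_complex_ofReal] at this ⊢
  rw [this, Complex.ofReal_neg]

lemma HasWeakPartial.congr {i : Fin 3} {w v w' v' : Pt → F} (h : HasWeakPartial i w v)
    (hw : w =ᵐ[volOmega] w') (hv : v =ᵐ[volOmega] v') : HasWeakPartial i w' v' := by
  intro ψ hψ hc hs
  rw [integral_congr_ae (g := fun x => fderiv ℝ ψ x (Pi.single i 1) • w x)
    (hw.mono fun x hx => by simp only [hx]), integral_congr_ae (f := fun x => ψ x • v' x)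
    (g := fun x => ψ x • v x) (hv.mono fun x hx => by simp only [hx]), h ψ hψ hc hs]

lemma HasWeakPartial.unique {i : Fin 3} {w v v' : Pt → ℝ} (h : HasWeakPartial i w v)
    (h' : HasWeakPartial i w v') (hv : Integrable v volOmega) (hv' : Integrable v' volOmega) :
    v =ᵐ[volOmega] v' := by
  have := ae_eq_zero_of_forall_integral (hv.sub hv') fun ψ hψ hc hs => by
    have e1 := h ψ hψ hc hs
    have e2 := h' ψ hψ hc hs
    simp only [smul_eq_mul] at e1 e2
    simp only [Pi.sub_apply, mul_sub]
    rw [integral_sub (by simpa using integrable_smul_of_continuous hv hψ.continuous)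
      (by simpa using integrable_smul_of_continuous hv' hψ.continuous)]
    linarith
  filter_upwards [this] with x hx
  simpa [sub_eq_zero] using hx

/-- Weak second derivatives commute. -/
lemma HasWeakPartial.symm {i j : Fin 3} {w vi vj vij vji : Pt → ℝ}
    (hi : HasWeakPartial i w vi) (hj : HasWeakPartial j w vj)
    (hij : HasWeakPartial j vi vij) (hji : HasWeakPartial i vj vji)
    (h1 : Integrable vij volOmega) (h2 : Integrable vji volOmega) : vij =ᵐ[volOmega] vji := by
  have := ae_eq_zero_of_forall_integral (h1.sub h2) fun ψ hψ hc hs => by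
    have hd : ∀ l : Fin 3, ContDiff ℝ ((⊤ : ℕ∞) : WithTop ℕ∞)
        (fun x => fderiv ℝ ψ x (Pi.single l 1)) := fun l => hψ.pd
    have hcl : ∀ l : Fin 3, HasCompactSupport (fun x => fderiv ℝ ψ x (Pi.single l 1)) :=
      fun l => hc.fderiv_apply (𝕜 := ℝ) _
    have hsl : ∀ l : Fin 3, tsupport (fun x => fderiv ℝ ψ x (Pi.single l 1)) ⊆ Omega :=
      fun l => (tsupport_fderiv_apply_subset ℝ _).trans hs
    have e1 := hij ψ hψ hc hs
    have e2 := hji ψ hψ hc hs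
    have e3 := hi _ (hd j) (hcl j) (hsl j)
    have e4 := hj _ (hd i) (hcl i) (hsl i)
    have hsw : ∀ x, fderiv ℝ (fun x => fderiv ℝ ψ x (Pi.single j 1)) x (Pi.single i 1) =
        fderiv ℝ (fun x => fderiv ℝ ψ x (Pi.single i 1)) x (Pi.single j 1) := by
      intro x
      have hdd : DifferentiableAt ℝ (fderiv ℝ ψ) x :=
        ((hψ.fderiv_right (m := 1) (by norm_cast)).differentiable (by simp)) x
      rw [fderiv_clm_apply hdd (differentiableAt_const _),
        fderiv_clm_apply hdd (differentiableAt_const _)]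
      have hsym := (hψ.contDiffAt (x := x)).isSymmSndFDerivAt (by simp; norm_cast)
      simpa using hsym (Pi.single i 1) (Pi.single j 1)
    simp only [hsw] at e3
    simp only [smul_eq_mul] at e1 e2 e3 e4
    simp only [Pi.sub_apply, mul_sub]
    rw [integral_sub (by simpa using integrable_smul_of_continuous h1 hψ.continuous)
      (by simpa using integrable_smul_of_continuous h2 hψ.continuous)]
    linarith
  filter_upwards [this] with x hx
  simpa [sub_eq_zero] using hx

end WeakDerivatives

/-! ### Test functions that vanish on two opposite faces only -/

lemma exists_bound_deriv_smoothTransition :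
    ∃ C : ℝ, 0 ≤ C ∧ (∀ y, |deriv Real.smoothTransition y| ≤ C) ∧
      ∀ y, 1 < y → deriv Real.smoothTransition y = 0 := by
  have hcont : Continuous (deriv Real.smoothTransition) :=
    (Real.smoothTransition.contDiff (n := 1)).continuous_deriv le_rfl
  obtain ⟨C, hC⟩ := (isCompact_Icc (a := (0 : ℝ)) (b := 1)).exists_bound_of_continuousOn
    hcont.continuousOn
  have h1 : ∀ y, 1 < y → deriv Real.smoothTransition y = 0 := fun y hy => by
    rw [Filter.EventuallyEq.deriv_eq (f := fun _ => (1 : ℝ)), deriv_const]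
    filter_upwards [Ioi_mem_nhds hy] with z hz
    exact Real.smoothTransition.one_of_one_le (le_of_lt hz)
  have h0 : ∀ y, y < 0 → deriv Real.smoothTransition y = 0 := fun y hy => by
    rw [Filter.EventuallyEq.deriv_eq (f := fun _ => (0 : ℝ)), deriv_const]
    filter_upwards [Iio_mem_nhds hy] with z hz
    exact Real.smoothTransition.zero_of_nonpos (le_of_lt hz)
  refine ⟨max C 0, le_max_right _ _, fun y => ?_, h1⟩
  rcases lt_or_ge y 0 with hy | hy
  · simp [h0 y hy]
  rcases lt_or_ge 1 y with hy1 | hy1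
  · simp [h1 y hy1]
  · exact (hC y ⟨hy, hy1⟩).trans (le_max_left _ _)

/-- A smooth cutoff function on the line, `0` within `1/N` of the complement of `(0,1)` and `1` at
the points of `(0,1)` that are at distance at least `2/N` from the end points. -/
def cutoff (N : ℝ) (t : ℝ) : ℝ :=
  Real.smoothTransition (N * t - 1) * Real.smoothTransition (N * (1 - t) - 1)

lemma contDiff_cutoff (N : ℝ) : ContDiff ℝ ((⊤ : ℕ∞) : WithTop ℕ∞) (cutoff N) := by
  unfold cutoff
  exact (Real.smoothTransition.contDiff.comp (by fun_prop)).mul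
    (Real.smoothTransition.contDiff.comp (by fun_prop))

lemma cutoff_nonneg (N t : ℝ) : 0 ≤ cutoff N t :=
  mul_nonneg (Real.smoothTransition.nonneg _) (Real.smoothTransition.nonneg _)

lemma cutoff_le_one (N t : ℝ) : cutoff N t ≤ 1 :=
  mul_le_one₀ (Real.smoothTransition.le_one _) (Real.smoothTransition.nonneg _)
    (Real.smoothTransition.le_one _)

lemma deriv_cutoff (N t : ℝ) : deriv (cutoff N) t =
    N * deriv Real.smoothTransition (N * t - 1) * Real.smoothTransition (N * (1 - t) - 1)
    - Real.smoothTransition (N * t - 1) * (N * deriv Real.smoothTransition (N * (1 - t) - 1)) := by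
  have hS : Differentiable ℝ Real.smoothTransition :=
    (Real.smoothTransition.contDiff (n := 1)).differentiable (by simp)
  have h1 : HasDerivAt (fun t : ℝ => N * t - 1) N t := by
    simpa using ((hasDerivAt_id t).const_mul N).sub_const 1
  have h2 : HasDerivAt (fun t : ℝ => N * (1 - t) - 1) (-N) t := by
    simpa using (((hasDerivAt_id t).const_sub 1).const_mul N).sub_const 1
  have := ((hS _).hasDerivAt.comp t h1).mul ((hS _).hasDerivAt.comp t h2)
  rw [show cutoff N = (Real.smoothTransition ∘ fun t : ℝ => N * t - 1) *
    (Real.smoothTransition ∘ fun t : ℝ => N * (1 - t) - 1) from rfl, this.deriv]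
  simp only [Function.comp]
  ring

lemma pd_comp_coord {i k : Fin 3} {g : ℝ → ℝ} (hg : Differentiable ℝ g) (x : Pt) :
    pd i (fun y : Pt => g (y k)) x = if i = k then deriv g (x k) else 0 := by
  have h : HasFDerivAt (fun y : Pt => g (y k))
      (deriv g (x k) • (ContinuousLinearMap.proj k : Pt →L[ℝ] ℝ)) x :=
    (hg (x k)).hasDerivAt.comp_hasFDerivAt x (hasFDerivAt_apply k x)
  rw [pd, h.fderiv]
  by_cases hik : i = k
  · subst hik; simp
  · simp [hik, Ne.symm hik]

/-- The partial derivative of a product of functions of one variable. -/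
lemma pd_prod {i : Fin 3} {g : Fin 3 → ℝ → ℝ} (hg : ∀ k, Differentiable ℝ (g k)) (x : Pt) :
    pd i (fun y : Pt => ∏ k, g k (y k)) x =
      ∏ k, Function.update g i (deriv (g i)) k (x k) := by
  have h : ∀ k, HasFDerivAt (fun y : Pt => g k (y k))
      (deriv (g k) (x k) • (ContinuousLinearMap.proj k : Pt →L[ℝ] ℝ)) x := fun k =>
    (hg k (x k)).hasDerivAt.comp_hasFDerivAt x (hasFDerivAt_apply k x)
  have := HasFDerivAt.finsetProd (u := Finset.univ) (fun k _ => h k)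
  rw [pd, this.fderiv]
  simp only [sum_apply, smul_apply,
    ContinuousLinearMap.proj_apply, smul_eq_mul, Pi.single_apply, mul_ite, mul_one, mul_zero]
  rw [Finset.sum_ite_eq' Finset.univ i, if_pos (Finset.mem_univ i),
    ← Finset.mul_prod_erase _ _ (Finset.mem_univ i), Function.update_self, mul_comm]
  congr 1
  refine Finset.prod_congr rfl fun q hq => ?_
  rw [Function.update_of_ne (Finset.ne_of_mem_erase hq)]

/-- A smooth function that vanishes on a hyperplane `x i = s` is at most of the order of the
distance to it. -/
lemma abs_le_mul_coord {i : Fin 3} {θ : Pt → ℝ} (hθ : ContDiff ℝ ((⊤ : ℕ∞) : WithTop ℕ∞) θ) (s : ℝ)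
    (hs : s ∈ Icc (0 : ℝ) 1) (h0 : ∀ x, x i = s → θ x = 0) :
    ∃ L : ℝ, 0 ≤ L ∧ ∀ x ∈ Icc (0 : Pt) 1, |θ x| ≤ L * |x i - s| := by
  obtain ⟨L, hL0, hL⟩ := exists_bound_Icc (hθ.continuous_fderiv (by simp))
  refine ⟨L, hL0, fun x hx => ?_⟩
  have hx' : Function.update x i s ∈ Icc (0 : Pt) 1 := by
    constructor <;> intro k <;> by_cases hk : k = i
    · subst hk; simpa using hs.1
    · simpa [hk] using hx.1 k
    · subst hk; simpa using hs.2
    · simpa [hk] using hx.2 k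
  have := (convex_Icc (0 : Pt) 1).norm_image_sub_le_of_norm_fderiv_le (𝕜 := ℝ) (f := θ) (C := L)
    (fun y _ => (hθ.differentiable (by simp)) y) hL hx' hx
  rw [h0 _ (Function.update_self i s x), sub_zero, Real.norm_eq_abs] at this
  refine this.trans (mul_le_mul_of_nonneg_left ?_ hL0)
  rw [pi_norm_le_iff_of_nonneg (abs_nonneg _)]
  intro k
  by_cases hk : k = i
  · subst hk; simp
  · simp [hk]

/-- The defining identity of the weak derivative `∂w/∂x_i` also holds for test functions that vanish
only on the two faces orthogonal to `e_i`: multiplying by a cutoff adds the derivative of the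
cutoff, which is of order `N` only where the test function is of order `1/N`. -/
lemma HasWeakPartial.integral_eq {i : Fin 3} {w v : Pt → ℝ} (h : HasWeakPartial i w v)
    (hw : Integrable w volOmega) (hv : Integrable v volOmega) {θ : Pt → ℝ}
    (hθ : ContDiff ℝ ((⊤ : ℕ∞) : WithTop ℕ∞) θ)
    (h0 : ∀ x, x i = 0 → θ x = 0) (h1 : ∀ x, x i = 1 → θ x = 0) :
    ∫ x in Omega, pd i θ x * w x = -∫ x in Omega, θ x * v x := by
  obtain ⟨C, hC0, hC, hC1⟩ := exists_bound_deriv_smoothTransition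
  obtain ⟨L0, hL0, hL0'⟩ := abs_le_mul_coord hθ 0 ⟨le_rfl, zero_le_one⟩ h0
  obtain ⟨L1, hL1, hL1'⟩ := abs_le_mul_coord hθ 1 ⟨zero_le_one, le_rfl⟩ h1
  obtain ⟨M, hM0, hM⟩ := exists_bound_Icc hθ.continuous
  obtain ⟨M', hM'0, hM'⟩ := exists_bound_Icc (hθ.pd (i := i)).continuous
  set N : ℕ → ℝ := fun n => n + 1 with hN
  have hNpos : ∀ n, 0 < N n := fun n => by positivity
  have hNtop : Filter.Tendsto N Filter.atTop Filter.atTop :=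
    Filter.tendsto_atTop_add_const_right _ _ tendsto_natCast_atTop_atTop
  have hcd : ∀ n, Differentiable ℝ (cutoff (N n)) := fun n =>
    (contDiff_cutoff _).differentiable (by simp)
  set χ : ℕ → Pt → ℝ := fun n x => ∏ k, cutoff (N n) (x k) with hχ
  have hχs : ∀ n, ContDiff ℝ ((⊤ : ℕ∞) : WithTop ℕ∞) (χ n) := fun n =>
    contDiff_prod fun k _ => (contDiff_cutoff _).comp (contDiff_apply ℝ ℝ k)
  have hsupp : ∀ n, tsupport (fun x => χ n x * θ x) ⊆
      Icc (fun _ => 1 / N n : Pt) (fun _ => 1 - 1 / N n) := by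
    intro n
    refine closure_minimal (fun x hx => ?_) isClosed_Icc
    have hx' : χ n x ≠ 0 := left_ne_zero_of_mul hx
    have hk : ∀ k, cutoff (N n) (x k) ≠ 0 := fun k => Finset.prod_ne_zero_iff.1 hx' k (Finset.mem_univ _)
    refine ⟨fun k => ?_, fun k => ?_⟩
    · by_contra! hlt
      refine hk k ?_
      rw [cutoff, Real.smoothTransition.zero_of_nonpos, zero_mul]
      rw [lt_div_iff₀ (hNpos n)] at hlt
      linarith
    · by_contra! hlt
      refine hk k ?_
      rw [cutoff, Real.smoothTransition.zero_of_nonpos (x := N n * (1 - x k) - 1), mul_zero]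
      have : 1 - x k < 1 / N n := by linarith
      rw [lt_div_iff₀ (hNpos n)] at this
      linarith
  have key : ∀ n, ∫ x in Omega, pd i (fun x => χ n x * θ x) x * w x =
      -∫ x in Omega, χ n x * θ x * v x := by
    intro n
    have := h (fun x => χ n x * θ x) ((hχs n).mul hθ)
      (HasCompactSupport.of_support_subset_isCompact isCompact_Icc
        (subset_closure.trans (hsupp n)))
      (fun x hx k _ => ?_)
    · simpa only [smul_eq_mul, pd] using this
    · have hx' := hsupp n hx
      have := hx'.1 k
      have := hx'.2 k
      have : 0 < 1 / N n := by have := hNpos n; positivity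
      constructor <;> linarith
  have hpd : ∀ n x, pd i (fun x => χ n x * θ x) x = χ n x * pd i θ x +
      θ x * ∏ k, Function.update (fun _ => cutoff (N n)) i (deriv (cutoff (N n))) k (x k) := by
    intro n x
    rw [pd_mul ((hχs n).differentiable (by simp)) (hθ.differentiable (by simp)),
      hχ, pd_prod fun k => hcd n]
  have hχ01 : ∀ n x, 0 ≤ χ n x ∧ χ n x ≤ 1 := fun n x =>
    ⟨Finset.prod_nonneg fun k _ => cutoff_nonneg _ _,
      Finset.prod_le_one (fun k _ => cutoff_nonneg _ _) fun k _ => cutoff_le_one _ _⟩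
  have hbd : ∀ n, ∀ x ∈ Icc (0 : Pt) 1, |θ x * deriv (cutoff (N n)) (x i)| ≤ 2 * L0 * C + 2 * L1 * C := by
    intro n x hx
    have hx0 := hx.1 i
    have hx1 := hx.2 i
    simp only [Pi.zero_apply, Pi.one_apply] at hx0 hx1
    have e0 := hL0' x hx
    have e1 := hL1' x hx
    rw [sub_zero, abs_of_nonneg hx0] at e0
    rw [abs_sub_comm, abs_of_nonneg (sub_nonneg.2 hx1)] at e1
    have a0 : |θ x * (N n * deriv Real.smoothTransition (N n * x i - 1))| ≤ 2 * L0 * C := by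
      rcases lt_or_ge 1 (N n * x i - 1) with hc | hc
      · rw [hC1 _ hc, mul_zero, mul_zero, abs_zero]; positivity
      · rw [abs_mul, abs_mul, abs_of_pos (hNpos n)]
        calc |θ x| * (N n * |deriv Real.smoothTransition (N n * x i - 1)|)
            ≤ (L0 * x i) * (N n * C) := by
              refine mul_le_mul e0 (mul_le_mul_of_nonneg_left (hC _) (hNpos n).le)
                (mul_nonneg (hNpos n).le (abs_nonneg _)) ((abs_nonneg _).trans e0)
          _ = L0 * C * (N n * x i) := by ring
          _ ≤ L0 * C * 2 := by gcongr; linarith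
          _ = _ := by ring
    have a1 : |θ x * (N n * deriv Real.smoothTransition (N n * (1 - x i) - 1))| ≤ 2 * L1 * C := by
      rcases lt_or_ge 1 (N n * (1 - x i) - 1) with hc | hc
      · rw [hC1 _ hc, mul_zero, mul_zero, abs_zero]; positivity
      · rw [abs_mul, abs_mul, abs_of_pos (hNpos n)]
        calc |θ x| * (N n * |deriv Real.smoothTransition (N n * (1 - x i) - 1)|)
            ≤ (L1 * (1 - x i)) * (N n * C) := by
              refine mul_le_mul e1 (mul_le_mul_of_nonneg_left (hC _) (hNpos n).le)
                (mul_nonneg (hNpos n).le (abs_nonneg _)) ((abs_nonneg _).trans e1)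
          _ = L1 * C * (N n * (1 - x i)) := by ring
          _ ≤ L1 * C * 2 := by gcongr; linarith
          _ = _ := by ring
    rw [deriv_cutoff]
    have s0 := Real.smoothTransition.nonneg (N n * x i - 1)
    have s1 := Real.smoothTransition.le_one (N n * x i - 1)
    have t0 := Real.smoothTransition.nonneg (N n * (1 - x i) - 1)
    have t1 := Real.smoothTransition.le_one (N n * (1 - x i) - 1)
    rw [show θ x * (N n * deriv Real.smoothTransition (N n * x i - 1) *
          Real.smoothTransition (N n * (1 - x i) - 1) -
        Real.smoothTransition (N n * x i - 1) *
          (N n * deriv Real.smoothTransition (N n * (1 - x i) - 1))) =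
        θ x * (N n * deriv Real.smoothTransition (N n * x i - 1)) *
          Real.smoothTransition (N n * (1 - x i) - 1) -
        θ x * (N n * deriv Real.smoothTransition (N n * (1 - x i) - 1)) *
          Real.smoothTransition (N n * x i - 1) by ring]
    refine (abs_sub _ _).trans (add_le_add ?_ ?_)
    · rw [abs_mul, abs_of_nonneg t0]
      exact (mul_le_of_le_one_right (abs_nonneg _) t1).trans a0
    · rw [abs_mul, abs_of_nonneg s0]
      exact (mul_le_of_le_one_right (abs_nonneg _) s1).trans a1
  have hbd' : ∀ n, ∀ x ∈ Icc (0 : Pt) 1,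
      |θ x * ∏ k, Function.update (fun _ => cutoff (N n)) i (deriv (cutoff (N n))) k (x k)| ≤
        2 * L0 * C + 2 * L1 * C := by
    intro n x hx
    rw [← Finset.mul_prod_erase _ _ (Finset.mem_univ i), Function.update_self, ← mul_assoc, abs_mul]
    refine (mul_le_of_le_one_right (abs_nonneg _) ?_).trans (hbd n x hx)
    rw [Finset.abs_prod]
    refine Finset.prod_le_one (fun _ _ => abs_nonneg _) fun k hk => ?_
    rw [Function.update_of_ne (Finset.ne_of_mem_erase hk), abs_of_nonneg (cutoff_nonneg _ _)]
    exact cutoff_le_one _ _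
  -- at each point of the cube the cutoff is eventually `1` and its derivative eventually `0`
  have hev : ∀ x ∈ Omega, ∀ᶠ n in Filter.atTop, χ n x = 1 ∧
      ∏ k, Function.update (fun _ => cutoff (N n)) i (deriv (cutoff (N n))) k (x k) = 0 := by
    intro x hx
    have hk : ∀ k, ∀ᶠ n in Filter.atTop, 2 < N n * x k ∧ 2 < N n * (1 - x k) := fun k =>
      ((hNtop.atTop_mul_const (hx k trivial).1).eventually_gt_atTop 2).and
        ((hNtop.atTop_mul_const (sub_pos.2 (hx k trivial).2)).eventually_gt_atTop 2)
    filter_upwards [Filter.eventually_all.2 hk] with n hn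
    refine ⟨Finset.prod_eq_one fun k _ => ?_, Finset.prod_eq_zero (Finset.mem_univ i) ?_⟩
    · rw [cutoff, Real.smoothTransition.one_of_one_le (by linarith [(hn k).1]),
        Real.smoothTransition.one_of_one_le (by linarith [(hn k).2]), one_mul]
    · rw [Function.update_self, deriv_cutoff, hC1 _ (by linarith [(hn i).1]),
        hC1 _ (by linarith [(hn i).2])]
      ring
  have lim1 : Filter.Tendsto (fun n => ∫ x in Omega, pd i (fun x => χ n x * θ x) x * w x)
      Filter.atTop (nhds (∫ x in Omega, pd i θ x * w x)) := by
    refine tendsto_integral_of_dominated_convergence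
      (fun x => (M' + (2 * L0 * C + 2 * L1 * C)) * ‖w x‖) (fun n => ?_) (hw.norm.const_mul _)
      (fun n => ?_) ?_
    · exact ((((hχs n).mul hθ).pd (i := i)).continuous.aestronglyMeasurable).mul hw.1
    · filter_upwards [ae_restrict_mem measurableSet_Omega] with x hx
      have hx' := Omega_subset_Icc hx
      rw [norm_mul, hpd]
      refine mul_le_mul_of_nonneg_right ((norm_add_le _ _).trans (add_le_add ?_ (hbd' n x hx')))
        (norm_nonneg _)
      rw [norm_mul, Real.norm_of_nonneg (hχ01 n x).1]
      exact (mul_le_of_le_one_left (norm_nonneg _) (hχ01 n x).2).trans (hM' x hx')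
    · filter_upwards [ae_restrict_mem measurableSet_Omega] with x hx
      refine tendsto_const_nhds.congr' ?_
      filter_upwards [hev x hx] with n hn
      rw [hpd, hn.1, hn.2]; ring
  have lim2 : Filter.Tendsto (fun n => ∫ x in Omega, χ n x * θ x * v x)
      Filter.atTop (nhds (∫ x in Omega, θ x * v x)) := by
    refine tendsto_integral_of_dominated_convergence
      (fun x => M * ‖v x‖) (fun n => ?_) (hv.norm.const_mul _) (fun n => ?_) ?_
    · exact (((hχs n).mul hθ).continuous.aestronglyMeasurable).mul hv.1
    · filter_upwards [ae_restrict_mem measurableSet_Omega] with x hx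
      have hx' := Omega_subset_Icc hx
      rw [norm_mul, norm_mul, Real.norm_of_nonneg (hχ01 n x).1]
      exact mul_le_mul_of_nonneg_right
        ((mul_le_of_le_one_left (norm_nonneg _) (hχ01 n x).2).trans (hM x hx')) (norm_nonneg _)
    · filter_upwards [ae_restrict_mem measurableSet_Omega] with x hx
      refine tendsto_const_nhds.congr' ?_
      filter_upwards [hev x hx] with n hn
      rw [hn.1, one_mul]
  exact tendsto_nhds_unique lim1 (by simpa only [key] using lim2.neg)

/-! ### Surface integrals and Green's formula -/

lemma measurable_insertNth (i : Fin 3) (s : ℝ) :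
    Measurable (fun y : Fin 2 → ℝ => (Fin.insertNth (α := fun _ => ℝ) i s y : Pt)) := by
  refine measurable_pi_iff.2 fun k => ?_
  rcases eq_or_ne k i with rfl | hk
  · simp
  · obtain ⟨l, rfl⟩ := Fin.exists_succAbove_eq hk
    simpa using measurable_pi_apply l

instance (i : Fin 3) (s : ℝ) : IsFiniteMeasure (faceMeasure i s) := by
  have : IsFiniteMeasure (volume.restrict (Set.pi Set.univ fun _ : Fin 2 => Ioo (0 : ℝ) 1)) :=
    ⟨by rw [Measure.restrict_apply_univ, volume_pi_pi]; simp⟩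
  exact Measure.isFiniteMeasure_map _ _

instance : IsFiniteMeasure surf := by unfold surf; infer_instance

lemma ae_faceMeasure (i : Fin 3) {s : ℝ} (hs : s ∈ Icc (0 : ℝ) 1) :
    ∀ᵐ x ∂(faceMeasure i s), x ∈ Icc (0 : Pt) 1 ∧ x i = s ∧ ∀ k ≠ i, x k ∈ Ioo (0 : ℝ) 1 := by
  rw [faceMeasure]
  have hm : MeasurableSet {x : Pt | x ∈ Icc (0 : Pt) 1 ∧ x i = s ∧ ∀ k ≠ i, x k ∈ Ioo (0 : ℝ) 1} := by
    refine measurableSet_Icc.inter ((measurableSet_eq_fun (measurable_pi_apply i)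
      measurable_const).inter ?_)
    have : {x : Pt | ∀ k ≠ i, x k ∈ Ioo (0 : ℝ) 1} =
        ⋂ k, ⋂ (_ : k ≠ i), (fun x : Pt => x k) ⁻¹' Ioo (0 : ℝ) 1 := by ext; simp
    change MeasurableSet {x : Pt | ∀ k ≠ i, x k ∈ Ioo (0 : ℝ) 1}
    rw [this]
    exact MeasurableSet.iInter fun k => MeasurableSet.iInter fun _ =>
      (measurable_pi_apply k) measurableSet_Ioo
  rw [ae_map_iff (measurable_insertNth i s).aemeasurable hm]
  filter_upwards [ae_restrict_mem (MeasurableSet.univ_pi fun _ => measurableSet_Ioo)] with y hy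
  have h2 : ∀ k ≠ i, (Fin.insertNth (α := fun _ => ℝ) i s y : Pt) k ∈ Ioo (0 : ℝ) 1 := by
    intro k hk
    obtain ⟨l, rfl⟩ := Fin.exists_succAbove_eq hk
    simpa using hy l trivial
  refine ⟨⟨fun k => ?_, fun k => ?_⟩, by simp, h2⟩
  · rcases eq_or_ne k i with rfl | hk
    · simpa using hs.1
    · exact (h2 k hk).1.le
  · rcases eq_or_ne k i with rfl | hk
    · simpa using hs.2
    · exact (h2 k hk).2.le

lemma ae_surf_mem_Icc : ∀ᵐ x ∂surf, x ∈ Icc (0 : Pt) 1 := by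
  rw [surf, ← Measure.sum_fintype, Measure.ae_sum_iff]
  intro i
  rw [ae_add_measure_iff]
  exact ⟨(ae_faceMeasure i (by simp)).mono fun x hx => hx.1,
    (ae_faceMeasure i (by simp)).mono fun x hx => hx.1⟩

lemma measurable_normal (k : Fin 3) : Measurable (fun x => normal x k) := by
  unfold normal
  refine Measurable.ite ?_ measurable_const (Measurable.ite ?_ measurable_const measurable_const)
  · exact measurableSet_eq_fun (measurable_pi_apply k) measurable_const
  · exact measurableSet_eq_fun (measurable_pi_apply k) measurable_const

lemma abs_normal_le (x : Pt) (k : Fin 3) : |normal x k| ≤ 1 := by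
  unfold normal
  split_ifs <;> simp

lemma integrable_surf_of_continuous {f : Pt → ℝ} (hf : Continuous f) : Integrable f surf := by
  obtain ⟨C, -, hC⟩ := exists_bound_Icc hf
  exact Integrable.of_bound hf.aestronglyMeasurable C (ae_surf_mem_Icc.mono fun x hx => hC x hx)

lemma integrable_surf_mul_normal {f : Pt → ℝ} (hf : Integrable f surf) (k : Fin 3) :
    Integrable (fun x => f x * normal x k) surf :=
  hf.mul_bdd (c := 1) (measurable_normal k).aestronglyMeasurable
    (Filter.Eventually.of_forall fun x => abs_normal_le x k)

/-- A surface integral against a component of the normal only sees the two faces orthogonal to it.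
-/
lemma integral_surf_mul_normal {f : Pt → ℝ} (hf : Continuous f) (k : Fin 3) :
    ∫ x, f x * normal x k ∂surf = ∫ x, f x ∂(faceMeasure k 1) - ∫ x, f x ∂(faceMeasure k 0) := by
  have hi := integrable_surf_mul_normal (integrable_surf_of_continuous hf) k
  rw [surf] at hi ⊢
  rw [integrable_finsetSum_measure] at hi
  rw [integral_finsetSum_measure hi, Finset.sum_eq_single k]
  · have hk := integrable_add_measure.1 (hi k (Finset.mem_univ k))
    rw [integral_add_measure hk.1 hk.2]
    have e0 : ∫ x, f x * normal x k ∂(faceMeasure k 0) = ∫ x, -f x ∂(faceMeasure k 0) :=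
      integral_congr_ae ((ae_faceMeasure k (by simp)).mono fun x hx => by
        simp [normal, hx.2.1])
    have e1 : ∫ x, f x * normal x k ∂(faceMeasure k 1) = ∫ x, f x ∂(faceMeasure k 1) :=
      integral_congr_ae ((ae_faceMeasure k (by simp)).mono fun x hx => by
        simp [normal, hx.2.1])
    rw [e0, e1, integral_neg]; ring
  · intro i _ hik
    have hk := integrable_add_measure.1 (hi i (Finset.mem_univ i))
    have hz : ∀ s ∈ Icc (0 : ℝ) 1, ∫ x, f x * normal x k ∂(faceMeasure i s) = 0 := fun s hs => by
      rw [integral_eq_zero_of_ae]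
      refine (ae_faceMeasure i hs).mono fun x hx => ?_
      have := hx.2.2 k hik.symm
      simp [normal, this.1.ne', this.2.ne]
    rw [integral_add_measure hk.1 hk.2, hz 0 (by simp), hz 1 (by simp), add_zero]
  · simp

lemma integral_faceMeasure {f : Pt → ℝ} (hf : Continuous f) (i : Fin 3) (s : ℝ) :
    ∫ x, f x ∂(faceMeasure i s) =
      ∫ y in Icc (0 : Fin 2 → ℝ) 1, f (Fin.insertNth (α := fun _ => ℝ) i s y) := by
  rw [faceMeasure, integral_map (measurable_insertNth i s).aemeasurable hf.aestronglyMeasurable]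
  rw [setIntegral_congr_set (μ := volume)
    (show Set.pi Set.univ (fun _ : Fin 2 => Ioo (0 : ℝ) 1) =ᵐ[volume] Icc (0 : Fin 2 → ℝ) 1 from
      Measure.univ_pi_Ioo_ae_eq_Icc (μ := fun _ => volume))]

/-- The divergence theorem on the cube for a field along one coordinate axis. -/
lemma integral_pd {f : Pt → ℝ} (hf : ContDiff ℝ ((⊤ : ℕ∞) : WithTop ℕ∞) f) (k : Fin 3) :
    ∫ x in Omega, pd k f x = ∫ x, f x * normal x k ∂surf := by
  rw [integral_surf_mul_normal hf.continuous, integral_faceMeasure hf.continuous,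
    integral_faceMeasure hf.continuous]
  have hf1 : Differentiable ℝ f := hf.differentiable (by simp)
  have hsum : ∀ x, ∑ i, ((Pi.single (M := fun _ => Pt → Pt →L[ℝ] ℝ) k (fderiv ℝ f)) i x)
      (Pi.single i 1) = pd k f x := by
    intro x
    rw [Finset.sum_eq_single k]
    · simp [pd]
    · intro i _ hik; simp [hik]
    · simp
  have := integral_divergence_of_hasFDerivAt_off_countable' (n := 2) (0 : Pt) 1
    (by intro i; simp) (Pi.single k f) (Pi.single k (fderiv ℝ f)) ∅ countable_empty
    (fun i => by
      rcases eq_or_ne i k with rfl | h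
      · simpa using hf.continuous.continuousOn
      · rw [Pi.single_eq_of_ne h]; exact continuousOn_const)
    (fun x _ i => by
      rcases eq_or_ne i k with rfl | h
      · simpa using (hf1 x).hasFDerivAt
      · simp only [Pi.single_eq_of_ne h]; exact hasFDerivAt_const _ _)
    (by
      simp_rw [hsum]
      exact hf.pd.continuous.continuousOn.integrableOn_compact isCompact_Icc)
  simp_rw [hsum] at this
  rw [setIntegral_congr_set (μ := volume)
    (show Omega =ᵐ[volume] Icc (0 : Pt) 1 from
      Measure.univ_pi_Ioo_ae_eq_Icc (μ := fun _ => volume)), this, Finset.sum_eq_single k]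
  · simp only [Pi.single_eq_same]
    rfl
  · intro i _ hik; simp [hik]
  · simp

lemma le_rpow_half {x y : ENNReal} (h : x ^ 2 ≤ y) : x ≤ y ^ (1 / 2 : ℝ) := by
  calc x = (x ^ 2) ^ (1 / 2 : ℝ) := by
        rw [← ENNReal.rpow_natCast, ← ENNReal.rpow_mul]; norm_num
    _ ≤ _ := ENNReal.rpow_le_rpow h (by norm_num)

lemma eLpNorm_le_H1norm (w : Pt → ℝ) : eLpNorm w 2 volOmega ≤ H1norm w :=
  le_iInf₂ fun _ _ => le_rpow_half le_self_add

lemma eLpNorm_pd_le_H1norm {k : Fin 3} {w v : Pt → ℝ} (hw : HasWeakPartial k w v)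
    (hv : Integrable v volOmega) : eLpNorm v 2 volOmega ≤ H1norm w := by
  refine le_iInf₂ fun v' hv' => le_rpow_half ?_
  rw [eLpNorm_congr_ae (hw.unique (hv'.2 k).2 hv ((hv'.2 k).1.integrable (by norm_num)))]
  exact (Finset.single_le_sum (f := fun i => eLpNorm (v' i) 2 volOmega ^ 2)
    (fun _ _ => zero_le) (Finset.mem_univ k)).trans le_add_self

lemma tendsto_integral_mul {α : Type*} [MeasurableSpace α] {μ : Measure α} [IsFiniteMeasure μ]
    {f : ℕ → α → ℝ} {f₀ g : α → ℝ} (hf : ∀ n, MemLp (f n) 2 μ) (hf₀ : MemLp f₀ 2 μ)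
    (hg : AEStronglyMeasurable g μ) {C : ℝ} (hC : ∀ᵐ x ∂μ, ‖g x‖ ≤ C)
    (h : Filter.Tendsto (fun n => eLpNorm (fun x => f n x - f₀ x) 2 μ) Filter.atTop (nhds 0)) :
    Filter.Tendsto (fun n => ∫ x, f n x * g x ∂μ) Filter.atTop (nhds (∫ x, f₀ x * g x ∂μ)) := by
  have hgL : MemLp g 2 μ := MemLp.of_bound hg C hC
  refine tendsto_integral_of_L1' _ (hf₀.1.mul hg)
    (Filter.Eventually.of_forall fun n => (hgL.integrable_mul (hf n)).congr
    (Filter.Eventually.of_forall fun x => mul_comm _ _)) ?_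
  have hb : ∀ n, eLpNorm ((fun x => f n x * g x) - fun x => f₀ x * g x) 1 μ ≤
      eLpNorm (fun x => f n x - f₀ x) 2 μ * eLpNorm g 2 μ := by
    intro n
    have := eLpNorm_smul_le_mul_eLpNorm (p := 2) (q := 2) (r := 1) (μ := μ) hg
      ((hf n).sub hf₀).1
    refine le_trans (le_of_eq ?_) this
    congr 1
    funext x
    simp [sub_mul]
  refine tendsto_of_tendsto_of_tendsto_of_le_of_le tendsto_const_nhds ?_ (fun _ => zero_le) hb
  simpa using ENNReal.Tendsto.mul_const h (Or.inr hgL.2.ne)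

/-- Green's formula: integration by parts of a function of `H¹(Ω)` with given trace. -/
lemma integral_add_integral_pd_of_hasTrace {k : Fin 3} {w v b : Pt → ℝ} (hw : MemLp w 2 volOmega)
    (hv : MemLp v 2 volOmega) (h : HasWeakPartial k w v) (hb : HasTrace w b) {V : Pt → ℝ}
    (hV : ContDiff ℝ ((⊤ : ℕ∞) : WithTop ℕ∞) V) :
    (∫ x in Omega, v x * V x) + (∫ x in Omega, w x * pd k V x) = ∫ x, b x * (V x * normal x k) ∂surf := by
  obtain ⟨hbL, ψ, hψ, hH1, htr⟩ := hb
  have hwi : Integrable w volOmega := hw.integrable (by norm_num)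
  have hvi : Integrable v volOmega := hv.integrable (by norm_num)
  obtain ⟨C, hC0, hC⟩ := exists_bound_Icc hV.continuous
  obtain ⟨C', -, hC'⟩ := exists_bound_Icc (hV.pd (i := k)).continuous
  have hae : ∀ᵐ x ∂volOmega, x ∈ Icc (0 : Pt) 1 :=
    (ae_restrict_mem measurableSet_Omega).mono fun x hx => Omega_subset_Icc hx
  have hsub : ∀ n, HasWeakPartial k (fun x => ψ n x - w x) (fun x => pd k (ψ n) x - v x) := fun n =>
    (hasWeakPartial_of_contDiff (hψ n)).sub h
      (((hψ n).continuous.memLp_volOmega 2).integrable (by norm_num))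
      (((hψ n).pd.continuous.memLp_volOmega 2).integrable (by norm_num)) hwi hvi
  have l1 : Filter.Tendsto (fun n => ∫ x in Omega, ψ n x * pd k V x) Filter.atTop
      (nhds (∫ x in Omega, w x * pd k V x)) :=
    tendsto_integral_mul (fun n => (hψ n).continuous.memLp_volOmega 2) hw
      (hV.pd.continuous.aestronglyMeasurable) (hae.mono hC')
      (tendsto_of_tendsto_of_tendsto_of_le_of_le tendsto_const_nhds hH1 (fun _ => zero_le)
        fun n => eLpNorm_le_H1norm _)
  have l2 : Filter.Tendsto (fun n => ∫ x in Omega, pd k (ψ n) x * V x) Filter.atTop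
      (nhds (∫ x in Omega, v x * V x)) :=
    tendsto_integral_mul (fun n => (hψ n).pd.continuous.memLp_volOmega 2) hv
      (hV.continuous.aestronglyMeasurable) (hae.mono hC)
      (tendsto_of_tendsto_of_tendsto_of_le_of_le tendsto_const_nhds hH1 (fun _ => zero_le)
        fun n => eLpNorm_pd_le_H1norm (hsub n)
          ((((hψ n).pd.continuous.memLp_volOmega 2).integrable (by norm_num)).sub hvi))
  have hψL : ∀ n, MemLp (ψ n) 2 surf := fun n => by
    obtain ⟨M, -, hM⟩ := exists_bound_Icc (hψ n).continuous
    exact MemLp.of_bound (hψ n).continuous.aestronglyMeasurable M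
      (ae_surf_mem_Icc.mono fun x hx => hM x hx)
  have l3 : Filter.Tendsto (fun n => ∫ x, ψ n x * (V x * normal x k) ∂surf) Filter.atTop
      (nhds (∫ x, b x * (V x * normal x k) ∂surf)) := by
    refine tendsto_integral_mul (C := C) hψL hbL
      (hV.continuous.aestronglyMeasurable.mul (measurable_normal k).aestronglyMeasurable)
      (ae_surf_mem_Icc.mono fun x hx => ?_) htr
    rw [norm_mul]
    exact (mul_le_of_le_one_right (norm_nonneg _) (abs_normal_le x k)).trans (hC x hx)
  refine tendsto_nhds_unique (l2.add l1) (l3.congr fun n => ?_)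
  have := integral_pd ((hψ n).mul hV) k
  simp only [mul_assoc] at this
  rw [← this, ← integral_add]
  · refine integral_congr_ae (Filter.Eventually.of_forall fun x => ?_)
    have := pd_mul (i := k) ((hψ n).differentiable (by simp)) (hV.differentiable (by simp)) x
    simp only [this]
    ring
  · exact integrable_mul_of_continuous
      (((hψ n).pd.continuous.memLp_volOmega 2).integrable (by norm_num)) hV.continuous
  · exact integrable_mul_of_continuous
      (((hψ n).continuous.memLp_volOmega 2).integrable (by norm_num)) hV.pd.continuous

/-! ### The Lamé operator tested against smooth fields -/

/-- The functional `w ↦ ∫ f w` on `L²(Ω)`, for continuous `f`. -/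
def testL (f : Pt → ℝ) (hf : Continuous f) : L2Omega →L[ℝ] ℝ := innerSL ℝ (contToL2 f hf)

lemma testL_apply {f : Pt → ℝ} (hf : Continuous f) (w : L2Omega) :
    testL f hf w = ∫ x in Omega, f x * w x := by
  rw [testL, innerSL_apply_apply, inner_contToL2]

lemma L2_memLp (w : L2Omega) : MemLp w 2 volOmega := Lp.memLp w

lemma L2_integrable (w : L2Omega) : Integrable w volOmega := (Lp.memLp w).integrable (by norm_num)

lemma hasWeakPartial_L2_iff {i : Fin 3} {w v : L2Omega} : HasWeakPartial i w v ↔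
    ∀ (ψ : Pt → ℝ) (hψ : ContDiff ℝ ((⊤ : ℕ∞) : WithTop ℕ∞) ψ), HasCompactSupport ψ →
      tsupport ψ ⊆ Omega →
      testL (pd i ψ) (hψ.pd (i := i)).continuous w = -testL ψ hψ.continuous v := by
  simp only [testL_apply]
  rfl

lemma HasWeakPartial.L2_add {i : Fin 3} {w v w' v' : L2Omega} (h : HasWeakPartial i w v)
    (h' : HasWeakPartial i w' v') : HasWeakPartial i (w + w' : L2Omega) (v + v' : L2Omega) := by
  rw [hasWeakPartial_L2_iff] at *
  intro ψ hψ hc hs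
  rw [map_add, map_add, h ψ hψ hc hs, h' ψ hψ hc hs]
  ring

lemma HasWeakPartial.L2_smul {i : Fin 3} {w v : L2Omega} (c : ℝ) (h : HasWeakPartial i w v) :
    HasWeakPartial i (c • w : L2Omega) (c • v : L2Omega) := by
  rw [hasWeakPartial_L2_iff] at *
  intro ψ hψ hc hs
  rw [map_smul, map_smul, h ψ hψ hc hs, smul_neg]

lemma HasWeakPartial.L2_sum {i : Fin 3} {w v : Fin 3 → L2Omega}
    (h : ∀ l, HasWeakPartial i (w l) (v l)) :
    HasWeakPartial i (∑ l, w l : L2Omega) (∑ l, v l : L2Omega) := by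
  simp only [hasWeakPartial_L2_iff] at *
  intro ψ hψ hc hs
  rw [map_sum, map_sum, ← Finset.sum_neg_distrib]
  exact Finset.sum_congr rfl fun l _ => h l ψ hψ hc hs

lemma pd_comm {i j : Fin 3} {f : Pt → ℝ} (hf : ContDiff ℝ ((⊤ : ℕ∞) : WithTop ℕ∞) f) :
    pd i (pd j f) = pd j (pd i f) := by
  funext x
  have hdd : DifferentiableAt ℝ (fderiv ℝ f) x :=
    ((hf.fderiv_right (m := 1) (by norm_cast)).differentiable (by simp)) x
  change fderiv ℝ (fun x => fderiv ℝ f x (Pi.single j 1)) x (Pi.single i 1) =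
        fderiv ℝ (fun x => fderiv ℝ f x (Pi.single i 1)) x (Pi.single j 1)
  rw [fderiv_clm_apply hdd (differentiableAt_const _),
    fderiv_clm_apply hdd (differentiableAt_const _)]
  have hsym := (hf.contDiffAt (x := x)).isSymmSndFDerivAt (by simp; norm_cast)
  simpa using hsym (Pi.single i 1) (Pi.single j 1)

lemma stress_eq (lam mu : ℝ) (d : Fin 3 → Fin 3 → L2Omega) (j k : Fin 3) :
    stress lam mu d j k = mu • (d j k + d k j) + (if j = k then lam else 0) • ∑ l, d l l := by
  unfold stress
  split_ifs with h
  · subst h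
    rw [two_mul, add_smul, smul_add]; abel
  · simp

/-- An eigenfield `V` of the Lamé operator: `μ ΔV + (λ + μ) ∇ div V = κ V`. -/
structure IsEigenfield (lam mu κ : ℝ) (V : Fin 3 → Pt → ℝ) : Prop where
  smooth : ∀ j, ContDiff ℝ ((⊤ : ℕ∞) : WithTop ℕ∞) (V j)
  eqn : ∀ j x, mu * ∑ k, pd k (pd k (V j)) x + (lam + mu) * ∑ k, pd j (pd k (V k)) x = κ * V j x

/-- Betti's formula: the Lamé operator, applied to a field with vanishing trace and surface stress
`S n`, is tested against a smooth eigenfield. -/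
lemma IsEigenfield.betti {lam mu κ : ℝ} {V : Fin 3 → Pt → ℝ} (hV : IsEigenfield lam mu κ V)
    {u : Fin 3 → L2Omega} {d : Fin 3 → Fin 3 → L2Omega} {dd : Fin 3 → Fin 3 → Fin 3 → L2Omega}
    (hd : ∀ j k, HasWeakPartial k (u j) (d j k))
    (hdd : ∀ j k l, HasWeakPartial l (d j k) (dd j k l))
    (h0 : ∀ j, HasTrace (u j) (fun _ => (0 : ℝ))) {S : Fin 3 → Fin 3 → Pt → ℝ}
    (hS : ∀ j k, HasTrace (stress lam mu d j k) (S j k)) :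
    ∑ j, testL (V j) (hV.smooth j).continuous
        (mu • (∑ k, dd j k k) + (lam + mu) • (∑ k, dd k k j)) =
      ∫ x, ∑ j, (∑ k, S j k x * normal x k) * V j x ∂surf +
        κ * ∑ j, testL (V j) (hV.smooth j).continuous (u j) := by
  have hVs := hV.smooth
  -- weak second derivatives commute
  have hsym : ∀ j k, dd k j k = dd k k j := fun j k =>
    Lp.ext ((hd k j).symm (hd k k) (hdd k j k) (hdd k k j) (L2_integrable _) (L2_integrable _))
  -- integration by parts for `u`
  have hu : ∀ j k (f : Pt → ℝ) (hf : ContDiff ℝ ((⊤ : ℕ∞) : WithTop ℕ∞) f),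
      testL f hf.continuous (d j k) = -testL (pd k f) hf.pd.continuous (u j) := by
    intro j k f hf
    have := integral_add_integral_pd_of_hasTrace (L2_memLp _) (L2_memLp _) (hd j k) (h0 j) hf
    simp only [zero_mul, integral_zero] at this
    rw [testL_apply, testL_apply]
    simp only [mul_comm] at this ⊢
    linarith
  -- integration by parts for the stress
  set v : Fin 3 → Fin 3 → L2Omega := fun j k =>
    mu • (dd j k k + dd k j k) + (if j = k then lam else 0) • ∑ l, dd l l k with hv
  have hstress : ∀ j k, HasWeakPartial k (stress lam mu d j k) (v j k) := fun j k => by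
    rw [stress_eq]
    exact (((hdd j k k).L2_add (hdd k j k)).L2_smul mu).L2_add
      ((HasWeakPartial.L2_sum fun l => hdd l l k).L2_smul _)
  have hs : ∀ j k, testL (V j) (hVs j).continuous (v j k) =
      ∫ x, S j k x * (V j x * normal x k) ∂surf
        - testL (pd k (V j)) (hVs j).pd.continuous (stress lam mu d j k) := by
    intro j k
    have := integral_add_integral_pd_of_hasTrace (L2_memLp _) (L2_memLp _) (hstress j k)
      (hS j k) (hVs j)
    rw [testL_apply, testL_apply, ← this]
    simp only [mul_comm]
    ring
  have hvsum : ∀ j, mu • (∑ k, dd j k k) + (lam + mu) • (∑ k, dd k k j) = ∑ k, v j k := by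
    intro j
    have e : ∑ k, dd k j k = ∑ k, dd k k j := Finset.sum_congr rfl fun k _ => hsym j k
    simp only [hv, Finset.sum_add_distrib, ← Finset.smul_sum, smul_add, add_smul]
    rw [e]
    rw [Finset.sum_eq_single j (f := fun k => (if j = k then lam else 0) • ∑ l, dd l l k)]
    · simp only [if_true]; abel
    · intro k _ hk; simp [hk.symm]
    · simp
  have hSi : ∀ j k, Integrable (fun x => S j k x * (V j x * normal x k)) surf := fun j k => by
    obtain ⟨C, -, hC⟩ := exists_bound_Icc (hVs j).continuous
    have hSi : Integrable (S j k) surf := (hS j k).1.integrable (by norm_num)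
    refine hSi.mul_bdd (c := C) ((hVs j).continuous.aestronglyMeasurable.mul
      (measurable_normal k).aestronglyMeasurable) (ae_surf_mem_Icc.mono fun x hx => ?_)
    rw [norm_mul]
    exact (mul_le_of_le_one_right (norm_nonneg _) (abs_normal_le x k)).trans (hC x hx)
  have hbdry : ∫ x, ∑ j, (∑ k, S j k x * normal x k) * V j x ∂surf =
      ∑ j, ∑ k, ∫ x, S j k x * (V j x * normal x k) ∂surf := by
    simp_rw [Finset.sum_mul]
    rw [integral_finsetSum]
    · refine Finset.sum_congr rfl fun j _ => ?_
      rw [integral_finsetSum]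
      · exact Finset.sum_congr rfl fun k _ => integral_congr_ae
          (Filter.Eventually.of_forall fun x => by simp only []; ring)
      · exact fun k _ => (hSi j k).congr (Filter.Eventually.of_forall fun x => by simp only []; ring)
    · exact fun j _ => integrable_finsetSum _ fun k _ =>
        (hSi j k).congr (Filter.Eventually.of_forall fun x => by simp only []; ring)
  have heig : κ * ∑ j, testL (V j) (hVs j).continuous (u j) =
      ∑ j, (mu * ∑ k, testL (pd k (pd k (V j))) (hVs j).pd.pd.continuous (u j) +
        (lam + mu) * ∑ k, testL (pd j (pd k (V k))) (hVs k).pd.pd.continuous (u j)) := by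
    rw [Finset.mul_sum]
    refine Finset.sum_congr rfl fun j _ => ?_
    simp only [testL_apply]
    have hint : ∀ f : Pt → ℝ, Continuous f → Integrable (fun x => f x * u j x) volOmega :=
      fun f hf => by simpa only [mul_comm] using integrable_mul_of_continuous (L2_integrable (u j)) hf
    rw [← integral_const_mul, ← integral_finsetSum _ fun k _ => hint _ (hVs j).pd.pd.continuous,
      ← integral_finsetSum _ fun k _ => hint _ (hVs k).pd.pd.continuous, ← integral_const_mul,
      ← integral_const_mul, ← integral_add]
    · refine integral_congr_ae (Filter.Eventually.of_forall fun x => ?_)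
      simp only []
      rw [← mul_assoc, ← hV.eqn j x, ← Finset.sum_mul, ← Finset.sum_mul]
      ring
    · exact (integrable_finsetSum _ fun k _ => hint _ (hVs j).pd.pd.continuous).const_mul _
    · exact (integrable_finsetSum _ fun k _ => hint _ (hVs k).pd.pd.continuous).const_mul _
  rw [hbdry, heig]
  simp only [hvsum, map_sum, hs, stress_eq, map_add, map_smul, smul_eq_mul]
  have e1 : ∀ j k, testL (pd k (V j)) (hVs j).pd.continuous (d j k) =
      -testL (pd k (pd k (V j))) (hVs j).pd.pd.continuous (u j) := fun j k => hu _ _ _ (hVs j).pd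
  have e2 : ∀ j k, testL (pd k (V j)) (hVs j).pd.continuous (d k j) =
      -testL (pd k (pd j (V j))) (hVs j).pd.pd.continuous (u k) := fun j k => by
    rw [hu _ _ _ (hVs j).pd]
    simp only [pd_comm (i := j) (j := k) (hVs j)]
  have e3 : ∀ j l, testL (pd j (V j)) (hVs j).pd.continuous (d l l) =
      -testL (pd l (pd j (V j))) (hVs j).pd.pd.continuous (u l) := fun j l => hu _ _ _ (hVs j).pd
  set A : Fin 3 → Fin 3 → ℝ := fun j k => testL (pd k (pd k (V j))) (hVs j).pd.pd.continuous (u j)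
  set Bm : Fin 3 → Fin 3 → ℝ := fun j k =>
    testL (pd j (pd k (V k))) (hVs k).pd.pd.continuous (u j)
  have key : ∀ j k, mu * (testL (pd k (V j)) (hVs j).pd.continuous (d j k) +
      testL (pd k (V j)) (hVs j).pd.continuous (d k j)) +
      (if j = k then lam else 0) * ∑ l, testL (pd k (V j)) (hVs j).pd.continuous (d l l) =
      -(mu * (A j k + Bm k j) + (if j = k then lam else 0) * ∑ l, Bm l k) := by
    intro j k
    rw [e1, e2]
    by_cases hjk : j = k
    · subst hjk
      simp only [if_true, e3, Finset.sum_neg_distrib, A, Bm]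
      ring
    · simp only [hjk, if_false, A, Bm]; ring
  simp only [key]
  change _ = _ + ∑ j, (mu * ∑ k, A j k + (lam + mu) * ∑ k, Bm j k)
  simp only [sub_neg_eq_add, Finset.sum_add_distrib, Fin.sum_univ_three]
  simp
  ring

/-! ### The integral identity for a solution -/

/-- The solution `sinh (a (T - t)) / cosh (a T)` of `y'' = a² y` with `y(T) = 0`, `y'(0) = -a`. -/
def decay (a T t : ℝ) : ℝ := Real.sinh (a * (T - t)) / Real.cosh (a * T)

lemma continuous_decay (a T : ℝ) : Continuous (decay a T) := by
  unfold decay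
  exact (Real.continuous_sinh.comp (by fun_prop)).div_const _

lemma decay_nonneg {a T t : ℝ} (ha : 0 ≤ a) (ht : t ≤ T) : 0 ≤ decay a T t :=
  div_nonneg (Real.sinh_nonneg_iff.2 (mul_nonneg ha (by linarith))) (Real.cosh_pos _).le

lemma decay_le_one {a T t : ℝ} (ha : 0 ≤ a) (h0 : 0 ≤ t) : decay a T t ≤ 1 := by
  rw [decay, div_le_one (Real.cosh_pos _)]
  exact (Real.sinh_le_sinh.2 (by nlinarith)).trans (Real.sinh_lt_cosh _).le

lemma abs_decay_le_one {a T t : ℝ} (ha : 0 ≤ a) (ht : t ∈ Ioo 0 T) : |decay a T t| ≤ 1 := by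
  rw [abs_of_nonneg (decay_nonneg ha ht.2.le)]
  exact decay_le_one ha ht.1.le

/-- The pairing `∑ j, ∫ V_j w_j` of a smooth field and a field of `L²(Ω)³`. -/
def pairL (V : Fin 3 → Pt → ℝ) (w : Fin 3 → L2Omega) : ℝ := ∑ j, ∫ x in Omega, V j x * w j x

/-- The integral `∫ φ(t) sinh (a (T - t)) / cosh (a T) dt`. -/
def phiInt {T : ℝ} (a : ℝ) (I : Data T) : ℝ := ∫ t in Ioo 0 T, I.phi t * decay a T t

/-- The part of the integral identity that involves only the data `g`, `h` and `X`. -/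
def dataInt {T : ℝ} (a : ℝ) (V : Fin 3 → Pt → ℝ) (I : Data T) : ℝ :=
  a * pairL V I.g + Real.tanh (a * T) * pairL V I.h +
    ∫ q, decay a T q.1 * ∑ j, I.X j q * V j q.2 ∂(volLateral T)

lemma ae_volLateral {T : ℝ} : ∀ᵐ q ∂(volLateral T), q.1 ∈ Ioo 0 T ∧ q.2 ∈ Icc (0 : Pt) 1 := by
  have h1 : ∀ᵐ q ∂(volLateral T), q.1 ∈ Ioo 0 T :=
    Measure.quasiMeasurePreserving_fst.ae (ae_restrict_mem measurableSet_Ioo)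
  have h2 : ∀ᵐ q ∂(volLateral T), q.2 ∈ Icc (0 : Pt) 1 :=
    Measure.quasiMeasurePreserving_snd.ae ae_surf_mem_Icc
  exact h1.and h2

lemma integrable_lateral {T a : ℝ} (ha : 0 ≤ a) (X : Lp ℝ 1 (volLateral T)) {V : Pt → ℝ}
    (hV : Continuous V) : Integrable (fun q => decay a T q.1 * (X q * V q.2)) (volLateral T) := by
  obtain ⟨C, -, hC⟩ := exists_bound_Icc hV
  have hX : Integrable X (volLateral T) := L1.integrable_coeFn X
  have hm : Integrable (fun q => X q * V q.2) (volLateral T) :=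
    hX.mul_bdd (c := C) (hV.comp continuous_snd).aestronglyMeasurable
      (ae_volLateral.mono fun q hq => hC _ hq.2)
  exact hm.bdd_mul (c := 1) ((continuous_decay a T).comp continuous_fst).aestronglyMeasurable
    (ae_volLateral.mono fun q hq => abs_decay_le_one ha hq.1)

lemma hasDerivAt_decay (a T t : ℝ) :
    HasDerivAt (decay a T) (-a * Real.cosh (a * (T - t)) / Real.cosh (a * T)) t := by
  have h : HasDerivAt (fun t : ℝ => a * (T - t)) (-a) t := by
    simpa using ((hasDerivAt_id t).const_sub T).const_mul a
  exact (h.sinh.div_const (Real.cosh (a * T))).congr_deriv (by ring)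

lemma hasDerivAt_decay' (a T t : ℝ) :
    HasDerivAt (fun t => -a * Real.cosh (a * (T - t)) / Real.cosh (a * T)) (a ^ 2 * decay a T t) t := by
  have h : HasDerivAt (fun t : ℝ => a * (T - t)) (-a) t := by
    simpa using ((hasDerivAt_id t).const_sub T).const_mul a
  exact ((h.cosh.const_mul (-a)).div_const (Real.cosh (a * T))).congr_deriv (by
    simp only [decay]; ring)

/-- The integral identity obtained by testing the Lamé system with the product of an eigenfield for
the eigenvalue `a²` and `decay a T`. The term with `u(T)` is exponentially small in `a T`. -/
theorem IsSolution.identity {lam mu T : ℝ} (hT : 0 < T) {I : Data T} {u : Fin 3 → ℝ → L2Omega}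
    {f : Fin 3 → L2Omega} (hsol : IsSolution lam mu T I u f) {a : ℝ} (ha : 0 ≤ a)
    {V : Fin 3 → Pt → ℝ} (hV : IsEigenfield lam mu (a ^ 2) V) :
    dataInt a V I + phiInt a I * pairL V f =
      a / Real.cosh (a * T) * pairL V (fun j => u j T) := by
  obtain ⟨hC2, du, ddu, -, -, hdu, hddu, heq, hinit, htr, hst⟩ := hsol
  have hVc : ∀ j, Continuous (V j) := fun j => (hV.smooth j).continuous
  have hpair : ∀ w : Fin 3 → L2Omega, pairL V w = ∑ j, testL (V j) (hVc j) (w j) := fun w =>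
    Finset.sum_congr rfl fun j _ => (testL_apply (hVc j) (w j)).symm
  have huniq := uniqueDiffOn_Icc hT
  set p : ℝ → ℝ := fun t => pairL V (fun j => u j t) with hp
  set p1 : ℝ → ℝ := fun t => pairL V (fun j => derivWithin (u j) (Icc 0 T) t) with hp1
  set p2 : ℝ → ℝ := fun t => pairL V (fun j => iteratedDerivWithin 2 (u j) (Icc 0 T) t) with hp2
  have hcont : ∀ j, ContinuousOn (u j) (Icc 0 T) := fun j => (hC2 j).continuousOn
  have hcont1 : ∀ j, ContinuousOn (derivWithin (u j) (Icc 0 T)) (Icc 0 T) := fun j =>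
    (hC2 j).continuousOn_derivWithin huniq (by norm_num)
  have hcont2 : ∀ j, ContinuousOn (iteratedDerivWithin 2 (u j) (Icc 0 T)) (Icc 0 T) := fun j =>
    (hC2 j).continuousOn_iteratedDerivWithin (by norm_num) huniq
  have hpc : ∀ w : Fin 3 → ℝ → L2Omega, (∀ j, ContinuousOn (w j) (Icc 0 T)) →
      ContinuousOn (fun t => pairL V (fun j => w j t)) (Icc 0 T) := by
    intro w hw
    simp only [hpair]
    exact continuousOn_finsetSum _ fun j _ => (testL (V j) (hVc j)).continuous.comp_continuousOn (hw j)
  have hpd : ∀ w w' : Fin 3 → ℝ → L2Omega, ∀ t, (∀ j, HasDerivAt (w j) (w' j t) t) →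
      HasDerivAt (fun t => pairL V (fun j => w j t)) (pairL V (fun j => w' j t)) t := by
    intro w w' t hw
    simp only [hpair]
    exact HasDerivAt.fun_sum fun j _ => (testL (V j) (hVc j)).hasFDerivAt.comp_hasDerivAt t (hw j)
  have hd : ∀ t ∈ Ioo 0 T, HasDerivAt p (p1 t) t := fun t ht => hpd _ _ t fun j =>
    (((hC2 j).differentiableOn (by norm_num)) t ⟨ht.1.le, ht.2.le⟩).hasDerivWithinAt.hasDerivAt
      (Icc_mem_nhds ht.1 ht.2)
  have hd1 : ∀ t ∈ Ioo 0 T, HasDerivAt p1 (p2 t) t := fun t ht =>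
    hpd (fun j => derivWithin (u j) (Icc 0 T)) _ t fun j => by
      have h1 := (hC2 j).differentiableOn_iteratedDerivWithin (m := 1) (by norm_num) huniq t
        ⟨ht.1.le, ht.2.le⟩
      have h2 := h1.hasDerivWithinAt.hasDerivAt (Icc_mem_nhds ht.1 ht.2)
      rw [← iteratedDerivWithin_succ] at h2
      refine h2.congr_of_eventuallyEq ?_
      filter_upwards [Icc_mem_nhds ht.1 ht.2] with y hy
      rw [iteratedDerivWithin_one]
  set Kd : ℝ → ℝ := fun t => -a * Real.cosh (a * (T - t)) / Real.cosh (a * T) with hKd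
  have hKdc : Continuous Kd := by
    rw [hKd]
    exact (continuous_const.mul (Real.continuous_cosh.comp (by fun_prop))).div_const _
  have hftc := intervalIntegral.integral_eq_sub_of_hasDerivAt_of_le
    (f := fun t => decay a T t * p1 t - Kd t * p t)
    (f' := fun t => decay a T t * (p2 t - a ^ 2 * p t)) hT.le
    (((continuous_decay a T).continuousOn.mul (hpc _ hcont1)).sub
      (hKdc.continuousOn.mul (hpc _ hcont)))
    (fun t ht => by
      exact (((hasDerivAt_decay a T t).fun_mul (hd1 t ht)).fun_sub
        ((hasDerivAt_decay' a T t).fun_mul (hd t ht))).congr_deriv (by ring))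
    (ContinuousOn.intervalIntegrable (by
      rw [uIcc_of_le hT.le]
      exact (continuous_decay a T).continuousOn.mul
        ((hpc _ hcont2).sub ((hpc _ hcont).const_smul (a ^ 2)))))
  -- the equation, tested against `V` at almost every time
  have hae : ∀ᵐ t ∂(volTime T), p2 t - a ^ 2 * p t =
      ∫ x, ∑ j, I.X j (t, x) * V j x ∂surf + I.phi t * pairL V f := by
    filter_upwards [hdu, hddu, heq, htr, hst] with t h1 h2 h3 h4 h5
    obtain ⟨S, hS, hX⟩ := h5
    have hb := hV.betti (u := fun j => u j t) (d := fun a b => du a b t)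
      (dd := fun a b c => ddu a b c t) h1 h2 h4 hS
    have e : p2 t = ∑ j, testL (V j) (hVc j)
        (mu • (∑ k, ddu j k k t) + (lam + mu) • (∑ k, ddu k k j t)) + I.phi t * pairL V f := by
      rw [hp2]
      simp only [hpair]
      rw [Finset.mul_sum, ← Finset.sum_add_distrib]
      refine Finset.sum_congr rfl fun j _ => ?_
      rw [← smul_eq_mul, ← map_smul, ← map_add, ← h3 j]
      congr 1
      abel
    rw [e, hb, ← hpair]
    have e2 : ∫ x, ∑ j, (∑ k, S j k x * normal x k) * V j x ∂surf =
        ∫ x, ∑ j, I.X j (t, x) * V j x ∂surf := by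
      refine integral_congr_ae ?_
      filter_upwards [ae_all_iff.2 hX] with x hx
      exact Finset.sum_congr rfl fun j _ => by rw [hx j]
    rw [e2]
    ring
  rw [intervalIntegral.integral_of_le hT.le, integral_Ioc_eq_integral_Ioo,
    integral_congr_ae (g := fun t => decay a T t *
      (∫ x, ∑ j, I.X j (t, x) * V j x ∂surf + I.phi t * pairL V f))
      (hae.mono fun t ht => by simp only [ht])] at hftc
  have hlat : Integrable (fun q : ℝ × Pt => decay a T q.1 * ∑ j, I.X j q * V j q.2) (volLateral T) := by
    simp only [Finset.mul_sum]
    exact integrable_finsetSum _ fun j _ => integrable_lateral ha (I.X j) (hVc j)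
  have hφ : Integrable (fun t => I.phi t * decay a T t) (volTime T) :=
    (L1.integrable_coeFn I.phi).mul_bdd (c := 1) (continuous_decay a T).aestronglyMeasurable
      ((ae_restrict_mem measurableSet_Ioo).mono fun t ht => abs_decay_le_one ha ht)
  have hfub := integral_prod _ hlat
  have hfubi := hlat.integral_prod_left
  simp only [integral_const_mul] at hfub hfubi
  have hsplit : ∫ t in Ioo 0 T, decay a T t *
      (∫ x, ∑ j, I.X j (t, x) * V j x ∂surf + I.phi t * pairL V f) =
      ∫ q, decay a T q.1 * ∑ j, I.X j q * V j q.2 ∂(volLateral T) + phiInt a I * pairL V f := by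
    rw [hfub, phiInt, ← integral_mul_const, ← integral_add hfubi (hφ.mul_const _)]
    exact integral_congr_ae (Filter.Eventually.of_forall fun t => by simp only []; ring)
  rw [hsplit] at hftc
  have hcosh : Real.cosh (a * T) ≠ 0 := (Real.cosh_pos _).ne'
  have i0 : p 0 = pairL V I.g := by
    simp only [hp, pairL]
    exact Finset.sum_congr rfl fun j _ => by rw [(hinit j).1]
  have i1 : p1 0 = pairL V I.h := by
    simp only [hp1, pairL]
    exact Finset.sum_congr rfl fun j _ => by rw [(hinit j).2]
  have d0 : decay a T 0 = Real.tanh (a * T) := by rw [decay, Real.tanh_eq_sinh_div_cosh, sub_zero]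
  have dT : decay a T T = 0 := by simp [decay]
  have k0 : Kd 0 = -a := by simp only [hKd, sub_zero]; field_simp
  have kT : Kd T = -a / Real.cosh (a * T) := by simp [hKd]
  simp only [d0, dT, k0, kT, i0, i1] at hftc
  rw [dataInt]
  have : p T = pairL V (fun j => u j T) := rfl
  rw [← this]
  linear_combination hftc

/-! ### Stability of the integral identity -/

lemma abs_integral_mul_le {V : Pt → ℝ} (hV : Continuous V) {M : ℝ} (hM0 : 0 ≤ M)
    (hM : ∀ x ∈ Icc (0 : Pt) 1, |V x| ≤ M) (w : L2Omega) : |∫ x in Omega, V x * w x| ≤ M * ‖w‖ := by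
  rw [← inner_contToL2 V hV]
  refine (abs_real_inner_le_norm _ _).trans (mul_le_mul_of_nonneg_right ?_ (norm_nonneg _))
  have := Lp.norm_le_of_ae_bound (f := contToL2 V hV) hM0 (by
    filter_upwards [(hV.memLp_volOmega 2).coeFn_toLp, ae_restrict_mem measurableSet_Omega] with x hx hxm
    rw [contToL2, hx]
    exact hM x (Omega_subset_Icc hxm))
  simpa [measureUnivNNReal] using this

lemma pairL_sub {V : Fin 3 → Pt → ℝ} (hV : ∀ j, Continuous (V j)) (w w' : Fin 3 → L2Omega) :
    pairL V w - pairL V w' = pairL V (fun j => w j - w' j) := by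
  simp only [pairL, ← testL_apply (hV _), map_sub, Finset.sum_sub_distrib]

lemma abs_pairL_le {V : Fin 3 → Pt → ℝ} (hV : ∀ j, Continuous (V j)) {M : ℝ} (hM0 : 0 ≤ M)
    (hM : ∀ j, ∀ x ∈ Icc (0 : Pt) 1, |V j x| ≤ M) (w : Fin 3 → L2Omega) :
    |pairL V w| ≤ M * ∑ j, ‖w j‖ := by
  rw [Finset.mul_sum]
  exact (Finset.abs_sum_le_sum_abs _ _).trans
    (Finset.sum_le_sum fun j _ => abs_integral_mul_le (hV j) hM0 (hM j) (w j))

lemma abs_phiInt_sub_le {T : ℝ} {a ε : ℝ} (ha : 0 ≤ a) {I I' : Data T} (h : Close I I' ε) :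
    |phiInt a I' - phiInt a I| ≤ ε := by
  have hφ : ∀ I : Data T, Integrable (fun t => I.phi t * decay a T t) (volTime T) := fun I =>
    (L1.integrable_coeFn I.phi).mul_bdd (c := 1) (continuous_decay a T).aestronglyMeasurable
      ((ae_restrict_mem measurableSet_Ioo).mono fun t ht => abs_decay_le_one ha ht)
  rw [phiInt, phiInt, ← integral_sub (hφ I') (hφ I), ← Real.norm_eq_abs]
  refine (norm_integral_le_of_norm_le (L1.integrable_coeFn (I'.phi - I.phi)).norm ?_).trans
    ((L1.norm_eq_integral_norm _).symm.le.trans h.1)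
  filter_upwards [Lp.coeFn_sub I'.phi I.phi, ae_restrict_mem measurableSet_Ioo] with t ht htm
  rw [ht, Pi.sub_apply, ← sub_mul, norm_mul]
  exact mul_le_of_le_one_right (norm_nonneg _) (abs_decay_le_one ha htm)

/-- The dependence of `dataInt` on the data is Lipschitz, with a constant of the order of `a` times
the bound of the field. -/
lemma abs_dataInt_sub_le {T : ℝ} {a ε : ℝ} (ha : 0 ≤ a) {I I' : Data T}
    (h : Close I I' ε)
    {V : Fin 3 → Pt → ℝ} (hV : ∀ j, Continuous (V j)) {M : ℝ} (hM0 : 0 ≤ M)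
    (hM : ∀ j, ∀ x ∈ Icc (0 : Pt) 1, |V j x| ≤ M) :
    |dataInt a V I' - dataInt a V I| ≤ M * ε * (3 * a + 6) := by
  have hg : |pairL V I'.g - pairL V I.g| ≤ M * (3 * ε) := by
    rw [pairL_sub hV]
    refine (abs_pairL_le hV hM0 hM _).trans (mul_le_mul_of_nonneg_left ?_ hM0)
    refine (Finset.sum_le_card_nsmul _ _ ε fun j _ => (h.2 j).2.1).trans (by simp)
  have hh : |pairL V I'.h - pairL V I.h| ≤ M * (3 * ε) := by
    rw [pairL_sub hV]
    refine (abs_pairL_le hV hM0 hM _).trans (mul_le_mul_of_nonneg_left ?_ hM0)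
    refine (Finset.sum_le_card_nsmul _ _ ε fun j _ => (h.2 j).2.2).trans (by simp)
  have hX : |∫ q, decay a T q.1 * ∑ j, I'.X j q * V j q.2 ∂(volLateral T) -
      ∫ q, decay a T q.1 * ∑ j, I.X j q * V j q.2 ∂(volLateral T)| ≤ M * (3 * ε) := by
    simp only [Finset.mul_sum]
    rw [integral_finsetSum _ fun j _ => integrable_lateral ha _ (hV j),
      integral_finsetSum _ fun j _ => integrable_lateral ha _ (hV j), ← Finset.sum_sub_distrib]
    have : ∀ j, |∫ q, decay a T q.1 * (I'.X j q * V j q.2) ∂(volLateral T) -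
        ∫ q, decay a T q.1 * (I.X j q * V j q.2) ∂(volLateral T)| ≤ M * ε := by
      intro j
      rw [← integral_sub (integrable_lateral ha _ (hV j)) (integrable_lateral ha _ (hV j)),
        ← Real.norm_eq_abs]
      refine (norm_integral_le_of_norm_le
        ((L1.integrable_coeFn (I'.X j - I.X j)).norm.const_mul M) ?_).trans ?_
      · filter_upwards [Lp.coeFn_sub (I'.X j) (I.X j), ae_volLateral] with q hq hqm
        rw [hq, Pi.sub_apply, ← mul_sub, ← sub_mul, norm_mul, norm_mul, mul_comm M]
        exact (mul_le_of_le_one_left (by positivity) (abs_decay_le_one ha hqm.1)).trans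
          (mul_le_mul_of_nonneg_left (hM j _ hqm.2) (norm_nonneg _))
      · rw [integral_const_mul, ← L1.norm_eq_integral_norm]
        exact mul_le_mul_of_nonneg_left (h.2 j).1 hM0
    refine (Finset.abs_sum_le_sum_abs _ _).trans
      ((Finset.sum_le_card_nsmul _ _ _ fun j _ => this j).trans (le_of_eq ?_))
    simp
    ring
  have ht : |Real.tanh (a * T)| ≤ 1 := by
    rw [abs_le]; exact ⟨(Real.neg_one_lt_tanh _).le, (Real.tanh_lt_one _).le⟩
  rw [dataInt, dataInt, show ∀ x y z x' y' z' b : ℝ, a * x + b * y + z - (a * x' + b * y' + z') =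
    a * (x - x') + b * (y - y') + (z - z') by intros; ring]
  refine (abs_add_three _ _ _).trans ?_
  rw [abs_mul, abs_mul, abs_of_nonneg ha]
  have h1 := mul_le_mul_of_nonneg_left hg ha
  have h2 := (mul_le_of_le_one_left (abs_nonneg _) ht).trans hh
  linarith

lemma decay_le_exp {a T t Λ : ℝ} (ha : 0 ≤ a) (hΛ : Λ ≤ t) :
    decay a T t ≤ Real.exp (-(a * Λ)) := by
  rw [decay, div_le_iff₀ (Real.cosh_pos _), Real.sinh_eq, Real.cosh_eq]
  have h1 : Real.exp (a * (T - t)) ≤ Real.exp (-(a * Λ)) * Real.exp (a * T) := by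
    rw [← Real.exp_add]; exact Real.exp_le_exp.2 (by nlinarith)
  have h2 := Real.exp_pos (-(a * (T - t)))
  have h3 := mul_pos (Real.exp_pos (-(a * Λ))) (Real.exp_pos (-(a * T)))
  nlinarith

/-- The function `decay a T` stays away from `0` on `[0, 1/a]`. -/
lemma le_decay {a T t : ℝ} (ha : 0 < a) (ht0 : 0 ≤ t) (ht : t ≤ 1 / a) (hT : 2 ≤ a * T) :
    1 / 12 ≤ decay a T t := by
  have hat : a * t ≤ 1 := by rwa [le_div_iff₀ ha, mul_comm] at ht
  have h0 : 0 ≤ a * t := by positivity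
  rw [decay, le_div_iff₀ (Real.cosh_pos _), Real.sinh_eq, Real.cosh_eq]
  set E := Real.exp (a * T) with hE
  have hE2 : 3 ≤ E := by have := Real.add_one_le_exp (a * T); linarith
  have e1 : E ≤ 3 * Real.exp (a * (T - t)) := by
    have h3 : Real.exp 1 ≤ 3 := by have := Real.exp_one_lt_d9; linarith
    calc E ≤ Real.exp 1 * Real.exp (a * (T - t)) := by
          rw [← Real.exp_add]; exact Real.exp_le_exp.2 (by nlinarith)
      _ ≤ _ := by gcongr
  have e2 : Real.exp (-(a * (T - t))) ≤ 1 / 2 := by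
    rw [Real.exp_neg, inv_eq_one_div]
    refine one_div_le_one_div_of_le (by norm_num) ?_
    have := Real.add_one_le_exp (a * (T - t))
    nlinarith
  have e3 : Real.exp (-(a * T)) ≤ 1 := Real.exp_le_one_iff.2 (by linarith)
  linarith

/-- By condition (W1), the integral of `φ` against `decay a T` is of order `1/a`. -/
lemma W1.exists_le_abs_phiInt {T : ℝ} {I : Data T} (hW : W1 I) :
    ∃ c > 0, ∃ a₀ > 0, ∀ a ≥ a₀, c / a ≤ |phiInt a I| := by
  obtain ⟨Λ, hΛ, C, hC, hsign⟩ := hW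
  have hT : 0 < T := hΛ.1.trans hΛ.2
  have hmain : ∀ φ : ℝ → ℝ, Integrable φ (volTime T) → (∀ᵐ t ∂(volTime Λ), C ≤ φ t) →
      ∃ a₀ > 0, ∀ a ≥ a₀, (C / 24) / a ≤ ∫ t in Ioo 0 T, φ t * decay a T t := by
    intro φ hφ hCφ
    set N := ∫ t in Ioo 0 T, |φ t| with hN
    have hN0 : 0 ≤ N := integral_nonneg fun _ => abs_nonneg _
    refine ⟨1 / Λ + 2 / T + 48 * N / (C * Λ ^ 2), by have := hΛ.1; positivity, fun a ha => ?_⟩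
    have hΛ0 := hΛ.1
    have h1 : 1 / Λ ≤ a := by
      have : 0 ≤ 2 / T := by positivity
      have : 0 ≤ 48 * N / (C * Λ ^ 2) := by positivity
      linarith
    have h2 : 2 / T ≤ a := by
      have : 0 ≤ 1 / Λ := by positivity
      have : 0 ≤ 48 * N / (C * Λ ^ 2) := by positivity
      linarith
    have h3 : 48 * N / (C * Λ ^ 2) ≤ a := by
      have : 0 ≤ 1 / Λ := by positivity
      have : 0 ≤ 2 / T := by positivity
      linarith
    have ha0 : 0 < a := lt_of_lt_of_le (by positivity) h1
    have haT : 2 ≤ a * T := (div_le_iff₀ hT).1 h2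
    have haΛ : 1 / a ≤ Λ := by
      rw [div_le_iff₀ ha0, mul_comm]; exact (div_le_iff₀ hΛ0).1 h1
    have hprod : Integrable (fun t => φ t * decay a T t) (volTime T) :=
      hφ.mul_bdd (c := 1) (continuous_decay a T).aestronglyMeasurable
        ((ae_restrict_mem measurableSet_Ioo).mono fun t ht => abs_decay_le_one ha0.le ht)
    -- pointwise lower bound of the integrand
    have hpt : ∀ᵐ t ∂(volTime T), (Ioo 0 (1 / a)).indicator (fun _ => C / 12) t -
        Real.exp (-(a * Λ)) * |φ t| ≤ φ t * decay a T t := by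
      have hCφ' : ∀ᵐ t ∂(volTime T), t ∈ Ioo 0 Λ → C ≤ φ t :=
        ae_restrict_of_ae ((ae_restrict_iff' measurableSet_Ioo).1 hCφ)
      filter_upwards [hCφ', ae_restrict_mem measurableSet_Ioo] with t ht htm
      have hd0 := decay_nonneg (t := t) (T := T) ha0.le htm.2.le
      have hE : 0 ≤ Real.exp (-(a * Λ)) * |φ t| := by positivity
      by_cases ht1 : t ∈ Ioo 0 (1 / a)
      · rw [indicator_of_mem ht1]
        have := ht ⟨ht1.1, ht1.2.trans_le haΛ⟩
        have hd := le_decay ha0 ht1.1.le ht1.2.le haT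
        nlinarith
      · rw [indicator_of_notMem ht1, zero_sub]
        by_cases htΛ : t < Λ
        · have := mul_nonneg (hC.le.trans (ht ⟨htm.1, htΛ⟩)) hd0
          linarith
        · have := decay_le_exp (T := T) ha0.le (not_lt.1 htΛ)
          have h4 := mul_le_mul_of_nonneg_right this (abs_nonneg (φ t))
          have h5 := neg_abs_le (φ t * decay a T t)
          rw [abs_mul, abs_of_nonneg hd0] at h5
          linarith
    have hsub : Ioo 0 (1 / a) ⊆ Ioo 0 T := fun t ht => ⟨ht.1, ht.2.trans_le (haΛ.trans hΛ.2.le)⟩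
    have hind : Integrable ((Ioo 0 (1 / a)).indicator (fun _ => C / 12)) (volTime T) :=
      (integrable_const _).indicator measurableSet_Ioo
    have hval : ∫ t in Ioo 0 T, (Ioo 0 (1 / a)).indicator (fun _ => C / 12) t = C / 12 / a := by
      rw [integral_indicator measurableSet_Ioo, Measure.restrict_restrict measurableSet_Ioo,
        inter_eq_self_of_subset_left hsub, integral_const]
      simp [ha0.le]
      field_simp
    have hle := integral_mono_ae (hind.sub (hφ.abs.const_mul (Real.exp (-(a * Λ))))) hprod hpt
    simp only [Pi.sub_apply] at hle
    rw [integral_sub hind (hφ.abs.const_mul _), hval, integral_const_mul] at hle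
    refine le_trans ?_ hle
    -- the remainder is at most `C / (24 a)`
    have hexp : Real.exp (-(a * Λ)) * (a * Λ) ^ 2 ≤ 2 := by
      have h6 := Real.quadratic_le_exp_of_nonneg (x := a * Λ) (by positivity)
      rw [Real.exp_neg, inv_mul_le_iff₀ (Real.exp_pos _)]
      nlinarith [mul_pos ha0 hΛ0]
    have h7 : 48 * N ≤ a * (C * Λ ^ 2) := (div_le_iff₀ (by positivity)).1 h3
    have h8 : Real.exp (-(a * Λ)) * N ≤ C / 24 / a := by
      rw [le_div_iff₀ ha0]
      have h9 : Real.exp (-(a * Λ)) * (48 * N) ≤ Real.exp (-(a * Λ)) * (a * (C * Λ ^ 2)) :=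
        mul_le_mul_of_nonneg_left h7 (Real.exp_pos _).le
      nlinarith
    have : C / 12 / a = C / 24 / a + C / 24 / a := by ring
    linarith
  have hint : Integrable I.phi (volTime T) := L1.integrable_coeFn I.phi
  refine ⟨C / 24, by positivity, ?_⟩
  rcases hsign with h | h
  · obtain ⟨a₀, h0, h1⟩ := hmain _ hint h
    exact ⟨a₀, h0, fun a ha => (h1 a ha).trans (le_abs_self _)⟩
  · obtain ⟨a₀, h0, h1⟩ := hmain (fun t => -I.phi t) hint.neg (h.mono fun t ht => by linarith)
    refine ⟨a₀, h0, fun a ha => (h1 a ha).trans ?_⟩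
    simp only [neg_mul, integral_neg]
    exact neg_le_abs _

/-- For inexact data, the quotient of `dataInt` and `phiInt` still approximates `-∫ f · V`. -/
theorem IsSolution.exists_stability {lam mu T : ℝ} (hT : 0 < T) {I₀ : Data T} (hW : W1 I₀)
    {u : Fin 3 → ℝ → L2Omega} {f : Fin 3 → L2Omega} (hsol : IsSolution lam mu T I₀ u f) :
    ∃ C > 0, ∃ c > 0, ∃ a₀ > 0, ∀ a ≥ a₀, ∀ (V : Fin 3 → Pt → ℝ) (M ε : ℝ) (I : Data T),
      IsEigenfield lam mu (a ^ 2) V → 0 ≤ M → (∀ j, ∀ x ∈ Icc (0 : Pt) 1, |V j x| ≤ M) →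
      Close I₀ I ε → ε * a ≤ c → phiInt a I ≠ 0 ∧
        |dataInt a V I / phiInt a I + pairL V f| ≤
          C * a * M * (ε * (a + 1) + a / Real.cosh (a * T)) := by
  obtain ⟨c, hc, a₀, ha₀, hlow⟩ := hW.exists_le_abs_phiInt
  set Ff := ∑ j, ‖f j‖ with hFf
  set U := ∑ j, ‖u j T‖ with hU
  have hFf0 : 0 ≤ Ff := Finset.sum_nonneg fun _ _ => norm_nonneg _
  have hU0 : 0 ≤ U := Finset.sum_nonneg fun _ _ => norm_nonneg _
  refine ⟨2 / c * (6 + Ff + U), by positivity, c / 2, by positivity, a₀, ha₀,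
    fun a ha V M ε I hV hM0 hM hI hε => ?_⟩
  have ha0 : 0 < a := ha₀.trans_le ha
  have hVc : ∀ j, Continuous (V j) := fun j => (hV.smooth j).continuous
  have hε0 : 0 ≤ ε := (norm_nonneg _).trans hI.1
  have hid := hsol.identity hT ha0.le hV
  have h1 := abs_dataInt_sub_le ha0.le hI hVc hM0 hM
  have h2 := abs_phiInt_sub_le ha0.le hI
  have h3 := abs_pairL_le hVc hM0 hM f
  have h4 := abs_pairL_le hVc hM0 hM (fun j => u j T)
  have hq : c / 2 / a ≤ |phiInt a I| := by
    have h5 := hlow a ha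
    -- at most half of the lower bound `c / a` for the exact data is lost
    have h6 : |phiInt a I₀| ≤ |phiInt a I| + |phiInt a I - phiInt a I₀| := by
      have := abs_sub_abs_le_abs_sub (phiInt a I₀) (phiInt a I)
      rw [abs_sub_comm] at this
      linarith
    have h7 : ε ≤ c / 2 / a := (le_div_iff₀ ha0).2 hε
    have : c / a = c / 2 / a + c / 2 / a := by ring
    linarith
  have hqpos : 0 < |phiInt a I| := lt_of_lt_of_le (by positivity) hq
  have hne : phiInt a I ≠ 0 := abs_pos.1 hqpos
  refine ⟨hne, ?_⟩
  rw [div_add' _ _ _ hne, abs_div, div_le_iff₀ hqpos]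
  have hcosh := Real.cosh_pos (a * T)
  have hnum : |dataInt a V I + pairL V f * phiInt a I| ≤
      M * ε * (3 * a + 6) + ε * (M * Ff) + a / Real.cosh (a * T) * (M * U) := by
    have e : dataInt a V I + pairL V f * phiInt a I = (dataInt a V I - dataInt a V I₀) +
        (phiInt a I - phiInt a I₀) * pairL V f +
        a / Real.cosh (a * T) * pairL V (fun j => u j T) := by
      rw [← hid]; ring
    rw [e]
    refine (abs_add_three _ _ _).trans (add_le_add_three h1 ?_ ?_)
    · rw [abs_mul]; exact mul_le_mul h2 h3 (abs_nonneg _) hε0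
    · rw [abs_mul, abs_of_pos (div_pos ha0 hcosh)]
      exact mul_le_mul_of_nonneg_left h4 (by positivity)
  refine hnum.trans ?_
  set R := a / Real.cosh (a * T) with hR
  have hR0 : 0 ≤ R := by positivity
  have hfin : M * ε * (3 * a + 6) + ε * (M * Ff) + R * (M * U) ≤
      M * ((6 + Ff + U) * (ε * (a + 1) + R)) := by
    have t1 : 0 ≤ M * ε := mul_nonneg hM0 hε0
    have t2 : 0 ≤ M * R := mul_nonneg hM0 hR0
    have t3 : 0 ≤ M * ε * a := by positivity
    have := mul_nonneg t3 hFf0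
    have := mul_nonneg t3 hU0
    have := mul_nonneg t1 hU0
    have := mul_nonneg t2 hFf0
    nlinarith
  refine hfin.trans ?_
  have h8 : 0 ≤ 2 / c * (6 + Ff + U) * a * M * (ε * (a + 1) + R) := by positivity
  refine le_trans (le_of_eq ?_) (mul_le_mul_of_nonneg_left hq h8)
  field_simp

/-! ### The functional `H_j` in terms of real eigenfields -/

section Eigenfields

variable {σ : ℝ} {P : Pt → ℝ}

/-- A solution `P` of `ΔP = σ P` gives an eigenfield `-∇ ∂_j P` for the speed of the pressure waves,
and a divergence-free eigenfield `σ P e_j - ∇ ∂_j P` for that of the shear waves. -/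
lemma isEigenfield_gradient (lam mu : ℝ) (hP : ContDiff ℝ ((⊤ : ℕ∞) : WithTop ℕ∞) P)
    (hΔ : ∀ x, ∑ k, pd k (pd k P) x = σ * P x) (j : Fin 3) :
    IsEigenfield lam mu ((lam + 2 * mu) * σ) (fun k x => -pd k (pd j P) x) ∧
      IsEigenfield lam mu (mu * σ) (fun k x => (if k = j then σ * P x else 0) - pd k (pd j P) x) := by
  have hP1 : ∀ i, ContDiff ℝ ((⊤ : ℕ∞) : WithTop ℕ∞) (pd i P) := fun i => hP.pd
  have hP2 : ∀ i k, ContDiff ℝ ((⊤ : ℕ∞) : WithTop ℕ∞) (pd k (pd i P)) := fun i k => (hP1 i).pd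
  have hdiff : ∀ {f : Pt → ℝ}, ContDiff ℝ ((⊤ : ℕ∞) : WithTop ℕ∞) f → Differentiable ℝ f :=
    fun hf => hf.differentiable (by simp)
  have pd_neg' : ∀ (i : Fin 3) (f : Pt → ℝ), pd i (fun x => -f x) = fun x => -pd i f x := fun i f => by
    funext x; simp [pd, fderiv_fun_neg]
  have pd_smul' : ∀ (i : Fin 3) (f : Pt → ℝ), Differentiable ℝ f →
      pd i (fun x => σ * f x) = fun x => σ * pd i f x := fun i f hf => by
    funext x; simp [pd, fderiv_const_mul (hf x)]
  have pd_sub' : ∀ (i : Fin 3) (f g : Pt → ℝ), Differentiable ℝ f → Differentiable ℝ g →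
      pd i (fun x => f x - g x) = fun x => pd i f x - pd i g x := fun i f g hf hg => by
    funext x; simp [pd, fderiv_fun_sub (hf x) (hg x)]
  have pd_sum' : ∀ (i : Fin 3) (f : Fin 3 → Pt → ℝ), (∀ k, Differentiable ℝ (f k)) →
      pd i (fun x => ∑ k, f k x) = fun x => ∑ k, pd i (f k) x := fun i f hf => by
    funext x
    simp only [pd]
    rw [fderiv_fun_sum fun k _ => hf k x, sum_apply]
  -- derivatives of the Laplacian
  have hΔ1 : ∀ i x, ∑ k, pd i (pd k (pd k P)) x = σ * pd i P x := fun i x => by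
    have h1 := congrFun (pd_sum' i (fun k => pd k (pd k P)) fun k => hdiff (hP2 k k)) x
    have h2 := congrFun (pd_smul' i P (hdiff hP)) x
    rw [show (fun x => ∑ k, pd k (pd k P) x) = fun x => σ * P x from funext hΔ, h2] at h1
    exact h1.symm
  have hΔ2 : ∀ i l x, ∑ k, pd l (pd i (pd k (pd k P))) x = σ * pd l (pd i P) x := fun i l x => by
    have h1 := congrFun (pd_sum' l (fun k => pd i (pd k (pd k P))) fun k => hdiff (hP2 k k).pd) x
    have h2 := congrFun (pd_smul' l (pd i P) (hdiff (hP1 i))) x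
    rw [show (fun x => ∑ k, pd i (pd k (pd k P)) x) = fun x => σ * pd i P x from funext (hΔ1 i), h2]
      at h1
    exact h1.symm
  have hΔ2' : ∀ i l x, ∑ k, pd k (pd k (pd l (pd i P))) x = σ * pd l (pd i P) x := fun i l x => by
    rw [← hΔ2 i l x]
    refine Finset.sum_congr rfl fun k _ => ?_
    rw [pd_comm (i := k) (j := l) (hP1 i), pd_comm (i := k) (j := i) hP,
      pd_comm (i := k) (j := l) (hP1 k).pd, pd_comm (i := k) (j := i) (hP1 k)]
  have hdiv : ∀ i x, ∑ k, pd i (pd k (pd k (pd j P))) x = σ * pd i (pd j P) x := fun i x => by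
    rw [← hΔ2 j i x]
    refine Finset.sum_congr rfl fun k _ => ?_
    rw [pd_comm (i := k) (j := j) hP, pd_comm (i := k) (j := j) (hP1 k)]
  refine ⟨⟨fun k => (hP2 j k).neg, fun l x => ?_⟩, ⟨fun k => ?_, fun l x => ?_⟩⟩
  · simp only [pd_neg', Finset.sum_neg_distrib]
    rw [hΔ2', hdiv]; ring
  · by_cases hkj : k = j
    · simp only [hkj, if_true]; exact (contDiff_const.mul hP).sub (hP2 j j)
    · simp only [hkj, if_false]; exact contDiff_const.sub (hP2 j k)
  · have hsm : ∀ k, ContDiff ℝ ((⊤ : ℕ∞) : WithTop ℕ∞) (fun x => if k = j then σ * P x else 0) := by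
      intro k
      by_cases hkj : k = j
      · simp only [hkj, if_true]; exact contDiff_const.mul hP
      · simp only [hkj, if_false]; exact contDiff_const
    have hpd1 : ∀ i k, pd i (fun x => if k = j then σ * P x else 0) =
        fun x => if k = j then σ * pd i P x else 0 := by
      intro i k
      by_cases hkj : k = j
      · simp only [hkj, if_true]; exact pd_smul' i P (hdiff hP)
      · simp only [hkj, if_false]; funext x; simp [pd]
    have hsm1 : ∀ i k, ContDiff ℝ ((⊤ : ℕ∞) : WithTop ℕ∞)
        (fun x => if k = j then σ * pd i P x else 0) := by
      intro i k
      rw [← hpd1]; exact (hsm k).pd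
    have hpd2 : ∀ i l k, pd l (fun x => if k = j then σ * pd i P x else 0) =
        fun x => if k = j then σ * pd l (pd i P) x else 0 := by
      intro i l k
      by_cases hkj : k = j
      · simp only [hkj, if_true]; exact pd_smul' l _ (hdiff (hP1 i))
      · simp only [hkj, if_false]; funext x; simp [pd]
    have e : ∀ i m k, pd m (pd i (fun x => (if k = j then σ * P x else 0) - pd k (pd j P) x)) =
        fun x => (if k = j then σ * pd m (pd i P) x else 0) - pd m (pd i (pd k (pd j P))) x := by
      intro i m k
      rw [pd_sub' i _ _ (hdiff (hsm k)) (hdiff (hP2 j k)), hpd1,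
        pd_sub' m _ _ (hdiff (hsm1 i k)) (hdiff (hP2 j k).pd), hpd2]
    simp only [e, Finset.sum_sub_distrib]
    rw [hΔ2', hdiv, Finset.sum_ite_eq' Finset.univ j, if_pos (Finset.mem_univ j), sub_self, mul_zero,
      add_zero]
    by_cases hlj : l = j
    · simp only [hlj, if_true]
      rw [← Finset.mul_sum, hΔ]; ring
    · simp only [hlj, if_false]
      simp only [Finset.sum_const_zero]; ring

end Eigenfields

/-- The factors of the function `cosh (z x₀) cos (b x₁) cos (d x₂)`. -/
def coshFactor (z b d : ℝ) (i : Fin 3) : ℝ → ℝ :=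
  ![fun t => Real.cosh (z * t), fun t => Real.cos (b * t), fun t => Real.cos (d * t)] i

/-- The function `cosh (z x₀) cos (b x₁) cos (d x₂)`, which is `G(α, ·)` for `α = (-iz, b, d)`. -/
def coshCos (z b d : ℝ) (x : Pt) : ℝ := ∏ i, coshFactor z b d i (x i)

/-- The frequency vector `(-iz, b, d)`. -/
def freq (z : ℂ) (b d : ℝ) : Fin 3 → ℂ := ![-Complex.I * z, (b : ℂ), (d : ℂ)]

lemma contDiff_coshFactor (z b d : ℝ) (i : Fin 3) {n : WithTop ℕ∞} :
    ContDiff ℝ n (coshFactor z b d i) := by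
  unfold coshFactor
  fin_cases i
  · exact Real.contDiff_cosh.comp (contDiff_const.mul contDiff_id)
  · exact Real.contDiff_cos.comp (contDiff_const.mul contDiff_id)
  · exact Real.contDiff_cos.comp (contDiff_const.mul contDiff_id)

lemma contDiff_coshCos (z b d : ℝ) {n : WithTop ℕ∞} : ContDiff ℝ n (coshCos z b d) :=
  contDiff_prod fun i _ => (contDiff_coshFactor z b d i).comp (contDiff_apply ℝ ℝ i)

lemma deriv_coshFactor (z b d : ℝ) (i : Fin 3) : deriv (coshFactor z b d i) =
    ![fun t => z * Real.sinh (z * t), fun t => -(b * Real.sin (b * t)),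
      fun t => -(d * Real.sin (d * t))] i := by
  have h : ∀ c t : ℝ, HasDerivAt (fun t => c * t) c t := fun c t => by
    simpa using (hasDerivAt_id t).const_mul c
  unfold coshFactor
  fin_cases i
  · funext t; exact ((h z t).cosh.congr_deriv (by simp; ring)).deriv
  · funext t; exact ((h b t).cos.congr_deriv (by simp; ring)).deriv
  · funext t; exact ((h d t).cos.congr_deriv (by simp; ring)).deriv

lemma deriv_deriv_coshFactor (z b d : ℝ) (i : Fin 3) (t : ℝ) :
    deriv (deriv (coshFactor z b d i)) t = ![z ^ 2, -b ^ 2, -d ^ 2] i * coshFactor z b d i t := by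
  have h : ∀ c t : ℝ, HasDerivAt (fun t => c * t) c t := fun c t => by
    simpa using (hasDerivAt_id t).const_mul c
  rw [deriv_coshFactor]
  unfold coshFactor
  fin_cases i
  · exact (((h z t).sinh.const_mul z).congr_deriv (by simp; ring)).deriv
  · exact (((h b t).sin.const_mul b).neg.congr_deriv (by simp; ring)).deriv
  · exact (((h d t).sin.const_mul d).neg.congr_deriv (by simp; ring)).deriv

lemma ofReal_coshFactor (z b d : ℝ) (i : Fin 3) (t : ℝ) :
    (coshFactor z b d i t : ℂ) = Complex.cos (freq z b d i * t) := by
  fin_cases i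
  · simp only [coshFactor, freq]
    change ((Real.cosh (z * t) : ℝ) : ℂ) = Complex.cos (-Complex.I * z * t)
    rw [show -Complex.I * z * t = -((z * t) * Complex.I) by ring, Complex.cos_neg, Complex.cos_mul_I]
    push_cast; rfl
  · simp [coshFactor, freq]
  · simp [coshFactor, freq]

lemma ofReal_deriv_coshFactor (z b d : ℝ) (i : Fin 3) (t : ℝ) :
    ((deriv (coshFactor z b d i) t : ℝ) : ℂ) = -(freq z b d i * Complex.sin (freq z b d i * t)) := by
  rw [deriv_coshFactor]
  fin_cases i
  · simp only [freq]
    change ((z * Real.sinh (z * t) : ℝ) : ℂ) = -(-Complex.I * z * Complex.sin (-Complex.I * z * t))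
    rw [show -Complex.I * z * t = -((z * t) * Complex.I) by ring, Complex.sin_neg, Complex.sin_mul_I]
    push_cast
    linear_combination ((z : ℂ) * Complex.sinh (z * t)) * Complex.I_mul_I
  · simp [freq]
  · simp [freq]

lemma ofReal_deriv_deriv_coshFactor (z b d : ℝ) (i : Fin 3) (t : ℝ) :
    ((deriv (deriv (coshFactor z b d i)) t : ℝ) : ℂ) =
      -(freq z b d i ^ 2 * Complex.cos (freq z b d i * t)) := by
  rw [deriv_deriv_coshFactor, Complex.ofReal_mul, ofReal_coshFactor, ← neg_mul]
  congr 1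
  fin_cases i <;> simp [freq, mul_pow]

lemma ofReal_coshCos (z b d : ℝ) (j : Fin 3) (x : Pt) :
    (coshCos z b d x : ℂ) = G j j (freq z b d) x := by
  simp [coshCos, G, ofReal_coshFactor]

lemma ofReal_pd_pd_coshCos (z b d : ℝ) (j k : Fin 3) (x : Pt) :
    ((pd k (pd j (coshCos z b d)) x : ℝ) : ℂ) =
      -(freq z b d j * (freq z b d k * G j k (freq z b d) x)) := by
  have hc : ∀ i, ContDiff ℝ ((⊤ : ℕ∞) : WithTop ℕ∞) (coshFactor z b d i) := fun i =>
    contDiff_coshFactor z b d i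
  have hd : ∀ i, Differentiable ℝ (coshFactor z b d i) := fun i => (hc i).differentiable (by simp)
  have hd' : ∀ i, Differentiable ℝ (deriv (coshFactor z b d i)) := fun i =>
    ((contDiff_infty_iff_deriv.1 (hc i)).2).differentiable (by simp)
  have h1 : pd j (coshCos z b d) = fun x => ∏ l,
      Function.update (coshFactor z b d) j (deriv (coshFactor z b d j)) l (x l) :=
    funext fun x => pd_prod hd x
  rw [h1, pd_prod (fun l => by
    rcases eq_or_ne l j with rfl | h
    · rw [Function.update_self]; exact hd' _
    · rw [Function.update_of_ne h]; exact hd _)]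
  rw [Complex.ofReal_prod]
  have c := fun i => ofReal_coshFactor z b d i (x i)
  have c1 := fun i => ofReal_deriv_coshFactor z b d i (x i)
  have c2 := fun i => ofReal_deriv_deriv_coshFactor z b d i (x i)
  generalize freq z b d = α at c c1 c2
  simp only [Fin.prod_univ_three]
  fin_cases j <;> fin_cases k <;>
    simp [Function.update, G, Fin.prod_univ_three, c, c1, c2] <;> ring

lemma norm_freq_le {z b d : ℝ} (hb : |b| ≤ |z|) (hd : |d| ≤ |z|) (i : Fin 3) :
    ‖freq z b d i‖ ≤ |z| := by
  fin_cases i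
  · simp [freq]
  · simpa [freq] using hb
  · simpa [freq] using hd

lemma norm_G_le {z b d : ℝ} (j k : Fin 3) {x : Pt} (hx : x ∈ Icc (0 : Pt) 1) :
    ‖G j k (freq z b d) x‖ ≤ Real.exp |z| := by
  have hx0 : |z * x 0| ≤ |z| := by
    rw [abs_mul]
    refine mul_le_of_le_one_right (abs_nonneg _) ?_
    rw [abs_of_nonneg (hx.1 0)]; exact hx.2 0
  have hcosh : Real.cosh (z * x 0) ≤ Real.exp |z| := by
    rw [← Real.cosh_abs]
    have h1 : Real.cosh |z * x 0| ≤ Real.exp |z * x 0| := by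
      rw [Real.cosh_eq]
      have := Real.exp_le_exp.2 (neg_le_self (abs_nonneg (z * x 0)))
      linarith
    exact h1.trans (Real.exp_le_exp.2 hx0)
  have hsinh : |Real.sinh (z * x 0)| ≤ Real.exp |z| := by
    refine le_trans ?_ hcosh
    rw [abs_le]
    exact ⟨by rw [neg_le, ← Real.sinh_neg, ← Real.cosh_neg]; exact (Real.sinh_lt_cosh _).le,
      (Real.sinh_lt_cosh _).le⟩
  have he : freq z b d 0 * x 0 = -(((z * x 0 : ℝ) : ℂ) * Complex.I) := by
    simp only [freq]; push_cast
    ring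
  have hcos : ∀ i, ‖Complex.cos (freq z b d i * x i)‖ ≤ if i = 0 then Real.exp |z| else 1 := by
    intro i
    fin_cases i
    · change ‖Complex.cos (freq z b d 0 * x 0)‖ ≤ _
      rw [he, Complex.cos_neg, Complex.cos_mul_I, ← Complex.ofReal_cosh, Complex.norm_real,
        Real.norm_of_nonneg (Real.cosh_pos _).le]
      simpa using hcosh
    · change ‖Complex.cos ((b : ℂ) * (x 1 : ℂ))‖ ≤ _
      rw [← Complex.ofReal_mul, ← Complex.ofReal_cos, Complex.norm_real]
      simpa using Real.abs_cos_le_one _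
    · change ‖Complex.cos ((d : ℂ) * (x 2 : ℂ))‖ ≤ _
      rw [← Complex.ofReal_mul, ← Complex.ofReal_cos, Complex.norm_real]
      simpa using Real.abs_cos_le_one _
  have hsin : ∀ i, ‖Complex.sin (freq z b d i * x i)‖ ≤ if i = 0 then Real.exp |z| else 1 := by
    intro i
    fin_cases i
    · change ‖Complex.sin (freq z b d 0 * x 0)‖ ≤ _
      rw [he, Complex.sin_neg, Complex.sin_mul_I, ← Complex.ofReal_sinh, norm_neg, norm_mul,
        Complex.norm_I, mul_one, Complex.norm_real]
      simpa using hsinh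
    · change ‖Complex.sin ((b : ℂ) * (x 1 : ℂ))‖ ≤ _
      rw [← Complex.ofReal_mul, ← Complex.ofReal_sin, Complex.norm_real]
      simpa using Real.abs_sin_le_one _
    · change ‖Complex.sin ((d : ℂ) * (x 2 : ℂ))‖ ≤ _
      rw [← Complex.ofReal_mul, ← Complex.ofReal_sin, Complex.norm_real]
      simpa using Real.abs_sin_le_one _
  have hprod : ∏ i : Fin 3, (if i = 0 then Real.exp |z| else 1) = Real.exp |z| := by
    simp
  unfold G
  split_ifs with hjk
  · rw [norm_prod, ← hprod]
    exact Finset.prod_le_prod (fun _ _ => norm_nonneg _) fun i _ => hcos i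
  · rw [norm_neg, norm_prod, ← hprod]
    refine Finset.prod_le_prod (fun _ _ => norm_nonneg _) fun i _ => ?_
    split_ifs with h1 h2
    · have := hsin i; rwa [if_pos h2] at this
    · have := hsin i; rwa [if_neg h2] at this
    · have := hcos i; rwa [if_pos (by assumption)] at this
    · have := hcos i; rwa [if_neg (by assumption)] at this

lemma sum_pd_pd_coshCos (z b d : ℝ) (x : Pt) :
    ∑ k, pd k (pd k (coshCos z b d)) x = (z ^ 2 - b ^ 2 - d ^ 2) * coshCos z b d x := by
  have : ((∑ k, pd k (pd k (coshCos z b d)) x : ℝ) : ℂ) =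
      (((z ^ 2 - b ^ 2 - d ^ 2) * coshCos z b d x : ℝ) : ℂ) := by
    push_cast
    simp only [ofReal_pd_pd_coshCos, Fin.sum_univ_three, ← ofReal_coshCos]
    simp only [freq]
    simp
    linear_combination (-(z : ℂ) ^ 2 * coshCos z b d x) * Complex.I_mul_I
  exact_mod_cast this

lemma abs0_sq {z b d : ℝ} (h : 0 ≤ z ^ 2 - b ^ 2 - d ^ 2) :
    abs0 (freq z b d) ^ 2 = z ^ 2 - b ^ 2 - d ^ 2 := by
  have e : ∑ i, freq z b d i ^ 2 = ((-(z ^ 2 - b ^ 2 - d ^ 2) : ℝ) : ℂ) := by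
    simp only [Fin.sum_univ_three, freq]
    simp [mul_pow]
    ring
  rw [abs0, Real.sq_sqrt (norm_nonneg _), e, Complex.norm_real, norm_neg, Real.norm_of_nonneg h]

/-- The gradient eigenfield `V_k = α_j α_k G_k^j` for `α = (-iz, b, d)`. -/
def gradField (z b d : ℝ) (j k : Fin 3) (x : Pt) : ℝ := -pd k (pd j (coshCos z b d)) x

/-- The divergence-free eigenfield `W_k = |α|₀² G δ_{jk} + α_j α_k G_k^j` for `α = (-iz, b, d)`. -/
def solField (z b d : ℝ) (j k : Fin 3) (x : Pt) : ℝ :=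
  (if k = j then (z ^ 2 - b ^ 2 - d ^ 2) * coshCos z b d x else 0) - pd k (pd j (coshCos z b d)) x

lemma ofReal_gradField (z b d : ℝ) (j k : Fin 3) (x : Pt) :
    (gradField z b d j k x : ℂ) = freq z b d j * (freq z b d k * G j k (freq z b d) x) := by
  rw [gradField, Complex.ofReal_neg, ofReal_pd_pd_coshCos, neg_neg]

lemma ofReal_solField {z b d : ℝ} (h : 0 ≤ z ^ 2 - b ^ 2 - d ^ 2) (j k : Fin 3) (x : Pt) :
    (solField z b d j k x : ℂ) = (if k = j then (abs0 (freq z b d) : ℂ) ^ 2 *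
      G j j (freq z b d) x else 0) + freq z b d j * (freq z b d k * G j k (freq z b d) x) := by
  rw [solField, Complex.ofReal_sub, ofReal_pd_pd_coshCos, sub_neg_eq_add]
  congr 1
  split_ifs
  · rw [Complex.ofReal_mul, ← Complex.ofReal_pow, abs0_sq h, ofReal_coshCos]
  · simp

lemma contDiff_gradField (z b d : ℝ) (j k : Fin 3) :
    ContDiff ℝ ((⊤ : ℕ∞) : WithTop ℕ∞) (gradField z b d j k) :=
  ((isEigenfield_gradient 0 0 (contDiff_coshCos z b d) (sum_pd_pd_coshCos z b d) j).1).smooth k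

lemma contDiff_solField (z b d : ℝ) (j k : Fin 3) :
    ContDiff ℝ ((⊤ : ℕ∞) : WithTop ℕ∞) (solField z b d j k) :=
  ((isEigenfield_gradient 0 0 (contDiff_coshCos z b d) (sum_pd_pd_coshCos z b d) j).2).smooth k

lemma integral_complex_pairL {V : Fin 3 → Pt → ℝ} (hV : ∀ k, Continuous (V k)) (w : Fin 3 → L2Omega) :
    ∫ x in Omega, ∑ k, (V k x : ℂ) * (w k x : ℂ) = (pairL V w : ℂ) := by
  have h : ∀ k, Integrable (fun x => V k x * w k x) volOmega := fun k => by
    simpa only [mul_comm] using integrable_mul_of_continuous (L2_integrable (w k)) (hV k)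
  rw [pairL, ← integral_finsetSum _ fun k _ => h k, ← integral_complex_ofReal]
  push_cast
  rfl

lemma D_eq_phiInt {T : ℝ} (c : ℝ) (I : Data T) (α : Fin 3 → ℂ) :
    D c I α = -(abs0 α) ^ 2 * phiInt (c * abs0 α) I := rfl

lemma E1_eq_dataInt {T : ℝ} (c : ℝ) (I : Data T) (j : Fin 3) (z b d : ℝ) :
    E1 c I j (freq z b d) = -(dataInt (c * abs0 (freq z b d)) (gradField z b d j) I : ℂ) := by
  have hV : ∀ k, Continuous (gradField z b d j k) := fun k => (contDiff_gradField z b d j k).continuous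
  have hL : ∀ w : Fin 3 → L2Omega, freq z b d j *
      (∫ x in Omega, ∑ k, freq z b d k * (w k x : ℂ) * G j k (freq z b d) x) =
        (pairL (gradField z b d j) w : ℂ) := by
    intro w
    rw [← integral_complex_pairL hV, ← integral_const_mul]
    refine integral_congr_ae (Filter.Eventually.of_forall fun x => ?_)
    simp only [ofReal_gradField, Finset.mul_sum]
    exact Finset.sum_congr rfl fun k _ => by ring
  have hX : ∫ q, (K c T (freq z b d) q.1 : ℂ) * (freq z b d j * ∑ k, freq z b d k * (I.X k q : ℂ) *
      G j k (freq z b d) q.2) ∂(volLateral T) =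
      ((∫ q, decay (c * abs0 (freq z b d)) T q.1 * ∑ k, I.X k q * gradField z b d j k q.2
        ∂(volLateral T) : ℝ) : ℂ) := by
    rw [← integral_complex_ofReal]
    refine integral_congr_ae (Filter.Eventually.of_forall fun q => ?_)
    simp only [Complex.ofReal_mul, Complex.ofReal_sum, ofReal_gradField, Finset.mul_sum]
    exact Finset.sum_congr rfl fun k _ => by rw [K, decay]; ring
  rw [E1, hX, mul_assoc, mul_assoc, hL, hL, dataInt]
  push_cast
  ring

lemma E2_eq_dataInt {T : ℝ} (c : ℝ) (I : Data T) (j : Fin 3) {z b d : ℝ}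
    (h : 0 ≤ z ^ 2 - b ^ 2 - d ^ 2) :
    E2 c I j (freq z b d) = (dataInt (c * abs0 (freq z b d)) (solField z b d j) I : ℂ) := by
  have hV : ∀ k, Continuous (solField z b d j k) := fun k => (contDiff_solField z b d j k).continuous
  have hsum : ∀ (y : Fin 3 → ℂ) (x : Pt), ∑ k, (solField z b d j k x : ℂ) * y k =
      (abs0 (freq z b d) : ℂ) ^ 2 * y j * G j j (freq z b d) x +
        freq z b d j * ∑ k, freq z b d k * y k * G j k (freq z b d) x := by
    intro y x
    simp only [ofReal_solField h, add_mul, Finset.sum_add_distrib, ite_mul, zero_mul,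
      Finset.sum_ite_eq', Finset.mem_univ, if_true, Finset.mul_sum]
    congr 1
    · ring
    · exact Finset.sum_congr rfl fun k _ => by ring
  have hL : ∀ w : Fin 3 → L2Omega,
      (∫ x in Omega, (-((abs0 (freq z b d) : ℂ) ^ 2) * (w j x : ℂ) * G j j (freq z b d) x
        - freq z b d j * ∑ k, freq z b d k * (w k x : ℂ) * G j k (freq z b d) x)) =
        -(pairL (solField z b d j) w : ℂ) := by
    intro w
    rw [← integral_complex_pairL hV, ← integral_neg]
    refine integral_congr_ae (Filter.Eventually.of_forall fun x => ?_)
    simp only [hsum]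
    ring
  have hX : ∫ q, (K c T (freq z b d) q.1 : ℂ) * ((abs0 (freq z b d) : ℂ) ^ 2 * (I.X j q : ℂ) *
      G j j (freq z b d) q.2 + freq z b d j * ∑ k, freq z b d k * (I.X k q : ℂ) *
      G j k (freq z b d) q.2) ∂(volLateral T) =
      ((∫ q, decay (c * abs0 (freq z b d)) T q.1 * ∑ k, I.X k q * solField z b d j k q.2
        ∂(volLateral T) : ℝ) : ℂ) := by
    rw [← integral_complex_ofReal]
    refine integral_congr_ae (Filter.Eventually.of_forall fun q => ?_)
    simp only []
    rw [← hsum (fun k => (I.X k q : ℂ)) q.2, K, decay]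
    push_cast
    congr 1
    exact Finset.sum_congr rfl fun k _ => by ring
  rw [E2, hX, hL, hL, dataInt]
  push_cast
  ring

lemma abs_fields_le {z b d : ℝ} (hb : |b| ≤ |z|) (hd : |d| ≤ |z|)
    (h : 0 ≤ z ^ 2 - b ^ 2 - d ^ 2) (j k : Fin 3) {x : Pt} (hx : x ∈ Icc (0 : Pt) 1) :
    |gradField z b d j k x| ≤ 2 * z ^ 2 * Real.exp |z| ∧
      |solField z b d j k x| ≤ 2 * z ^ 2 * Real.exp |z| := by
  have h1 : ‖freq z b d j * (freq z b d k * G j k (freq z b d) x)‖ ≤ z ^ 2 * Real.exp |z| := by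
    rw [norm_mul, norm_mul, ← sq_abs z, sq, mul_assoc]
    have := norm_freq_le hb hd j
    have := norm_freq_le hb hd k
    have := norm_G_le (z := z) (b := b) (d := d) j k hx
    gcongr
  have h2 : ‖(if k = j then (abs0 (freq z b d) : ℂ) ^ 2 * G j j (freq z b d) x else 0)‖ ≤
      z ^ 2 * Real.exp |z| := by
    split_ifs
    · rw [norm_mul, ← Complex.ofReal_pow, abs0_sq h, Complex.norm_real, Real.norm_of_nonneg h]
      have := norm_G_le (z := z) (b := b) (d := d) j j hx
      have : z ^ 2 - b ^ 2 - d ^ 2 ≤ z ^ 2 := by nlinarith [sq_nonneg b, sq_nonneg d]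
      gcongr
    · rw [norm_zero]; positivity
  constructor
  · rw [← Real.norm_eq_abs, ← Complex.norm_real, ofReal_gradField]
    refine h1.trans ?_
    have : 0 ≤ z ^ 2 * Real.exp |z| := by positivity
    linarith
  · rw [← Real.norm_eq_abs, ← Complex.norm_real, ofReal_solField h]
    refine (norm_add_le _ _).trans ?_
    linarith

/-- The two eigenfields differ by `|α|₀² G e_j`, so that the difference of their pairings with a
field singles out its component `j`. -/
lemma pairL_solField_sub (z b d : ℝ) (j : Fin 3) (w : Fin 3 → L2Omega) :
    pairL (solField z b d j) w - pairL (gradField z b d j) w =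
      (z ^ 2 - b ^ 2 - d ^ 2) * ∫ x in Omega, coshCos z b d x * w j x := by
  have hi : ∀ {V : Pt → ℝ} (k : Fin 3), Continuous V → Integrable (fun x => V x * w k x) volOmega :=
    fun k hV => by simpa only [mul_comm] using integrable_mul_of_continuous (L2_integrable (w k)) hV
  rw [pairL, pairL, ← Finset.sum_sub_distrib, Finset.sum_eq_single j]
  · rw [← integral_sub (hi j (contDiff_solField z b d j j).continuous)
      (hi j (contDiff_gradField z b d j j).continuous), ← integral_const_mul]
    refine integral_congr_ae (Filter.Eventually.of_forall fun x => ?_)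
    simp only [solField, gradField, if_true]
    ring
  · intro k _ hk
    rw [sub_eq_zero]
    refine integral_congr_ae (Filter.Eventually.of_forall fun x => ?_)
    simp only [solField, gradField, hk, if_false]
    ring
  · simp

/-- The error bound of `IsSolution.exists_stability` in terms of `y = |z|`, if `a` is at most of the
order of `y` and `a T ≥ 12 y`. -/
lemma scalar_bound {C M ε c a y T : ℝ} (hC : 0 ≤ C) (hM : 0 ≤ M) (hε : 0 ≤ ε) (hc : 0 ≤ c)
    (ha : 0 ≤ a) (hac : a ≤ c * y) (hy : 1 ≤ y) (haT : 12 * y ≤ a * T) :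
    C * a * M * (ε * (a + 1) + a / Real.cosh (a * T)) ≤
      C * c * (c + 1 + 2 * c) * y ^ 2 * M * (ε + Real.exp (-(12 * y))) := by
  have hcosh : a / Real.cosh (a * T) ≤ 2 * c * y * Real.exp (-(12 * y)) := by
    rw [div_le_iff₀ (Real.cosh_pos _)]
    have h2 : Real.exp (12 * y) / 2 ≤ Real.cosh (a * T) := by
      rw [Real.cosh_eq]
      have := Real.exp_le_exp.2 haT
      have := Real.exp_pos (-(a * T))
      linarith
    calc a ≤ c * y := hac
      _ = 2 * c * y * Real.exp (-(12 * y)) * (Real.exp (12 * y) / 2) := by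
        have : Real.exp (-(12 * y)) * Real.exp (12 * y) = 1 := by
          rw [← Real.exp_add]; simp
        linear_combination (-c * y) * this
      _ ≤ _ := mul_le_mul_of_nonneg_left h2 (by positivity)
  have hX0 : 0 < Real.exp (-(12 * y)) := Real.exp_pos _
  generalize Real.exp (-(12 * y)) = X at *
  have hin : ε * (a + 1) + a / Real.cosh (a * T) ≤ (c + 1 + 2 * c) * y * (ε + X) := by
    have t1 : ε * (a + 1) ≤ ε * (c * y + y) := mul_le_mul_of_nonneg_left (by linarith) hε
    have t2 : 0 ≤ ε * (2 * c * y) := by positivity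
    have t3 : 0 ≤ X * ((c + 1) * y) := by positivity
    nlinarith
  calc C * a * M * (ε * (a + 1) + a / Real.cosh (a * T))
      ≤ C * (c * y) * M * ((c + 1 + 2 * c) * y * (ε + X)) := by
        have : 0 ≤ a / Real.cosh (a * T) := div_nonneg ha (Real.cosh_pos _).le
        gcongr
    _ = _ := by ring

/-- The functional `H_j` is the difference of the quotients for the two eigenfields. -/
lemma norm_H_sub_le {lam mu T : ℝ} {I : Data T} {f : Fin 3 → L2Omega} {j : Fin 3} {z b d R1 R2 : ℝ}
    (hσ : 0 < z ^ 2 - b ^ 2 - d ^ 2)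
    (q1 : phiInt (√(lam + 2 * mu) * abs0 (freq z b d)) I ≠ 0)
    (q2 : phiInt (√mu * abs0 (freq z b d)) I ≠ 0)
    (h1 : |dataInt (√(lam + 2 * mu) * abs0 (freq z b d)) (gradField z b d j) I /
      phiInt (√(lam + 2 * mu) * abs0 (freq z b d)) I + pairL (gradField z b d j) f| ≤ R1)
    (h2 : |dataInt (√mu * abs0 (freq z b d)) (solField z b d j) I /
      phiInt (√mu * abs0 (freq z b d)) I + pairL (solField z b d j) f| ≤ R2) :
    ‖H lam mu I j (freq z b d) - ((∫ x in Omega, coshCos z b d x * f j x : ℝ) : ℂ)‖ ≤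
      (R1 + R2) / (z ^ 2 - b ^ 2 - d ^ 2) := by
  have hsol' := pairL_solField_sub z b d j f
  have hssq : abs0 (freq z b d) ^ 2 = z ^ 2 - b ^ 2 - d ^ 2 := abs0_sq hσ.le
  have hDne : D (√(lam + 2 * mu)) I (freq z b d) * D (√mu) I (freq z b d) ≠ 0 := by
    rw [D_eq_phiInt, D_eq_phiInt, hssq]
    exact mul_ne_zero (mul_ne_zero (neg_ne_zero.2 hσ.ne') q1)
      (mul_ne_zero (neg_ne_zero.2 hσ.ne') q2)
  rw [H, if_pos hDne, E1_eq_dataInt, E2_eq_dataInt _ _ _ hσ.le, D_eq_phiInt, D_eq_phiInt, hssq]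
  generalize dataInt (√(lam + 2 * mu) * abs0 (freq z b d)) (gradField z b d j) I = A1 at *
  generalize dataInt (√mu * abs0 (freq z b d)) (solField z b d j) I = A2 at *
  generalize phiInt (√(lam + 2 * mu) * abs0 (freq z b d)) I = Q1 at *
  generalize phiInt (√mu * abs0 (freq z b d)) I = Q2 at *
  generalize pairL (gradField z b d j) f = P1 at *
  generalize pairL (solField z b d j) f = P2 at *
  generalize ∫ x in Omega, coshCos z b d x * f j x = R at *
  generalize z ^ 2 - b ^ 2 - d ^ 2 = σ at *
  rw [← Complex.ofReal_neg, ← Complex.ofReal_div, ← Complex.ofReal_div, ← Complex.ofReal_add,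
    ← Complex.ofReal_sub, Complex.norm_real, Real.norm_eq_abs]
  have hσne := hσ.ne'
  have e : -A1 / (-σ * Q1) + A2 / (-σ * Q2) - R = ((A1 / Q1 + P1) - (A2 / Q2 + P2)) / σ := by
    rw [eq_div_iff hσne]
    have e1 : -A1 / (-σ * Q1) * σ = A1 / Q1 := by field_simp
    have e2 : A2 / (-σ * Q2) * σ = -(A2 / Q2) := by field_simp
    linear_combination e1 + e2 + hsol'
  rw [e, abs_div, abs_of_pos hσ]
  exact div_le_div_of_nonneg_right ((abs_sub _ _).trans (add_le_add h1 h2)) hσ.le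

/-- The functional `H_j` of inexact data approximates the Fourier–Laplace transform of `f_j` at the
frequency `(-iz, b, d)`, if this lies in the region `|α|₀² ≥ z²/5`. -/
theorem IsSolution.exists_H_bound {lam mu T : ℝ} (hT : 0 < T) (hmu : 0 < mu) (hlam : 0 < lam + 2 * mu)
    {I₀ : Data T} (hW : W1 I₀) (hW2 : W2' lam mu T)
    {u : Fin 3 → ℝ → L2Omega} {f : Fin 3 → L2Omega} (hsol : IsSolution lam mu T I₀ u f) :
    ∃ C > 0, ∃ c > 0, ∃ z₀ > 0, ∀ (z b d ε : ℝ) (I : Data T) (j : Fin 3), z₀ ≤ |z| → |b| ≤ |z| →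
      |d| ≤ |z| → z ^ 2 / 5 ≤ z ^ 2 - b ^ 2 - d ^ 2 → Close I₀ I ε → ε * |z| ≤ c →
      ‖H lam mu I j (freq z b d) - ((∫ x in Omega, coshCos z b d x * f j x : ℝ) : ℂ)‖ ≤
        C * |z| ^ 2 * Real.exp |z| * (ε + Real.exp (-(12 * |z|))) := by
  obtain ⟨C, hC, c, hc, a₀, ha₀, hstab⟩ := hsol.exists_stability hT hW
  set c1 := √(lam + 2 * mu) with hc1
  set c2 := √mu with hc2
  have h1pos : 0 < c1 := Real.sqrt_pos.2 hlam
  have h2pos : 0 < c2 := Real.sqrt_pos.2 hmu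
  set cm := min c1 c2 with hcm
  have hcm0 : 0 < cm := lt_min h1pos h2pos
  set cM := max c1 c2 with hcM
  have hcM0 : 0 < cM := h1pos.trans_le (le_max_left _ _)
  have hW2' : ∀ e, (e = c1 ∨ e = c2) → 12 * √5 < e * T := by
    intro e he
    rw [W2'] at hW2
    have h5 : (0 : ℝ) < 12 * √5 := by positivity
    rcases he with rfl | rfl
    · have := (mul_le_mul_of_nonneg_left (le_max_right (1 / c2) (1 / c1)) h5.le).trans_lt hW2
      rw [mul_one_div, div_lt_iff₀ h1pos] at this
      linarith
    · have := (mul_le_mul_of_nonneg_left (le_max_left (1 / c2) (1 / c1)) h5.le).trans_lt hW2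
      rw [mul_one_div, div_lt_iff₀ h2pos] at this
      linarith
  refine ⟨40 * C * cM * (cM + 1 + 2 * cM), by positivity, c / cM, by positivity,
    √5 * (a₀ / cm) + 1, by positivity, fun z b d ε I j hz0 hb hd hσ hI hε => ?_⟩
  set σ := z ^ 2 - b ^ 2 - d ^ 2 with hσdef
  set s := abs0 (freq z b d) with hs
  have hz1 : 1 ≤ |z| := by
    have : 0 ≤ √5 * (a₀ / cm) := by positivity
    linarith
  have hzsq : 1 ≤ z ^ 2 := (one_le_sq_iff_one_le_abs z).2 hz1
  have hσ0 : 0 < σ := by linarith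
  have hssq : s ^ 2 = σ := abs0_sq hσ0.le
  have hs0 : 0 ≤ s := Real.sqrt_nonneg _
  have hspos : 0 < s := by
    rcases hs0.eq_or_lt with h | h
    · rw [← h] at hssq; norm_num at hssq; linarith
    · exact h
  have hsz : s ≤ |z| := by
    apply abs_le_of_sq_le_sq' _ (abs_nonneg _) |>.2
    rw [hssq, sq_abs]; linarith [sq_nonneg b, sq_nonneg d]
  have h5 : √5 * √5 = 5 := Real.mul_self_sqrt (by norm_num)
  have h50 : 0 < √5 := by positivity
  have hzs : |z| ≤ √5 * s := by
    apply abs_le_of_sq_le_sq' _ (by positivity) |>.2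
    rw [mul_pow, hssq, sq √5, h5, sq_abs]; linarith
  have hε0 : 0 ≤ ε := (norm_nonneg _).trans hI.1
  set M := 2 * z ^ 2 * Real.exp |z| with hM
  have hM0 : 0 ≤ M := by positivity
  -- the estimate for one wave speed
  have hone : ∀ e, (e = c1 ∨ e = c2) → ∀ V : Fin 3 → Pt → ℝ, IsEigenfield lam mu ((e * s) ^ 2) V →
      (∀ k, ∀ x ∈ Icc (0 : Pt) 1, |V k x| ≤ M) → phiInt (e * s) I ≠ 0 ∧
      |dataInt (e * s) V I / phiInt (e * s) I + pairL V f| ≤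
        C * cM * (cM + 1 + 2 * cM) * |z| ^ 2 * M * (ε + Real.exp (-(12 * |z|))) := by
    intro e he V hV hVM
    have hepos : 0 < e := by rcases he with rfl | rfl <;> assumption
    have hecm : cm ≤ e := by
      rcases he with rfl | rfl
      · exact min_le_left _ _
      · exact min_le_right _ _
    have hecM : e ≤ cM := by
      rcases he with rfl | rfl
      · exact le_max_left _ _
      · exact le_max_right _ _
    have ha : a₀ ≤ e * s := by
      have h1 : √5 * (a₀ / cm) ≤ √5 * s := by linarith
      have h2 := le_of_mul_le_mul_left h1 h50
      rw [div_le_iff₀ hcm0] at h2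
      exact (h2.trans (mul_le_mul_of_nonneg_left hecm hs0)).trans_eq (mul_comm _ _)
    have hes : e * s ≤ cM * |z| := mul_le_mul hecM hsz hs0 hcM0.le
    have hεa : ε * (e * s) ≤ c := by
      rw [le_div_iff₀ hcM0] at hε
      linarith [mul_le_mul_of_nonneg_left hes hε0]
    obtain ⟨hne, hb⟩ := hstab (e * s) ha V M ε I hV hM0 hVM hI hεa
    refine ⟨hne, hb.trans ?_⟩
    have h12 : 12 * |z| ≤ e * s * T := by
      have := (mul_lt_mul_of_pos_right (hW2' e he) hspos).le
      linarith
    exact scalar_bound hC.le hM0 hε0 hcM0.le (by positivity) hes hz1 h12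
  have heig := isEigenfield_gradient lam mu (contDiff_coshCos z b d) (sum_pd_pd_coshCos z b d) j
  have hk1 : (c1 * s) ^ 2 = (lam + 2 * mu) * σ := by
    rw [mul_pow, hssq, hc1, Real.sq_sqrt hlam.le]
  have hk2 : (c2 * s) ^ 2 = mu * σ := by rw [mul_pow, hssq, hc2, Real.sq_sqrt hmu.le]
  obtain ⟨q1, hb1⟩ := hone c1 (Or.inl rfl) (gradField z b d j) (hk1 ▸ heig.1)
    fun k x hx => (abs_fields_le hb hd hσ0.le j k hx).1
  obtain ⟨q2, hb2⟩ := hone c2 (Or.inr rfl) (solField z b d j) (hk2 ▸ heig.2)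
    fun k x hx => (abs_fields_le hb hd hσ0.le j k hx).2
  have hHle := norm_H_sub_le (f := f) hσ0 q1 q2 hb1 hb2
  refine hHle.trans ?_
  rw [div_le_iff₀ hσ0]
  have hR : 0 ≤ C * cM * (cM + 1 + 2 * cM) * |z| ^ 2 * Real.exp |z| *
    (ε + Real.exp (-(12 * |z|))) := by positivity
  have h10 : 4 * z ^ 2 ≤ 40 * σ := by linarith
  have h11 := mul_le_mul_of_nonneg_left h10 hR
  rw [hM]
  linarith

/-! ### Products over the interpolation points -/

lemma prod_Icc_eq_prod_range {M : Type*} [CommMonoid M] (f : ℕ → M) (n : ℕ) :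
    ∏ l ∈ Finset.Icc 1 n, f l = ∏ l ∈ Finset.range n, f (l + 1) := by
  induction n with
  | zero => simp
  | succ n ih => rw [Finset.prod_Icc_succ_top (by omega), ih, Finset.prod_range_succ]

lemma prod_add_div_eq_choose (k n : ℕ) :
    ∏ l ∈ Finset.Icc 1 n, (((l : ℝ) + k) / l) = ((n + k).choose k : ℝ) := by
  induction n with
  | zero => simp
  | succ n ih =>
    rw [Finset.prod_Icc_succ_top (by omega), ih]
    have h := Nat.choose_mul_succ_eq (n + k) k
    rw [show n + k + 1 - k = n + 1 by omega, show n + k + 1 = n + 1 + k by ring] at h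
    have h' : ((n + k).choose k : ℝ) * ((n : ℝ) + 1 + k) = ((n + 1 + k).choose k : ℝ) * (n + 1) := by
      exact_mod_cast h
    push_cast
    field_simp
    linarith

lemma prod_abs_sub_erase {k n : ℕ} (hk : 1 ≤ k) (hkn : k ≤ n) :
    ∏ l ∈ (Finset.Icc 1 n).erase k, |(k : ℝ) - l| =
      ((k - 1).factorial : ℝ) * ((n - k).factorial : ℝ) := by
  induction n, hkn using Nat.le_induction with
  | base =>
    have e : (Finset.Icc 1 k).erase k = Finset.Ico 1 k := by
      ext l; simp
    rw [e, Nat.sub_self, Nat.factorial_zero, Nat.cast_one, mul_one]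
    have h1 : ∏ l ∈ Finset.Ico 1 k, |(k : ℝ) - l| = ∏ l ∈ Finset.Ico 1 k, ((k - l : ℕ) : ℝ) := by
      refine Finset.prod_congr rfl fun l hl => ?_
      have := (Finset.mem_Ico.1 hl).2
      rw [Nat.cast_sub this.le, abs_of_nonneg]
      have : (l : ℝ) ≤ k := by exact_mod_cast this.le
      linarith
    rw [h1, Finset.prod_Ico_reflect (fun l => (l : ℝ)) 1 (by omega)]
    have h2 := Finset.prod_Ico_id_eq_factorial (k - 1)
    rw [show k + 1 - k = 1 by omega, show k + 1 - 1 = k - 1 + 1 by omega, ← h2, Nat.cast_prod]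
  | succ n hkn ih =>
    have e : (Finset.Icc 1 (n + 1)).erase k = insert (n + 1) ((Finset.Icc 1 n).erase k) := by
      ext l; simp; omega
    rw [e, Finset.prod_insert (by simp), ih, show n + 1 - k = (n - k) + 1 by omega,
      Nat.factorial_succ]
    have : |(k : ℝ) - (n + 1 : ℕ)| = ((n - k + 1 : ℕ) : ℝ) := by
      rw [abs_sub_comm, abs_of_nonneg]
      · push_cast [Nat.cast_sub hkn]; ring
      · have : (k : ℝ) ≤ n := by exact_mod_cast hkn
        push_cast; linarith
    rw [this]
    push_cast
    ring

/-- The product of the distances of an integer of `[1, n]` to the others is at least `n! / (n 2^n)`,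
as its quotient with `(n - 1)!` is the inverse of a binomial coefficient. -/
lemma factorial_le_prod_abs_sub_erase {k n : ℕ} (hk : 1 ≤ k) (hkn : k ≤ n) :
    (n.factorial : ℝ) ≤ n * 2 ^ n * ∏ l ∈ (Finset.Icc 1 n).erase k, |(k : ℝ) - l| := by
  rw [prod_abs_sub_erase hk hkn]
  have h := Nat.choose_mul_factorial_mul_factorial (n := n - 1) (k := k - 1) (by omega)
  rw [show n - 1 - (k - 1) = n - k by omega] at h
  have h2 : (n - 1).choose (k - 1) ≤ 2 ^ n :=
    (Nat.choose_le_two_pow _ _).trans (Nat.pow_le_pow_right (by norm_num) (by omega))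
  have h3 : n.factorial = n * (n - 1).factorial := (Nat.mul_factorial_pred (by omega)).symm
  rw [h3, ← h]
  push_cast
  have h2' : ((n - 1).choose (k - 1) : ℝ) ≤ 2 ^ n := by exact_mod_cast h2
  rw [mul_assoc ((n - 1).choose (k - 1) : ℝ), mul_assoc (n : ℝ) (2 ^ n)]
  gcongr

/-- `∏ (z_l² + y²)` over the points `z_l = 5r + l` is at most `e^{29 r}` times the relevant products
of differences of the points. -/
lemma prod_ratio_le {r : ℕ} (hr : 1 ≤ r) {y : ℝ} (hy : y ^ 2 ≤ 10 * r ^ 2) :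
    2 ^ (24 * r) * ∏ l ∈ Finset.Icc 1 (24 * r), (((5 * r + l : ℝ) ^ 2 + y ^ 2) / (l * (10 * r + l))) ≤
      Real.exp (29 * r) := by
  have hr0 : (0 : ℝ) < r := by exact_mod_cast hr
  -- each factor is at most `(l + 4 r) / l`, and these multiply to a binomial coefficient
  have h1 : ∏ l ∈ Finset.Icc 1 (24 * r), (((5 * r + l : ℝ) ^ 2 + y ^ 2) / (l * (10 * r + l))) ≤
      ∏ l ∈ Finset.Icc 1 (24 * r), (((l : ℝ) + (4 * r : ℕ)) / l) := by
    refine Finset.prod_le_prod (fun l _ => by positivity) fun l hl => ?_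
    have hl0 : (0 : ℝ) < l := by exact_mod_cast (Finset.mem_Icc.1 hl).1
    rw [div_le_div_iff₀ (by positivity) hl0]
    push_cast
    have : (0 : ℝ) ≤ l * (5 * r * r + 4 * r * l) := by positivity
    nlinarith [mul_le_mul_of_nonneg_left hy hl0.le]
  rw [prod_add_div_eq_choose] at h1
  have h2 : (((24 * r + 4 * r).choose (4 * r) : ℕ) : ℝ) ≤ 7 ^ (4 * r) * Real.exp (4 * r) := by
    refine (Nat.choose_le_pow_div (α := ℝ) _ _).trans ?_
    have h3 := Real.pow_div_factorial_le_exp (4 * r : ℝ) (by positivity) (4 * r)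
    push_cast
    rw [show (24 * (r : ℝ) + 4 * r) = 7 * (4 * r) by ring, mul_pow, mul_div_assoc]
    gcongr
  calc _ ≤ 2 ^ (24 * r) * (7 ^ (4 * r) * Real.exp (4 * r)) := by
        exact mul_le_mul_of_nonneg_left (h1.trans h2) (by positivity)
    _ = (2 ^ 24 * 7 ^ 4) ^ r * Real.exp (4 * r) := by rw [mul_pow, ← pow_mul, ← pow_mul]; ring
    _ ≤ (Real.exp 25) ^ r * Real.exp (4 * r) := by
        gcongr
        have := Real.exp_one_gt_d9
        rw [show (25 : ℝ) = ((25 : ℕ) : ℝ) * 1 by norm_num, Real.exp_nat_mul]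
        calc (2 : ℝ) ^ 24 * 7 ^ 4 ≤ 2.7182818283 ^ 25 := by norm_num
          _ ≤ _ := by gcongr
    _ = _ := by
        rw [← Real.exp_nat_mul, ← Real.exp_add]; congr 1; ring

/-- The function `(x² + 9.87) / (55² - x²)`. At `x = z/r` it bounds the ratio of `|z² - w²|` for
`w = i y`, `y² ≤ 9.87 r²`, and for `|w| = 55 r`; the constant `9.87` is just above `π²`. -/
def nodeRatio (x : ℝ) : ℝ := (x ^ 2 + 9.87) / (3025 - x ^ 2)

lemma nodeRatio_pos {x : ℝ} (hx : x ^ 2 < 3025) : 0 < nodeRatio x := by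
  unfold nodeRatio
  exact div_pos (by positivity) (by linarith)

/-- The convexity of `nodeRatio` on `[0, 55)`. -/
lemma nodeRatio_chord {p q θ : ℝ} (hp : 0 ≤ p) (hpq : p ≤ q) (hq : q < 55) (h0 : 0 ≤ θ) (h1 : θ ≤ 1) :
    nodeRatio ((1 - θ) * p + θ * q) ≤ (1 - θ) * nodeRatio p + θ * nodeRatio q := by
  have hq2 : q ^ 2 < 3025 := by nlinarith
  have hp2 : p ^ 2 < 3025 := by nlinarith
  have e : ∀ x : ℝ, x ^ 2 < 3025 → nodeRatio x = 3034.87 * (3025 - x ^ 2)⁻¹ - 1 := fun x hx => by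
    have : (3025 - x ^ 2) ≠ 0 := by linarith
    rw [nodeRatio]; field_simp; ring
  have hsq : ((1 - θ) * p + θ * q) ^ 2 ≤ (1 - θ) * p ^ 2 + θ * q ^ 2 := by
    nlinarith [mul_nonneg (mul_nonneg h0 (sub_nonneg.2 h1)) (sq_nonneg (p - q))]
  have hP : 0 < 3025 - p ^ 2 := by linarith
  have hQ : 0 < 3025 - q ^ 2 := by linarith
  have hconv : (1 - θ) * p ^ 2 + θ * q ^ 2 < 3025 := by
    nlinarith [mul_nonneg (sub_nonneg.2 h1) (sub_nonneg.2 (pow_le_pow_left₀ hp hpq 2))]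
  rw [e _ (hsq.trans_lt hconv), e _ hp2, e _ hq2]
  have hinv : (3025 - ((1 - θ) * p + θ * q) ^ 2)⁻¹ ≤
      (1 - θ) * (3025 - p ^ 2)⁻¹ + θ * (3025 - q ^ 2)⁻¹ := by
    have s1 : (3025 - ((1 - θ) * p + θ * q) ^ 2)⁻¹ ≤
        ((1 - θ) * (3025 - p ^ 2) + θ * (3025 - q ^ 2))⁻¹ := by
      apply inv_anti₀ <;> nlinarith
    refine s1.trans ?_
    have hc := (convexOn_zpow (-1)).2 (x := 3025 - p ^ 2) hP (y := 3025 - q ^ 2) hQ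
      (sub_nonneg.2 h1) h0 (by ring)
    simpa using hc
  linarith

/-- The product over the `r` points between `(5 + b) r` and `(6 + b) r`: by convexity their values
lie below a chord, and the product is at most the `r`-th power of the mean of its end values, up to
the factor `e` that accounts for the use of right end points in the Riemann sum. -/
lemma prod_block_le {r b : ℕ} (hr : 1 ≤ r) (hb : b < 24) :
    ∏ i ∈ Finset.range r, nodeRatio (5 + b + (i + 1) / r) ≤
      ((nodeRatio (5 + b) + nodeRatio (6 + b)) / 2) ^ r * Real.exp 1 := by
  have hr0 : (0 : ℝ) < r := by exact_mod_cast hr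
  have hb' : (b : ℝ) ≤ 23 := by exact_mod_cast Nat.le_of_lt_succ hb
  have hb0 : (0 : ℝ) ≤ b := by positivity
  set P := nodeRatio (5 + b) with hP
  set Q := nodeRatio (6 + b) with hQ
  have hP0 : 0 < P := nodeRatio_pos (by nlinarith)
  have hQ0 : 0 < Q := nodeRatio_pos (by nlinarith)
  set A := (P + Q) / 2 with hA
  have hA0 : 0 < A := by positivity
  have hterm : ∀ i ∈ Finset.range r, nodeRatio (5 + b + (i + 1) / r) ≤
      A * Real.exp ((P + (Q - P) * ((i + 1) / r)) / A - 1) := by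
    intro i hi
    have hi' : ((i : ℝ) + 1) / r ≤ 1 := by
      rw [div_le_one hr0]; exact_mod_cast Finset.mem_range.1 hi
    have h1 := nodeRatio_chord (p := 5 + b) (q := 6 + b) (θ := ((i : ℝ) + 1) / r) (by positivity)
      (by linarith) (by linarith) (by positivity) hi'
    have h2 := Real.add_one_le_exp ((P + (Q - P) * (((i : ℝ) + 1) / r)) / A - 1)
    rw [sub_add_cancel, div_le_iff₀ hA0] at h2
    rw [show (1 - ((i : ℝ) + 1) / r) * (5 + b) + ((i : ℝ) + 1) / r * (6 + b) =
      5 + b + ((i : ℝ) + 1) / r by ring] at h1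
    linarith
  refine (Finset.prod_le_prod (fun i hi => ?_) hterm).trans ?_
  · have hi' : ((i : ℝ) + 1) / r ≤ 1 := by
      rw [div_le_one hr0]; exact_mod_cast Finset.mem_range.1 hi
    have : (0 : ℝ) ≤ ((i : ℝ) + 1) / r := by positivity
    exact (nodeRatio_pos (by nlinarith)).le
  · rw [Finset.prod_mul_distrib, Finset.prod_const, Finset.card_range, ← Real.exp_sum]
    refine mul_le_mul_of_nonneg_left (Real.exp_le_exp.2 ?_) (by positivity)
    have hsum : ∑ i ∈ Finset.range r, ((i : ℝ) + 1) = r * (r + 1) / 2 := by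
      clear * -
      induction r with
      | zero => simp
      | succ r ih => rw [Finset.sum_range_succ, ih]; push_cast; ring
    have e : ∑ i ∈ Finset.range r, ((P + (Q - P) * (((i : ℝ) + 1) / r)) / A - 1) =
        (Q - P) / (2 * A) := by
      rw [Finset.sum_sub_distrib, ← Finset.sum_div, Finset.sum_add_distrib, ← Finset.mul_sum,
        ← Finset.sum_div, hsum]
      simp only [Finset.sum_const, Finset.card_range, nsmul_eq_mul]
      field_simp
      rw [hA]; ring
    rw [e, div_le_one (by positivity), hA]
    linarith

/-- The quantity that governs the interpolation error on the circle of radius `55 r`: the growth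
`e^{55 r}` of the kernel is outweighed by the product over the `24` blocks of points. -/
lemma prod_nodeRatio_le {r : ℕ} (hr : 1 ≤ r) :
    Real.exp (55 * r) * ∏ l ∈ Finset.Icc 1 (24 * r), nodeRatio ((5 * r + l) / r) ≤
      Real.exp 24 * Real.exp (-r) := by
  have hr0 : (0 : ℝ) < r := by exact_mod_cast hr
  have hblocks : ∀ k ≤ 24, ∏ l ∈ Finset.range (k * r), nodeRatio ((5 * r + (l + 1 : ℕ)) / r) ≤
      (∏ b ∈ Finset.range k, (nodeRatio (5 + b) + nodeRatio (6 + b)) / 2) ^ r * Real.exp 1 ^ k := by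
    intro k hk
    induction k with
    | zero => simp
    | succ k ih =>
      rw [Nat.succ_mul, Finset.prod_range_add, Finset.prod_range_succ, mul_pow, pow_succ]
      have hbl := prod_block_le (b := k) hr (by omega)
      have e : ∏ i ∈ Finset.range r, nodeRatio ((5 * r + (k * r + i + 1 : ℕ)) / r) =
          ∏ i ∈ Finset.range r, nodeRatio (5 + k + (i + 1) / r) := by
        refine Finset.prod_congr rfl fun i _ => ?_
        congr 1
        push_cast
        field_simp
        ring
      rw [e, show ∀ a b c d : ℝ, a * b * (c * d) = (a * c) * (b * d) by intros; ring]
      refine mul_le_mul (ih (by omega)) hbl (Finset.prod_nonneg fun i hi => ?_) ?_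
      · have hi' : ((i : ℝ) + 1) / r ≤ 1 := by
          rw [div_le_one hr0]; exact_mod_cast Finset.mem_range.1 hi
        have : (0 : ℝ) ≤ ((i : ℝ) + 1) / r := by positivity
        have hk' : (k : ℝ) ≤ 23 := by exact_mod_cast (by omega : k ≤ 23)
        have hk0 : (0 : ℝ) ≤ k := by positivity
        exact (nodeRatio_pos (by nlinarith)).le
      · refine mul_nonneg (pow_nonneg (Finset.prod_nonneg fun b hb => ?_) _) (by positivity)
        have hb' : (b : ℝ) ≤ 22 := by
          have := Finset.mem_range.1 hb
          exact_mod_cast (by omega : b ≤ 22)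
        have hb0 : (0 : ℝ) ≤ b := by positivity
        have := (nodeRatio_pos (x := 5 + b) (by nlinarith)).le
        have := (nodeRatio_pos (x := 6 + b) (by nlinarith)).le
        positivity
  have h24 := hblocks 24 le_rfl
  rw [prod_Icc_eq_prod_range]
  -- a numerical inequality between rational numbers, with `2.7182818286 > e`
  have hnum : (∏ b ∈ Finset.range 24, (nodeRatio (5 + b) + nodeRatio (6 + b)) / 2) ≤
      Real.exp (-56) := by
    have he : Real.exp (-56) = (Real.exp 1 ^ 56)⁻¹ := by
      rw [← Real.exp_nat_mul, ← Real.exp_neg]; norm_num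
    have hlt := Real.exp_one_lt_d9
    have : ((2.7182818286 : ℝ) ^ 56)⁻¹ ≤ (Real.exp 1 ^ 56)⁻¹ := by
      apply inv_anti₀ (by positivity)
      gcongr
    rw [he]
    refine le_trans ?_ this
    simp only [Finset.prod_range_succ, Finset.prod_range_zero, nodeRatio]
    norm_num
  have hpos : 0 ≤ ∏ b ∈ Finset.range 24, (nodeRatio (5 + b) + nodeRatio (6 + b)) / 2 := by
    refine Finset.prod_nonneg fun b hb => ?_
    have hb' : (b : ℝ) ≤ 23 := by
      have := Finset.mem_range.1 hb
      exact_mod_cast (by omega : b ≤ 23)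
    have hb0 : (0 : ℝ) ≤ b := by positivity
    have := (nodeRatio_pos (x := 5 + b) (by nlinarith)).le
    have := (nodeRatio_pos (x := 6 + b) (by nlinarith)).le
    positivity
  calc _ ≤ Real.exp (55 * r) * (Real.exp (-56) ^ r * Real.exp 1 ^ 24) := by
        refine mul_le_mul_of_nonneg_left (h24.trans ?_) (Real.exp_pos _).le
        gcongr
    _ = _ := by
        rw [← Real.exp_nat_mul, ← Real.exp_nat_mul, ← Real.exp_add, ← Real.exp_add, ← Real.exp_add]
        congr 1; push_cast; ring

/-! ### Lagrange interpolation at the points `B r` -/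

/-- The points `e (5 r + l)`, `l = 1, …, 24 r`, where `e = ± 1`. -/
def halfNodes (r : ℕ) (e : ℂ) : Finset ℂ :=
  (Finset.Icc 1 (24 * r)).image (fun l : ℕ => e * (5 * r + l : ℂ))

lemma B_eq_union (r : ℕ) {e : ℂ} (he : e = 1 ∨ e = -1) : B r = halfNodes r e ∪ halfNodes r (-e) := by
  rcases he with rfl | rfl
  · simp [B, halfNodes]
  · rw [Finset.union_comm]; simp [B, halfNodes]

lemma halfNodes_injective (r : ℕ) {e : ℂ} (he : e = 1 ∨ e = -1) :
    Function.Injective (fun l : ℕ => e * (5 * r + l : ℂ)) := by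
  have he0 : e ≠ 0 := by rcases he with rfl | rfl <;> norm_num
  intro l l' h
  have := add_left_cancel (mul_left_cancel₀ he0 h)
  exact_mod_cast this

lemma add_ne_zero_of_pos {r : ℕ} {l l' : ℕ} (hl : 1 ≤ l) :
    (5 * r + l : ℂ) + (5 * r + l' : ℂ) ≠ 0 := by
  have : ((5 * r + l + (5 * r + l') : ℕ) : ℂ) ≠ 0 := by
    rw [Nat.cast_ne_zero]; omega
  push_cast at this
  exact this

lemma halfNodes_disjoint (r : ℕ) {e : ℂ} (he : e = 1 ∨ e = -1) :
    Disjoint (halfNodes r e) (halfNodes r (-e)) := by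
  have he0 : e ≠ 0 := by rcases he with rfl | rfl <;> norm_num
  rw [Finset.disjoint_left]
  intro b hb hb'
  obtain ⟨l, hl, rfl⟩ := Finset.mem_image.1 hb
  obtain ⟨l', hl', h⟩ := Finset.mem_image.1 hb'
  refine add_ne_zero_of_pos (r := r) (l' := l') (Finset.mem_Icc.1 hl).1 ?_
  have : e * ((5 * r + l : ℂ) + (5 * r + l' : ℂ)) = 0 := by linear_combination -h
  exact (mul_eq_zero.1 this).resolve_left he0

lemma prod_B_sub (r : ℕ) (w : ℂ) :
    ∏ b ∈ B r, (w - b) = ∏ l ∈ Finset.Icc 1 (24 * r), (w ^ 2 - (5 * r + l : ℂ) ^ 2) := by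
  rw [B_eq_union r (Or.inl rfl), Finset.prod_union (halfNodes_disjoint r (Or.inl rfl)), halfNodes,
    halfNodes, Finset.prod_image (fun _ _ _ _ h => halfNodes_injective r (Or.inl rfl) h),
    Finset.prod_image (fun _ _ _ _ h => halfNodes_injective r (Or.inr rfl) h),
    ← Finset.prod_mul_distrib]
  exact Finset.prod_congr rfl fun l _ => by ring

lemma mem_B {r : ℕ} {b : ℂ} (hb : b ∈ B r) :
    ∃ x : ℝ, b = x ∧ 5 * (r : ℝ) + 1 ≤ |x| ∧ |x| ≤ 29 * r ∧
      ∃ k ∈ Finset.Icc 1 (24 * r), ∃ e : ℂ, (e = 1 ∨ e = -1) ∧ b = e * (5 * r + k : ℂ) := by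
  have key : ∀ l ∈ Finset.Icc 1 (24 * r), 5 * (r : ℝ) + 1 ≤ |(5 * r + l : ℝ)| ∧
      |(5 * r + l : ℝ)| ≤ 29 * r := by
    intro l hl
    have h1 : (1 : ℝ) ≤ l := by exact_mod_cast (Finset.mem_Icc.1 hl).1
    have h2 : (l : ℝ) ≤ 24 * r := by exact_mod_cast (Finset.mem_Icc.1 hl).2
    rw [abs_of_nonneg (by positivity)]
    constructor <;> linarith
  rcases Finset.mem_union.1 hb with h | h
  · obtain ⟨l, hl, rfl⟩ := Finset.mem_image.1 h
    exact ⟨5 * r + l, by push_cast; ring, (key l hl).1, (key l hl).2, l, hl, 1, Or.inl rfl, by ring⟩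
  · obtain ⟨l, hl, rfl⟩ := Finset.mem_image.1 h
    refine ⟨-(5 * r + l), by push_cast; ring, ?_, ?_, l, hl, -1, Or.inr rfl, by ring⟩
    · rw [abs_neg]; exact (key l hl).1
    · rw [abs_neg]; exact (key l hl).2

lemma card_B_le (r : ℕ) : ((B r).card : ℝ) ≤ 48 * r := by
  have : (B r).card ≤ 48 * r := by
    refine (Finset.card_union_le _ _).trans ?_
    have h1 := Finset.card_image_le (s := Finset.Icc 1 (24 * r)) (f := fun j : ℕ => (5 * r + j : ℂ))
    have h2 := Finset.card_image_le (s := Finset.Icc 1 (24 * r)) (f := fun j : ℕ => -(5 * r + j : ℂ))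
    simp only [Nat.card_Icc] at h1 h2
    omega
  exact_mod_cast this

/-- The Lagrange basis polynomial for the point `b`, evaluated at `w`. -/
def lagBasis (r : ℕ) (b w : ℂ) : ℂ :=
  (∏ b' ∈ B r, (w - b')) * (Lagrange.nodalWeight (B r) id b * (w - b)⁻¹)

lemma eval_lagrange (r : ℕ) (F : ℂ → ℂ) {w : ℂ} (hw : ∀ b ∈ B r, w ≠ b) :
    (lagrange (B r) F).eval w = ∑ b ∈ B r, lagBasis r b w * F b := by
  rw [lagrange, Lagrange.eval_interpolate_not_at_node (s := B r) (v := id) F hw,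
    Lagrange.eval_nodal, Finset.mul_sum]
  exact Finset.sum_congr rfl fun b _ => by simp only [id, lagBasis]; ring

lemma sum_nodalWeight_mul_inv {r : ℕ} (hr : 1 ≤ r) {w : ℂ} (hw : ∀ b ∈ B r, w ≠ b) :
    (∏ b' ∈ B r, (w - b')) * ∑ b ∈ B r, Lagrange.nodalWeight (B r) id b * (w - b)⁻¹ = 1 := by
  have hne : (B r).Nonempty := ⟨5 * r + 1, Finset.mem_union_left _
    (Finset.mem_image.2 ⟨1, Finset.mem_Icc.2 ⟨le_rfl, by omega⟩, by simp⟩)⟩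
  have h := Lagrange.eval_interpolate_not_at_node (s := B r) (v := id) 1 hw
  rw [Lagrange.interpolate_one Function.injective_id.injOn hne, Lagrange.eval_nodal] at h
  simpa using h.symm

/-- The interpolation error of the Cauchy kernel. -/
lemma inv_sub_sum_lagBasis {r : ℕ} (hr : 1 ≤ r) {w ζ : ℂ} (hw : ∀ b ∈ B r, w ≠ b)
    (hζ : ∀ b ∈ B r, ζ ≠ b) (hne : ζ ≠ w) :
    (ζ - w)⁻¹ - ∑ b ∈ B r, lagBasis r b w * (ζ - b)⁻¹ =
      (∏ b' ∈ B r, (w - b')) / ((∏ b' ∈ B r, (ζ - b')) * (ζ - w)) := by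
  have h1 := sum_nodalWeight_mul_inv hr hw
  have h2 := sum_nodalWeight_mul_inv hr hζ
  have hz : ζ - w ≠ 0 := sub_ne_zero.2 hne
  have hP : (∏ b' ∈ B r, (ζ - b')) ≠ 0 := left_ne_zero_of_mul_eq_one h2
  have e : ∑ b ∈ B r, lagBasis r b w * (ζ - b)⁻¹ = (∏ b' ∈ B r, (w - b')) *
      ((∑ b ∈ B r, Lagrange.nodalWeight (B r) id b * (w - b)⁻¹ -
        ∑ b ∈ B r, Lagrange.nodalWeight (B r) id b * (ζ - b)⁻¹) * (ζ - w)⁻¹) := by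
    rw [← Finset.sum_sub_distrib, Finset.sum_mul, Finset.mul_sum]
    refine Finset.sum_congr rfl fun b hb => ?_
    have hb1 : w - b ≠ 0 := sub_ne_zero.2 (hw b hb)
    have hb2 : ζ - b ≠ 0 := sub_ne_zero.2 (hζ b hb)
    rw [lagBasis]
    field_simp
    ring
  rw [e]
  have h3 : ∑ b ∈ B r, Lagrange.nodalWeight (B r) id b * (ζ - b)⁻¹ = (∏ b' ∈ B r, (ζ - b'))⁻¹ :=
    eq_inv_of_mul_eq_one_right h2
  rw [h3, ← mul_assoc, mul_sub, h1]
  field_simp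
  ring

lemma ne_of_mem_B {r : ℕ} {y : ℝ} {b : ℂ} (hb : b ∈ B r) : Complex.I * y ≠ b := by
  obtain ⟨x, rfl, hx, -⟩ := mem_B hb
  intro h
  have := congrArg Complex.re h
  simp at this
  rw [← this] at hx
  simp at hx
  have : (0 : ℝ) ≤ r := by positivity
  linarith

lemma norm_prod_B_I {r : ℕ} (y : ℝ) : ‖∏ b ∈ B r, (Complex.I * y - b)‖ =
    ∏ l ∈ Finset.Icc 1 (24 * r), ((5 * r + l : ℝ) ^ 2 + y ^ 2) := by
  rw [prod_B_sub, norm_prod]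
  refine Finset.prod_congr rfl fun l _ => ?_
  have : (Complex.I * y) ^ 2 - (5 * r + l : ℂ) ^ 2 = ((-((5 * r + l : ℝ) ^ 2 + y ^ 2) : ℝ) : ℂ) := by
    push_cast
    rw [mul_pow, Complex.I_sq]; ring
  rw [this, Complex.norm_real, norm_neg, Real.norm_of_nonneg (by positivity)]

/-- The Lagrange basis polynomials are at most `24 r e^{29 r}` at the points `i y`, `y² ≤ 10 r²`. -/
lemma norm_lagBasis_le {r : ℕ} (hr : 1 ≤ r) {y : ℝ} (hy : y ^ 2 ≤ 10 * r ^ 2) {b : ℂ} (hb : b ∈ B r) :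
    ‖lagBasis r b (Complex.I * y)‖ ≤ 24 * r * Real.exp (29 * r) := by
  have hr0 : (0 : ℝ) < r := by exact_mod_cast hr
  obtain ⟨x, hbx, hx5, -, k, hk, e, he, hbe⟩ := mem_B hb
  have he1 : ‖e‖ = 1 := by rcases he with rfl | rfl <;> simp
  have he2 : ∀ z : ℂ, ‖e * z‖ = ‖z‖ := fun z => by rw [norm_mul, he1, one_mul]
  -- the product of the distances to the other points
  have hW : ‖Lagrange.nodalWeight (B r) id b‖ = ((∏ l ∈ (Finset.Icc 1 (24 * r)).erase k, |(k : ℝ) - l|) *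
      ∏ l ∈ Finset.Icc 1 (24 * r), (10 * r + k + l : ℝ))⁻¹ := by
    rw [Lagrange.nodalWeight_eq_eval_nodal_erase_inv, Lagrange.eval_nodal, norm_inv, norm_prod]
    congr 1
    simp only [id]
    have hbe' : b ∈ halfNodes r e := Finset.mem_image.2 ⟨k, hk, hbe.symm⟩
    have hbn : b ∉ halfNodes r (-e) := Finset.disjoint_left.1 (halfNodes_disjoint r he) hbe'
    have h1 : (halfNodes r e).erase b =
        ((Finset.Icc 1 (24 * r)).erase k).image (fun l : ℕ => e * (5 * r + l : ℂ)) := by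
      rw [halfNodes, Finset.image_erase (halfNodes_injective r he), hbe]
    have hne : -e = 1 ∨ -e = -1 := by rcases he with rfl | rfl <;> simp
    rw [B_eq_union r he, Finset.erase_union_distrib, Finset.erase_eq_of_notMem hbn,
      Finset.prod_union ((halfNodes_disjoint r he).mono_left (Finset.erase_subset _ _)), h1,
      Finset.prod_image (fun _ _ _ _ h => halfNodes_injective r he h), halfNodes,
      Finset.prod_image (fun _ _ _ _ h => halfNodes_injective r hne h)]
    congr 1
    · refine Finset.prod_congr rfl fun l _ => ?_
      rw [hbe, show e * (5 * r + k : ℂ) - e * (5 * r + l) = e * (((k : ℝ) - l : ℝ) : ℂ) by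
        push_cast; ring, he2, Complex.norm_real, Real.norm_eq_abs]
    · refine Finset.prod_congr rfl fun l _ => ?_
      rw [hbe, show e * (5 * r + k : ℂ) - -e * (5 * r + l) = e * ((10 * r + k + l : ℝ) : ℂ) by
        push_cast; ring, he2, Complex.norm_real, Real.norm_of_nonneg (by positivity)]
  have hwb : 1 ≤ ‖Complex.I * y - b‖ := by
    have := Complex.abs_re_le_norm (Complex.I * y - b)
    rw [hbx] at this ⊢
    simp at this
    linarith
  rw [lagBasis, norm_mul, norm_mul, norm_prod_B_I, hW, norm_inv]
  set Nn := ∏ l ∈ Finset.Icc 1 (24 * r), ((5 * r + l : ℝ) ^ 2 + y ^ 2) with hNn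
  set P1 := ∏ l ∈ (Finset.Icc 1 (24 * r)).erase k, |(k : ℝ) - l| with hP1
  set P2 := ∏ l ∈ Finset.Icc 1 (24 * r), (10 * r + k + l : ℝ) with hP2
  set P3 := ∏ l ∈ Finset.Icc 1 (24 * r), (10 * r + l : ℝ) with hP3
  set Fa : ℝ := ∏ l ∈ Finset.Icc 1 (24 * r), (l : ℝ) with hFa
  have hFaeq : Fa = ((24 * r).factorial : ℝ) := by
    rw [hFa, ← Nat.cast_prod, ← Finset.prod_Ico_id_eq_factorial]; rfl
  have hFa0 : 0 < Fa := by rw [hFaeq]; exact_mod_cast Nat.factorial_pos _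
  have hNn0 : 0 ≤ Nn := Finset.prod_nonneg fun l _ => by positivity
  have hP10 : 0 < P1 := Finset.prod_pos fun l hl => abs_pos.2 (by
    rw [sub_ne_zero]; exact_mod_cast (Finset.ne_of_mem_erase hl).symm)
  have hP30 : 0 < P3 := Finset.prod_pos fun l hl => by positivity
  have hP23 : P3 ≤ P2 := Finset.prod_le_prod (fun l _ => by positivity) fun l _ => by
    have : (0 : ℝ) ≤ k := by positivity
    linarith
  have hfac : Fa ≤ (24 * r : ℝ) * 2 ^ (24 * r) * P1 := by
    rw [hFaeq]
    have := factorial_le_prod_abs_sub_erase (Finset.mem_Icc.1 hk).1 (Finset.mem_Icc.1 hk).2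
    push_cast at this
    exact this
  have hmain := prod_ratio_le hr hy
  rw [Finset.prod_div_distrib, Finset.prod_mul_distrib, ← hNn, ← hFa, ← hP3] at hmain
  have hinv : ‖Complex.I * y - b‖⁻¹ ≤ 1 := inv_le_one_of_one_le₀ hwb
  have hP1inv : P1⁻¹ ≤ (24 * r : ℝ) * 2 ^ (24 * r) * Fa⁻¹ := by
    rw [← div_eq_mul_inv, le_div_iff₀ hFa0, inv_mul_le_iff₀ hP10]
    linarith
  calc Nn * ((P1 * P2)⁻¹ * ‖Complex.I * y - b‖⁻¹) ≤ Nn * ((P1⁻¹ * P3⁻¹) * 1) := by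
        rw [mul_inv]
        gcongr
    _ ≤ Nn * (((24 * r : ℝ) * 2 ^ (24 * r) * Fa⁻¹ * P3⁻¹) * 1) := by gcongr
    _ = 24 * r * (2 ^ (24 * r) * (Nn / (Fa * P3))) := by field_simp
    _ ≤ _ := by gcongr

/-- The interpolation error of `z ↦ cosh (z x)`, `0 ≤ x ≤ 1`, at the points `i y`, by Cauchy's
formula on the circle of radius `55 r`. -/
lemma norm_cosh_sub_sum_lagBasis_le {r : ℕ} (hr : 1 ≤ r) {y : ℝ} (hy : y ^ 2 ≤ 9.87 * r ^ 2) {x : ℝ}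
    (hx0 : 0 ≤ x) (hx1 : x ≤ 1) :
    ‖Complex.cosh (Complex.I * y * x) -
      ∑ b ∈ B r, lagBasis r b (Complex.I * y) * Complex.cosh (b * x)‖ ≤
        2 * Real.exp 24 * Real.exp (-r) := by
  have hr0 : (0 : ℝ) < r := by exact_mod_cast hr
  set w : ℂ := Complex.I * y with hw
  set R : ℝ := 55 * r with hR
  have hR0 : 0 < R := by positivity
  have hwn : ‖w‖ ≤ 4 * r := by
    rw [hw, norm_mul, Complex.norm_I, one_mul, Complex.norm_real, Real.norm_eq_abs]
    exact abs_le_of_sq_le_sq (by nlinarith) (by positivity)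
  have hdiff : Differentiable ℂ (fun ζ : ℂ => Complex.cosh (ζ * x)) :=
    Complex.differentiable_cosh.comp (differentiable_id.mul_const _)
  have hcauchy : ∀ v : ℂ, ‖v‖ < R →
      (∮ ζ in C(0, R), (ζ - v)⁻¹ • Complex.cosh (ζ * x)) =
        (2 * Real.pi * Complex.I : ℂ) • Complex.cosh (v * x) := fun v hv =>
    hdiff.differentiableOn.circleIntegral_sub_inv_smul (by simpa using hv)
  have hbR : ∀ b ∈ B r, ‖b‖ < R := fun b hb => by
    obtain ⟨t, rfl, -, ht, -⟩ := mem_B hb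
    rw [Complex.norm_real, Real.norm_eq_abs]
    exact ht.trans_lt (by rw [hR]; linarith)
  have hwR : ‖w‖ < R := hwn.trans_lt (by rw [hR]; linarith)
  have hci : ∀ v : ℂ, ‖v‖ < R → CircleIntegrable (fun ζ => (ζ - v)⁻¹ • Complex.cosh (ζ * x)) 0 R := by
    intro v hv
    refine ContinuousOn.circleIntegrable hR0.le (ContinuousOn.smul (ContinuousOn.inv₀
      (continuous_id.sub continuous_const).continuousOn fun ζ hζ => ?_) hdiff.continuous.continuousOn)
    change ζ - v ≠ 0
    rw [sub_ne_zero]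
    rintro rfl
    rw [mem_sphere_zero_iff_norm] at hζ
    linarith
  have hwB : ∀ b ∈ B r, w ≠ b := fun b hb => ne_of_mem_B hb
  have hci' : ∀ b ∈ B r, CircleIntegrable
      (fun ζ => lagBasis r b w • ((ζ - b)⁻¹ • Complex.cosh (ζ * x))) 0 R := fun b hb =>
    (hci b (hbR b hb)).const_smul
  -- the interpolation error is the Cauchy integral of that of the Cauchy kernel
  have hint : (2 * Real.pi * Complex.I : ℂ) • (Complex.cosh (w * x) -
      ∑ b ∈ B r, lagBasis r b w * Complex.cosh (b * x)) =
      ∮ ζ in C(0, R), ((∏ b' ∈ B r, (w - b')) / ((∏ b' ∈ B r, (ζ - b')) * (ζ - w))) *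
        Complex.cosh (ζ * x) := by
    have h1 : (∮ ζ in C(0, R), ∑ b ∈ B r, lagBasis r b w • ((ζ - b)⁻¹ • Complex.cosh (ζ * x))) =
        ∑ b ∈ B r, lagBasis r b w • ((2 * Real.pi * Complex.I : ℂ) • Complex.cosh (b * x)) := by
      rw [circleIntegral.integral_fun_sum hci']
      refine Finset.sum_congr rfl fun b hb => ?_
      rw [circleIntegral.integral_smul, hcauchy b (hbR b hb)]
    have h2 : (2 * Real.pi * Complex.I : ℂ) • (Complex.cosh (w * x) -
        ∑ b ∈ B r, lagBasis r b w * Complex.cosh (b * x)) =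
        (∮ ζ in C(0, R), (ζ - w)⁻¹ • Complex.cosh (ζ * x)) -
        ∮ ζ in C(0, R), ∑ b ∈ B r, lagBasis r b w • ((ζ - b)⁻¹ • Complex.cosh (ζ * x)) := by
      rw [h1, hcauchy w hwR, smul_sub, Finset.smul_sum]
      congr 1
      exact Finset.sum_congr rfl fun b _ => by simp only [smul_eq_mul]; ring
    rw [h2, ← circleIntegral.integral_sub (hci w hwR)
      (CircleIntegrable.fun_sum _ hci')]
    refine circleIntegral.integral_congr hR0.le fun ζ hζ => ?_
    have hζn : ‖ζ‖ = R := by simpa using hζ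
    have hne : ∀ v : ℂ, ‖v‖ < R → ζ ≠ v := by rintro v hv rfl; linarith
    simp only [smul_eq_mul]
    rw [← inv_sub_sum_lagBasis hr hwB (fun b hb => hne b (hbR b hb)) (hne w hwR), sub_mul,
      Finset.sum_mul]
    congr 1
    exact Finset.sum_congr rfl fun b _ => by ring
  set Pr := ∏ l ∈ Finset.Icc 1 (24 * r), nodeRatio ((5 * r + l) / r) with hPr
  have hlb : ∀ l ∈ Finset.Icc 1 (24 * r), (5 * r + l : ℝ) ^ 2 ≤ (29 * r) ^ 2 := fun l hl => by
    have : (l : ℝ) ≤ 24 * r := by exact_mod_cast (Finset.mem_Icc.1 hl).2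
    exact pow_le_pow_left₀ (by positivity) (by linarith) 2
  have hbound : ∀ ζ ∈ Metric.sphere (0 : ℂ) R,
      ‖((∏ b' ∈ B r, (w - b')) / ((∏ b' ∈ B r, (ζ - b')) * (ζ - w))) * Complex.cosh (ζ * x)‖ ≤
        Pr * Real.exp R / (51 * r) := by
    intro ζ hζ
    have hζn : ‖ζ‖ = R := by simpa using hζ
    have hcosh : ‖Complex.cosh (ζ * x)‖ ≤ Real.exp R := by
      have h1 : ‖ζ * x‖ ≤ R := by
        rw [norm_mul, Complex.norm_real, Real.norm_of_nonneg hx0, hζn]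
        exact mul_le_of_le_one_right hR0.le hx1
      rw [Complex.cosh, norm_div, Complex.norm_two, div_le_iff₀ two_pos]
      refine (norm_add_le _ _).trans ?_
      have h2 := Complex.norm_exp_le_exp_norm (ζ * x)
      have h3 := Complex.norm_exp_le_exp_norm (-(ζ * x))
      rw [norm_neg] at h3
      have h4 := Real.exp_le_exp.2 h1
      linarith
    have hsub : 51 * r ≤ ‖ζ - w‖ := by
      have := norm_sub_norm_le ζ w
      rw [hζn] at this
      linarith
    have hden : ∏ l ∈ Finset.Icc 1 (24 * r), (3025 * (r : ℝ) ^ 2 - (5 * r + l : ℝ) ^ 2) ≤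
        ‖∏ b' ∈ B r, (ζ - b')‖ := by
      rw [prod_B_sub, norm_prod]
      refine Finset.prod_le_prod (fun l hl => by nlinarith [hlb l hl]) fun l _ => ?_
      have h1 := norm_sub_norm_le (ζ ^ 2) ((5 * r + l : ℂ) ^ 2)
      rw [norm_pow, norm_pow, hζn, show (5 * r + l : ℂ) = ((5 * r + l : ℝ) : ℂ) by push_cast; ring,
        Complex.norm_real, Real.norm_of_nonneg (by positivity), hR] at h1
      push_cast at h1 ⊢
      linarith
    have hdenpos : 0 < ∏ l ∈ Finset.Icc 1 (24 * r), (3025 * (r : ℝ) ^ 2 - (5 * r + l : ℝ) ^ 2) :=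
      Finset.prod_pos fun l hl => by nlinarith [hlb l hl]
    have hnum : ‖∏ b' ∈ B r, (w - b')‖ ≤
        Pr * ∏ l ∈ Finset.Icc 1 (24 * r), (3025 * (r : ℝ) ^ 2 - (5 * r + l : ℝ) ^ 2) := by
      rw [hw, norm_prod_B_I, hPr, ← Finset.prod_mul_distrib]
      refine Finset.prod_le_prod (fun l _ => by positivity) fun l hl => ?_
      have h1 : 3025 * (r : ℝ) ^ 2 - (5 * r + l : ℝ) ^ 2 ≠ 0 := by
        have := hlb l hl
        have : 0 < (r : ℝ) ^ 2 := by positivity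
        nlinarith
      have e : nodeRatio ((5 * r + l) / r) * (3025 * (r : ℝ) ^ 2 - (5 * r + l : ℝ) ^ 2) =
          (5 * r + l : ℝ) ^ 2 + 9.87 * r ^ 2 := by
        have h2 : 3025 - ((5 * r + l : ℝ) / r) ^ 2 = (3025 * (r : ℝ) ^ 2 - (5 * r + l : ℝ) ^ 2) / r ^ 2 := by
          field_simp
        rw [nodeRatio, h2, div_div_eq_mul_div, div_mul_cancel₀ _ h1]
        field_simp
      rw [e]
      linarith
    rw [norm_mul, norm_div, norm_mul]
    have hPr0 : 0 ≤ Pr := nonneg_of_mul_nonneg_left ((norm_nonneg _).trans hnum) hdenpos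
    rw [mul_div_right_comm]
    refine mul_le_mul ?_ hcosh (norm_nonneg _) (by positivity)
    rw [div_le_div_iff₀ (mul_pos (hdenpos.trans_le hden) (lt_of_lt_of_le (by positivity) hsub))
      (by positivity)]
    calc _ ≤ Pr * ‖∏ b' ∈ B r, (ζ - b')‖ * (51 * r) := by
          have := hnum.trans (mul_le_mul_of_nonneg_left hden hPr0)
          gcongr
      _ ≤ _ := by
          rw [mul_assoc]
          gcongr
  have hfin := circleIntegral.norm_integral_le_of_norm_le_const hR0.le hbound
  rw [← hint, norm_smul] at hfin
  have h2pi : ‖(2 * Real.pi * Complex.I : ℂ)‖ = 2 * Real.pi := by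
    simp [abs_of_pos Real.pi_pos]
  rw [h2pi, mul_assoc (2 * Real.pi) R] at hfin
  have hfin' := le_of_mul_le_mul_left hfin Real.two_pi_pos
  refine hfin'.trans ?_
  have hlast := prod_nodeRatio_le hr
  rw [← hPr, ← hR] at hlast
  have e : R * (Pr * Real.exp R / (51 * r)) = 55 / 51 * (Real.exp R * Pr) := by
    rw [hR]; field_simp
  rw [e]
  have : 0 < Real.exp 24 * Real.exp (-r) := by positivity
  linarith

/-! ### The error of the Fourier coefficients -/

lemma lt_sixty_mul_rEps {ε : ℝ} : Real.log ε⁻¹ < 60 * rEps ε := by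
  have h1 : Real.log ε⁻¹ / 60 < ((⌊Real.log ε⁻¹ / 60⌋ + 1 : ℤ) : ℝ) := by
    push_cast
    exact Int.lt_floor_add_one _
  have h2 : ((⌊Real.log ε⁻¹ / 60⌋ + 1 : ℤ) : ℝ) ≤ rEps ε := by
    have : (⌊Real.log ε⁻¹ / 60⌋ + 1 : ℤ) ≤ (rEps ε : ℤ) := Int.self_le_toNat _
    exact_mod_cast this
  linarith

lemma sixty_mul_rEps_le {ε : ℝ} (h0 : 0 < ε) (h1 : ε < 1) : 60 * rEps ε ≤ Real.log ε⁻¹ + 60 := by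
  have hl : 0 ≤ Real.log ε⁻¹ := Real.log_nonneg (one_le_inv₀ h0 |>.2 h1.le)
  have h3 : (rEps ε : ℤ) = ⌊Real.log ε⁻¹ / 60⌋ + 1 :=
    Int.toNat_of_nonneg (add_nonneg (Int.floor_nonneg.2 (by positivity)) zero_le_one)
  have h4 : (rEps ε : ℝ) = ⌊Real.log ε⁻¹ / 60⌋ + 1 := by exact_mod_cast h3
  have := Int.floor_le (Real.log ε⁻¹ / 60)
  linarith

lemma one_le_rEps {ε : ℝ} (h0 : 0 < ε) (h1 : ε < 1) : 1 ≤ rEps ε := by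
  have h := lt_sixty_mul_rEps (ε := ε)
  have hl : 0 ≤ Real.log ε⁻¹ := Real.log_nonneg (one_le_inv₀ h0 |>.2 h1.le)
  have : (0 : ℝ) < rEps ε := by linarith
  exact_mod_cast this

lemma le_exp_rEps {ε : ℝ} (h0 : 0 < ε) (h1 : ε < 1) : ε ≤ Real.exp 60 * Real.exp (-(60 * rEps ε)) := by
  have h := sixty_mul_rEps_le h0 h1
  rw [Real.log_inv] at h
  calc ε = Real.exp (Real.log ε) := (Real.exp_log h0).symm
    _ ≤ Real.exp (60 + -(60 * rEps ε)) := Real.exp_le_exp.2 (by linarith)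
    _ = _ := Real.exp_add _ _

/-- The product of cosines `cos (k₀ π x₀) cos (k₁ π x₁) cos (k₂ π x₂)`. -/
def cosProd (k : Fin 3 → ℕ) (x : Pt) : ℝ := ∏ i, Real.cos (k i * Real.pi * x i)

lemma contDiff_cosProd (k : Fin 3 → ℕ) {n : WithTop ℕ∞} : ContDiff ℝ n (cosProd k) :=
  contDiff_prod fun i _ => Real.contDiff_cos.comp (contDiff_const.mul (contDiff_apply ℝ ℝ i))

/-- The (not normalized) cosine coefficient `∫_Ω v cos (k₀ π x₀) cos (k₁ π x₁) cos (k₂ π x₂) dx`. -/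
def cosCoeff (v : L2Omega) (k : Fin 3 → ℕ) : ℝ := ∫ x in Omega, cosProd k x * v x

lemma FEps_eq_sum {T : ℝ} (lam mu : ℝ) (I : Data T) (j : Fin 3) (ε : ℝ) (m n p : ℕ) :
    FEps lam mu I j ε m n p = ∑ b ∈ B (rEps ε),
      lagBasis (rEps ε) b (Complex.I * ((m * Real.pi : ℝ) : ℂ)) *
        H lam mu I j (freq b (n * Real.pi) (p * Real.pi)) := by
  have e : Complex.I * (m : ℂ) * (Real.pi : ℂ) = Complex.I * ((m * Real.pi : ℝ) : ℂ) := by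
    push_cast; ring
  rw [FEps, e, eval_lagrange _ _ fun b hb => ne_of_mem_B hb]
  refine Finset.sum_congr rfl fun b _ => ?_
  simp [freq]

lemma pi_sq_le : Real.pi ^ 2 ≤ 9.87 := by
  have h1 := Real.pi_lt_d4
  have h2 := Real.pi_pos
  nlinarith

lemma sq_mul_pi_le {m r : ℕ} (hm : m ≤ r) : (m * Real.pi) ^ 2 ≤ 9.87 * (r : ℝ) ^ 2 := by
  have h : (m : ℝ) ^ 2 ≤ (r : ℝ) ^ 2 := by
    have : (m : ℝ) ≤ r := by exact_mod_cast hm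
    gcongr
  rw [mul_pow]
  have := pi_sq_le
  nlinarith [sq_nonneg (m : ℝ), sq_nonneg Real.pi]

/-- The interpolation at the points of `B_r` reproduces the cosine coefficient up to an error that
decays exponentially. -/
lemma norm_sum_lagBasis_sub_cosCoeff_le {r : ℕ} (hr : 1 ≤ r) {m n p : ℕ} (hm : m ≤ r) (v : L2Omega) :
    ‖(∑ b ∈ B r, lagBasis r b (Complex.I * ((m * Real.pi : ℝ) : ℂ)) *
      ((∫ x in Omega, coshCos b.re (n * Real.pi) (p * Real.pi) x * v x : ℝ) : ℂ)) -
      (cosCoeff v ![m, n, p] : ℂ)‖ ≤ 2 * Real.exp 24 * Real.exp (-r) * ∫ x in Omega, ‖v x‖ := by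
  have hvi : Integrable v volOmega := L2_integrable v
  have hint : ∀ b : ℂ, Integrable (fun x => ((coshCos b.re (n * Real.pi) (p * Real.pi) x * v x : ℝ) : ℂ))
      volOmega := fun b => by
    have h := integrable_mul_of_continuous hvi
      (contDiff_coshCos b.re (n * Real.pi) (p * Real.pi) (n := 1)).continuous
    exact (h.congr (Filter.Eventually.of_forall fun x => mul_comm _ _)).ofReal
  have hint' : Integrable (fun x => ((cosProd ![m, n, p] x * v x : ℝ) : ℂ)) volOmega := by
    have h := integrable_mul_of_continuous hvi (contDiff_cosProd ![m, n, p] (n := 1)).continuous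
    exact (h.congr (Filter.Eventually.of_forall fun x => mul_comm _ _)).ofReal
  have e : (∑ b ∈ B r, lagBasis r b (Complex.I * ((m * Real.pi : ℝ) : ℂ)) *
      ((∫ x in Omega, coshCos b.re (n * Real.pi) (p * Real.pi) x * v x : ℝ) : ℂ)) -
      (cosCoeff v ![m, n, p] : ℂ) = ∫ x in Omega,
        ((∑ b ∈ B r, lagBasis r b (Complex.I * ((m * Real.pi : ℝ) : ℂ)) *
          ((coshCos b.re (n * Real.pi) (p * Real.pi) x * v x : ℝ) : ℂ)) -
          ((cosProd ![m, n, p] x * v x : ℝ) : ℂ)) := by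
    rw [integral_sub (integrable_finsetSum _ fun b _ => (hint b).const_mul _) hint',
      integral_finsetSum _ fun b _ => (hint b).const_mul _, integral_complex_ofReal, cosCoeff]
    congr 1
    refine Finset.sum_congr rfl fun b _ => ?_
    rw [integral_const_mul, integral_complex_ofReal]
  rw [e]
  have hmem : ∀ᵐ x ∂volOmega, x ∈ Omega := ae_restrict_mem measurableSet_Omega
  refine (norm_integral_le_of_norm_le (g := fun x => 2 * Real.exp 24 * Real.exp (-r) * ‖v x‖)
    (hvi.norm.const_mul _) ?_).trans_eq (integral_const_mul _ _)
  filter_upwards [hmem] with x hx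
  have hx' := Omega_subset_Icc hx
  have hx0 : x 0 ∈ Icc (0 : ℝ) 1 := ⟨hx'.1 0, hx'.2 0⟩
  have key := norm_cosh_sub_sum_lagBasis_le hr (sq_mul_pi_le hm) hx0.1 hx0.2
  have e2 : ((∑ b ∈ B r, lagBasis r b (Complex.I * ((m * Real.pi : ℝ) : ℂ)) *
          ((coshCos b.re (n * Real.pi) (p * Real.pi) x * v x : ℝ) : ℂ)) -
          ((cosProd ![m, n, p] x * v x : ℝ) : ℂ)) =
      -(Complex.cosh (Complex.I * ((m * Real.pi : ℝ) : ℂ) * x 0) -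
        ∑ b ∈ B r, lagBasis r b (Complex.I * ((m * Real.pi : ℝ) : ℂ)) * Complex.cosh (b * x 0)) *
      ((Real.cos (n * Real.pi * x 1) * Real.cos (p * Real.pi * x 2) * v x : ℝ) : ℂ) := by
    have e3 : Complex.cosh (Complex.I * ((m * Real.pi : ℝ) : ℂ) * x 0) =
        ((Real.cos (m * Real.pi * x 0) : ℝ) : ℂ) := by
      rw [mul_assoc, mul_comm Complex.I, Complex.cosh_mul_I]
      push_cast
      rfl
    rw [e3, neg_sub, sub_mul, Finset.sum_mul]
    congr 1
    · refine Finset.sum_congr rfl fun b hb => ?_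
      obtain ⟨t, rfl, -⟩ := mem_B hb
      simp only [coshCos, coshFactor, Fin.prod_univ_three, Complex.ofReal_re]
      simp
      ring
    · simp [cosProd, Fin.prod_univ_three]
      ring
  rw [e2, norm_mul, norm_neg]
  refine mul_le_mul key ?_ (norm_nonneg _) (by positivity)
  rw [Complex.norm_real, norm_mul, norm_mul, Real.norm_eq_abs, Real.norm_eq_abs]
  have h1 := Real.abs_cos_le_one (n * Real.pi * x 1)
  have h2 := Real.abs_cos_le_one (p * Real.pi * x 2)
  refine mul_le_of_le_one_left (norm_nonneg _) ?_
  exact mul_le_one₀ h1 (abs_nonneg _) h2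

/-- The coefficients computed from inexact data differ from the exact cosine coefficients of the
source by an exponentially small quantity. -/
theorem IsSolution.exists_FEps_bound {lam mu T : ℝ} (hT : 0 < T) (hmu : 0 < mu)
    (hlam : 0 < lam + 2 * mu) {I₀ : Data T} (hW : W1 I₀) (hW2 : W2' lam mu T)
    {u : Fin 3 → ℝ → L2Omega} {f : Fin 3 → L2Omega} (hsol : IsSolution lam mu T I₀ u f) :
    ∃ C > 0, ∃ R₀ : ℝ, ∀ ε ∈ Ioo (0 : ℝ) 1, R₀ ≤ rEps ε → ∀ I : Data T, Close I₀ I ε →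
      ∀ (j : Fin 3) (m n p : ℕ), m ≤ rEps ε → n ≤ rEps ε → p ≤ rEps ε →
        ‖FEps lam mu I j ε m n p - (cosCoeff (f j) ![m, n, p] : ℂ)‖ ≤
          C * (rEps ε : ℝ) ^ 4 * Real.exp (-rEps ε) := by
  obtain ⟨C, hC, c, hc, z₀, hz₀, hH⟩ := hsol.exists_H_bound hT hmu hlam hW hW2
  set Nf : ℝ := ∑ j, ∫ x in Omega, ‖f j x‖ with hNf
  have hNf0 : ∀ j, 0 ≤ ∫ x in Omega, ‖f j x‖ := fun j => integral_nonneg fun _ => norm_nonneg _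
  have hNfj : ∀ j, ∫ x in Omega, ‖f j x‖ ≤ Nf := fun j =>
    Finset.single_le_sum (f := fun j => ∫ x in Omega, ‖f j x‖) (fun j _ => hNf0 j) (Finset.mem_univ j)
  have hNf00 : 0 ≤ Nf := (hNf0 0).trans (hNfj 0)
  refine ⟨48 * 24 * C * 841 * (Real.exp 60 + 1) + 2 * Real.exp 24 * Nf, by positivity,
    max z₀ (29 * Real.exp 60 / c), ?_⟩
  rintro ε ⟨hε0, hε1⟩ hR I hI j m n p hm hn hp
  have hεr := le_exp_rEps hε0 hε1
  have hr := one_le_rEps hε0 hε1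
  rw [FEps_eq_sum]
  set r := rEps ε with hrdef
  have hr1 : (1 : ℝ) ≤ r := by exact_mod_cast hr
  have hz : z₀ ≤ r := (le_max_left _ _).trans hR
  have hcr : 29 * Real.exp 60 / c ≤ r := (le_max_right _ _).trans hR
  rw [div_le_iff₀ hc] at hcr
  have hexp : (r : ℝ) ≤ Real.exp r := by linarith [Real.add_one_le_exp (r : ℝ)]
  -- all points of `B r` have modulus between `5 r` and `29 r`
  have hsmall : ε * (29 * r) ≤ c := by
    have h1 : Real.exp (-(60 * r)) ≤ Real.exp (-(2 * r)) := Real.exp_le_exp.2 (by linarith)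
    have h2 : Real.exp (-(2 * r : ℝ)) = (Real.exp r * Real.exp r)⁻¹ := by
      rw [← Real.exp_add, ← Real.exp_neg]; ring_nf
    have h3 : Real.exp (-(2 * r : ℝ)) ≤ ((r : ℝ) * r)⁻¹ := by rw [h2]; gcongr
    calc ε * (29 * r) ≤ (Real.exp 60 * ((r : ℝ) * r)⁻¹) * (29 * r) := by
          have := hεr.trans (mul_le_mul_of_nonneg_left (h1.trans h3) (Real.exp_pos 60).le)
          gcongr
      _ = 29 * Real.exp 60 / r := by field_simp
      _ ≤ c := by rw [div_le_iff₀ (by linarith)]; linarith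
  have hn2 := sq_mul_pi_le hn
  have hp2 := sq_mul_pi_le hp
  have hb : ∀ b ∈ B r, ‖lagBasis r b (Complex.I * ((m * Real.pi : ℝ) : ℂ)) *
      (H lam mu I j (freq b (n * Real.pi) (p * Real.pi)) -
      ((∫ x in Omega, coshCos b.re (n * Real.pi) (p * Real.pi) x * f j x : ℝ) : ℂ))‖ ≤
      24 * C * 841 * (Real.exp 60 + 1) * r ^ 3 * Real.exp (-r) := by
    intro b hb
    have hL := norm_lagBasis_le hr (y := m * Real.pi) (by nlinarith [sq_mul_pi_le hm]) hb
    obtain ⟨t, rfl, ht1, ht2, -⟩ := mem_B hb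
    have htsq : (5 * r) ^ 2 ≤ t ^ 2 := by
      rw [← sq_abs t]; exact pow_le_pow_left₀ (by positivity) (by linarith) 2
    have hbt := hH t (n * Real.pi) (p * Real.pi) ε I j (by linarith)
      (sq_le_sq.1 (by nlinarith)) (sq_le_sq.1 (by nlinarith)) (by nlinarith) hI
      ((mul_le_mul_of_nonneg_left ht2 hε0.le).trans hsmall)
    rw [norm_mul, Complex.ofReal_re]
    have hts : |t| ^ 2 ≤ 841 * r ^ 2 :=
      (pow_le_pow_left₀ (abs_nonneg t) ht2 2).trans_eq (by ring)
    have hexp1 : Real.exp |t| * (ε + Real.exp (-(12 * |t|))) ≤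
        (Real.exp 60 + 1) * Real.exp (-(30 * r)) := by
      rw [mul_add, ← Real.exp_add, add_mul, one_mul]
      refine add_le_add ?_ (Real.exp_le_exp.2 (by linarith))
      calc Real.exp |t| * ε ≤ Real.exp (29 * r) * (Real.exp 60 * Real.exp (-(60 * r))) := by
            gcongr
        _ = Real.exp 60 * Real.exp (29 * r + -(60 * r)) := by rw [Real.exp_add]; ring
        _ ≤ _ := by gcongr; linarith
    calc _ ≤ (24 * r * Real.exp (29 * r)) *
          (C * (841 * r ^ 2) * ((Real.exp 60 + 1) * Real.exp (-(30 * r)))) := by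
          refine mul_le_mul hL (hbt.trans ?_) (norm_nonneg _) (by positivity)
          rw [mul_assoc (C * |t| ^ 2)]
          gcongr
      _ = 24 * C * 841 * (Real.exp 60 + 1) * r ^ 3 * Real.exp (29 * r + -(30 * r)) := by
          rw [Real.exp_add]; ring
      _ = _ := by congr 2; ring
  have hsum := norm_sum_le_of_le _ hb
  rw [Finset.sum_const, nsmul_eq_mul] at hsum
  have hint := norm_sum_lagBasis_sub_cosCoeff_le hr hm (n := n) (p := p) (f j)
  have hcard := card_B_le r
  refine (norm_sub_le_norm_sub_add_norm_sub _ (∑ b ∈ B r,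
    lagBasis r b (Complex.I * ((m * Real.pi : ℝ) : ℂ)) *
      ((∫ x in Omega, coshCos b.re (n * Real.pi) (p * Real.pi) x * f j x : ℝ) : ℂ)) _).trans ?_
  rw [← Finset.sum_sub_distrib]
  simp only [← mul_sub]
  refine (add_le_add hsum hint).trans ?_
  rw [add_mul, add_mul]
  refine add_le_add ?_ ?_
  · calc _ ≤ (48 * r : ℝ) * (24 * C * 841 * (Real.exp 60 + 1) * r ^ 3 * Real.exp (-r)) := by
          gcongr
      _ = _ := by ring
  · have h4 : (1 : ℝ) ≤ (r : ℝ) ^ 4 := one_le_pow₀ hr1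
    have hj := hNfj j
    calc _ ≤ 2 * Real.exp 24 * Real.exp (-r) * (Nf * (r : ℝ) ^ 4) := by
          gcongr
          nlinarith
      _ = _ := by ring

/-! ### Partial sums of trigonometric series -/

/-- The indices `k` with `k j < N j` for all `j`. -/
def box (N : Fin 3 → ℕ) : Finset (Fin 3 → ℕ) := Fintype.piFinset fun j => Finset.range (N j)

lemma mem_box {N k : Fin 3 → ℕ} : k ∈ box N ↔ ∀ j, k j < N j := by simp [box]

/-- The Fourier coefficient with respect to `trigBasis σ`. -/
def trigCoeff (σ : Fin 3 → Bool) (v : L2Omega) (k : Fin 3 → ℕ) : ℝ := inner ℝ (trigL2 σ k) v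

/-- The partial sum of the expansion of `v` in `trigBasis σ`, over the indices in `box N`. -/
def trigSum (σ : Fin 3 → Bool) (v : L2Omega) (N : Fin 3 → ℕ) : L2Omega :=
  ∑ k ∈ box N, trigCoeff σ v k • trigL2 σ k

lemma trigCoeff_eq_integral (σ : Fin 3 → Bool) (v : L2Omega) (k : Fin 3 → ℕ) :
    trigCoeff σ v k = ∫ x in Omega, trigProd σ k x * v x :=
  inner_contToL2 _ (continuous_trigProd σ k) v

lemma hasSum_trigCoeff (σ : Fin 3 → Bool) (v : L2Omega) :
    HasSum (fun k => trigCoeff σ v k • trigL2 σ k) v := by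
  have h := (trigBasis σ).hasSum_repr v
  simp only [HilbertBasis.repr_apply_apply, trigBasis_apply] at h
  exact h

lemma sum_trigCoeff_sq_le (σ : Fin 3 → Bool) (v : L2Omega) (S : Finset (Fin 3 → ℕ)) :
    ∑ k ∈ S, trigCoeff σ v k ^ 2 ≤ ‖v‖ ^ 2 := by
  have h := (orthonormal_trigL2 σ).sum_inner_products_le v (s := S)
  simp only [Real.norm_eq_abs, sq_abs] at h
  exact h

lemma norm_sum_trigCoeff_sq (σ : Fin 3 → Bool) (v : L2Omega) (S : Finset (Fin 3 → ℕ)) :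
    ‖∑ k ∈ S, trigCoeff σ v k • trigL2 σ k‖ ^ 2 = ∑ k ∈ S, trigCoeff σ v k ^ 2 := by
  rw [← real_inner_self_eq_norm_sq, (orthonormal_trigL2 σ).inner_sum]
  exact Finset.sum_congr rfl fun k _ => by simp [sq]

/-- The distance from `v` to a partial sum is controlled by the coefficients outside the box. -/
lemma norm_trigSum_sub_sq_le {σ : Fin 3 → Bool} {v : L2Omega} {N : Fin 3 → ℕ} {A : Fin 3 → ℝ}
    (h : ∀ j, ∀ S : Finset (Fin 3 → ℕ), (∀ k ∈ S, N j ≤ k j) → ∑ k ∈ S, trigCoeff σ v k ^ 2 ≤ A j) :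
    ‖trigSum σ v N - v‖ ^ 2 ≤ ∑ j, A j := by
  have hS : ∀ S : Finset (Fin 3 → ℕ), (∀ k ∈ S, k ∉ box N) →
      ∑ k ∈ S, trigCoeff σ v k ^ 2 ≤ ∑ j, A j := by
    intro S hS
    calc _ ≤ ∑ k ∈ S, ∑ j, if N j ≤ k j then trigCoeff σ v k ^ 2 else 0 := by
          refine Finset.sum_le_sum fun k hk => ?_
          have := hS k hk
          rw [mem_box] at this
          push Not at this
          obtain ⟨j, hj⟩ := this
          refine le_of_eq_of_le (if_pos hj).symm (Finset.single_le_sum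
            (f := fun j => if N j ≤ k j then trigCoeff σ v k ^ 2 else 0)
            (fun j _ => ?_) (Finset.mem_univ j))
          split_ifs
          exacts [sq_nonneg _, le_rfl]
      _ = ∑ j, ∑ k ∈ S.filter fun k => N j ≤ k j, trigCoeff σ v k ^ 2 := by
          rw [Finset.sum_comm]
          simp only [Finset.sum_filter]
      _ ≤ _ := Finset.sum_le_sum fun j _ => h j _ fun k hk => (Finset.mem_filter.1 hk).2
  have hlim : Filter.Tendsto (fun S : Finset (Fin 3 → ℕ) =>
      ‖trigSum σ v N - ∑ k ∈ S, trigCoeff σ v k • trigL2 σ k‖ ^ 2) Filter.atTop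
      (nhds (‖trigSum σ v N - v‖ ^ 2)) :=
    ((tendsto_const_nhds.sub (hasSum_trigCoeff σ v)).norm).pow 2
  refine le_of_tendsto hlim ?_
  filter_upwards [Filter.eventually_ge_atTop (box N)] with S hNS
  rw [norm_sub_rev, trigSum, ← Finset.sum_sdiff hNS, add_sub_cancel_right, norm_sum_trigCoeff_sq]
  exact hS _ fun k hk => (Finset.mem_sdiff.1 hk).2

lemma tendsto_trigSum (σ : Fin 3 → Bool) (v : L2Omega) {N : ℕ → Fin 3 → ℕ}
    (hN : ∀ j, Filter.Tendsto (fun r => N r j) Filter.atTop Filter.atTop) :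
    Filter.Tendsto (fun r => trigSum σ v (N r)) Filter.atTop (nhds v) := by
  refine (hasSum_trigCoeff σ v).comp (Filter.tendsto_atTop.2 fun S => ?_)
  have h : ∀ k ∈ S, ∀ᶠ r in Filter.atTop, k ∈ box (N r) := fun k _ => by
    simp only [mem_box]
    exact Filter.eventually_all.2 fun j => (hN j).eventually_gt_atTop (k j)
  filter_upwards [(Filter.eventually_all_finset S).2 h] with r hr k hk using hr k hk

lemma hasDerivAt_trig_true (m : ℕ) (t : ℝ) :
    HasDerivAt (trig true m) ((m + 1) * Real.pi * trig false (m + 1) t) t := by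
  have h : HasDerivAt (fun t : ℝ => (m + 1) * Real.pi * t) ((m + 1) * Real.pi) t := by
    simpa using (hasDerivAt_id t).const_mul ((m + 1) * Real.pi)
  refine (h.sin.const_mul (√2)).congr_deriv ?_
  simp [trig]
  ring

lemma hasDerivAt_trig_false (m : ℕ) (t : ℝ) :
    HasDerivAt (trig false (m + 1)) (-((m + 1) * Real.pi * trig true m t)) t := by
  have h : HasDerivAt (fun t : ℝ => ((m + 1 : ℕ) : ℝ) * Real.pi * t) ((m + 1) * Real.pi) t := by
    simpa using (hasDerivAt_id t).const_mul (((m + 1 : ℕ) : ℝ) * Real.pi)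
  have e : trig false (m + 1) = fun t => √2 * Real.cos (((m + 1 : ℕ) : ℝ) * Real.pi * t) := by
    funext s; simp [trig]
  rw [e]
  refine (h.cos.const_mul (√2)).congr_deriv ?_
  simp [trig]
  ring

lemma hasDerivAt_trig_false_zero (t : ℝ) : HasDerivAt (trig false 0) 0 t := by
  have e : trig false 0 = fun _ => 1 := by funext s; simp [trig]
  rw [e]
  exact hasDerivAt_const t 1

/-- The product rule for a product of functions of one coordinate each, with the differentiated
factor singled out. -/
lemma pd_trigProd {σ : Fin 3 → Bool} {k : Fin 3 → ℕ} {i : Fin 3} {τ : Bool} {m : ℕ} {a : ℝ}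
    (h : ∀ t, HasDerivAt (trig (σ i) (k i)) (a * trig τ m t) t) (x : Pt) :
    pd i (trigProd σ k) x = a * trigProd (Function.update σ i τ) (Function.update k i m) x := by
  have h1 := pd_prod (i := i) (g := fun l => trig (σ l) (k l))
    (fun l => (contDiff_trig (σ l) (k l) (n := 1)).differentiable (by simp)) x
  change pd i (fun y : Pt => ∏ l, trig (σ l) (k l) (y l)) x = _
  rw [h1, trigProd, ← Finset.mul_prod_erase Finset.univ _ (Finset.mem_univ i),
    ← Finset.mul_prod_erase Finset.univ (fun l => trig (Function.update σ i τ l) _ _)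
      (Finset.mem_univ i), ← mul_assoc]
  congr 1
  · simp [(h (x i)).deriv]
  · refine Finset.prod_congr rfl fun l hl => ?_
    have := Finset.ne_of_mem_erase hl
    simp [this]

/-- Integration by parts: the cosine coefficients in the coordinate `i` of a function are, up to the
factor `-(k i + 1) π`, the sine coefficients of its weak derivative. -/
lemma trigCoeff_of_hasWeakPartial {i : Fin 3} {w v : L2Omega} (h : HasWeakPartial i w v)
    {σ : Fin 3 → Bool} (hσ : σ i = false) (k : Fin 3 → ℕ) :
    trigCoeff (Function.update σ i true) v k =
      -((k i + 1) * Real.pi) * trigCoeff σ w (Function.update k i (k i + 1)) := by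
  set σ' := Function.update σ i true with hσ'
  have hσ'i : σ' i = true := by simp [hσ']
  have hvan : ∀ x : Pt, trig (σ' i) (k i) (x i) = 0 → trigProd σ' k x = 0 := fun x hx =>
    Finset.prod_eq_zero (Finset.mem_univ i) hx
  have key := h.integral_eq (L2_integrable w) (L2_integrable v) (contDiff_trigProd σ' k)
    (fun x hx => hvan x (by simp [hσ'i, trig, hx]))
    (fun x hx => hvan x (by
      rw [hσ'i, hx]
      have := Real.sin_nat_mul_pi (k i + 1)
      push_cast at this
      simp [trig, this]))
  have hpd : ∀ x, pd i (trigProd σ' k) x =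
      (k i + 1) * Real.pi * trigProd σ (Function.update k i (k i + 1)) x := fun x => by
    rw [pd_trigProd (τ := false) (m := k i + 1) (a := (k i + 1) * Real.pi) fun t => by
      rw [hσ'i]; exact hasDerivAt_trig_true (k i) t, hσ', Function.update_idem, ← hσ,
      Function.update_eq_self]
  rw [trigCoeff_eq_integral, trigCoeff_eq_integral, neg_mul, ← integral_const_mul, ← neg_eq_iff_eq_neg,
    ← key]
  exact integral_congr_ae (Filter.Eventually.of_forall fun x => by simp only [hpd]; ring)

/-- The coefficients with a high cosine frequency in the coordinate `i` of a function with a weak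
derivative in that direction. -/
lemma sum_trigCoeff_sq_le_of_hasWeakPartial {i : Fin 3} {w v : L2Omega} (h : HasWeakPartial i w v)
    {σ : Fin 3 → Bool} (hσ : σ i = false) {r : ℕ} (hr : 1 ≤ r) {S : Finset (Fin 3 → ℕ)}
    (hS : ∀ k ∈ S, r ≤ k i) : ∑ k ∈ S, trigCoeff σ w k ^ 2 ≤ ‖v‖ ^ 2 / (r : ℝ) ^ 2 := by
  have hr0 : (0 : ℝ) < r := by exact_mod_cast hr
  have hinj : Set.InjOn (fun k : Fin 3 → ℕ => Function.update k i (k i - 1)) S := by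
    intro k hk l hl hkl
    have h1 := hS k hk
    have h2 := hS l hl
    funext j
    have := congrFun hkl j
    by_cases hj : j = i
    · subst hj; simp at this; omega
    · simpa [hj] using this
  have hb := sum_trigCoeff_sq_le (Function.update σ i true) v
    (S.image fun k : Fin 3 → ℕ => Function.update k i (k i - 1))
  rw [Finset.sum_image hinj] at hb
  rw [le_div_iff₀ (by positivity), Finset.sum_mul]
  refine (Finset.sum_le_sum fun k hk => ?_).trans hb
  have h1 := hS k hk
  rw [trigCoeff_of_hasWeakPartial h hσ]
  have e : Function.update (Function.update k i (k i - 1)) i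
      (Function.update k i (k i - 1) i + 1) = k := by
    rw [Function.update_idem, Function.update_self, Nat.sub_add_cancel (hr.trans h1),
      Function.update_eq_self]
  rw [e, Function.update_self, mul_pow, neg_sq, mul_comm]
  have e2 : ((k i - 1 : ℕ) : ℝ) + 1 = k i := by
    rw [Nat.cast_sub (hr.trans h1)]; simp
  rw [e2]
  have h3 : (r : ℝ) ≤ k i * Real.pi := by
    have h4 : (r : ℝ) ≤ k i := by exact_mod_cast h1
    nlinarith [Real.pi_gt_three]
  gcongr

/-! ### Rates of convergence of the partial sums in `H¹` and `H²` -/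

/-- The pointwise product of a continuous function and an element of `L²(Ω)`. -/
def mulL2 (g : Pt → ℝ) (hg : Continuous g) (v : L2Omega) : L2Omega :=
  MemLp.toLp (fun x => g x * v x) (by
    obtain ⟨M, -, hM⟩ := exists_bound_Icc hg
    refine MemLp.of_le_mul (c := M) (L2_memLp v)
      (hg.aestronglyMeasurable.mul (L2_memLp v).1) ?_
    filter_upwards [ae_restrict_mem measurableSet_Omega] with x hx
    rw [norm_mul]
    exact mul_le_mul_of_nonneg_right (hM x (Omega_subset_Icc hx)) (norm_nonneg _))

lemma coeFn_mulL2 (g : Pt → ℝ) (hg : Continuous g) (v : L2Omega) :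
    mulL2 g hg v =ᵐ[volOmega] fun x => g x * v x := MemLp.coeFn_toLp _

lemma norm_mulL2_le {g : Pt → ℝ} (hg : Continuous g) {M : ℝ}
    (hM : ∀ x ∈ Icc (0 : Pt) 1, |g x| ≤ M) (v : L2Omega) : ‖mulL2 g hg v‖ ≤ M * ‖v‖ := by
  refine Lp.norm_le_mul_norm_of_ae_le_mul ?_
  filter_upwards [ae_restrict_mem measurableSet_Omega, coeFn_mulL2 g hg v] with x hx hgx
  rw [hgx, norm_mul]
  exact mul_le_mul_of_nonneg_right (hM x (Omega_subset_Icc hx)) (norm_nonneg _)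

/-- The function `-cos ((m + 1) π t) + (1 - t) + cos ((m + 1) π) t`: a primitive of
`(m + 1) π sin ((m + 1) π t)` up to a linear function that makes it vanish at `0` and `1`. -/
def sinPrimitive (m : ℕ) (t : ℝ) : ℝ :=
  -Real.cos ((m + 1) * Real.pi * t) + (1 - t) + Real.cos ((m + 1) * Real.pi) * t

lemma contDiff_sinPrimitive (m : ℕ) {n : WithTop ℕ∞} : ContDiff ℝ n (sinPrimitive m) := by
  unfold sinPrimitive
  fun_prop

lemma hasDerivAt_sinPrimitive (m : ℕ) (t : ℝ) : HasDerivAt (sinPrimitive m)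
    ((m + 1) * Real.pi * Real.sin ((m + 1) * Real.pi * t) - (1 - Real.cos ((m + 1) * Real.pi))) t := by
  have h : HasDerivAt (fun t : ℝ => (m + 1) * Real.pi * t) ((m + 1) * Real.pi) t := by
    simpa using (hasDerivAt_id t).const_mul ((m + 1) * Real.pi)
  have h2 : HasDerivAt (fun t : ℝ => 1 - t) (-1) t := (hasDerivAt_id t).const_sub 1
  have h3 : HasDerivAt (fun t : ℝ => Real.cos ((m + 1) * Real.pi) * t)
      (Real.cos ((m + 1) * Real.pi)) t := by
    simpa using (hasDerivAt_id t).const_mul (Real.cos ((m + 1) * Real.pi))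
  refine ((h.cos.neg.add h2).add h3).congr_deriv ?_
  ring

lemma abs_sinPrimitive_le (m : ℕ) {t : ℝ} (h0 : 0 ≤ t) (h1 : t ≤ 1) : |sinPrimitive m t| ≤ 3 := by
  have ha := abs_le.1 (Real.abs_cos_le_one ((m + 1) * Real.pi * t))
  have hb := abs_le.1 (Real.abs_cos_le_one ((m + 1) * Real.pi))
  rw [sinPrimitive, abs_le]
  constructor <;> nlinarith

/-- Integration by parts in a direction in which the basis functions are sines; the boundary terms
appear as the coefficient of `w`. -/
lemma mul_trigCoeff_eq {i : Fin 3} {w v : L2Omega} (h : HasWeakPartial i w v)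
    {σ : Fin 3 → Bool} (hσ : σ i = true) (k : Fin 3 → ℕ) :
    (k i + 1) * Real.pi * trigCoeff σ w k =
      √2 * (1 - Real.cos ((k i + 1) * Real.pi)) *
        trigCoeff (Function.update σ i false) w (Function.update k i 0) -
      trigCoeff (Function.update σ i false)
        (mulL2 (fun x => √2 * sinPrimitive (k i) (x i))
          (continuous_const.mul ((contDiff_sinPrimitive (k i) (n := 0)).continuous.comp
            (continuous_apply i))) v) (Function.update k i 0) := by
  set σ' := Function.update σ i false with hσ'
  set k' := Function.update k i 0 with hk'
  have hσ'i : σ' i = false := by simp [hσ']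
  have hk'i : k' i = 0 := by simp [hk']
  set θ : Pt → ℝ := fun x => (√2 * sinPrimitive (k i) (x i)) * trigProd σ' k' x with hθ
  have hg : ContDiff ℝ ((⊤ : ℕ∞) : WithTop ℕ∞) (fun t => √2 * sinPrimitive (k i) t) :=
    contDiff_const.mul (contDiff_sinPrimitive (k i))
  have hgx : ContDiff ℝ ((⊤ : ℕ∞) : WithTop ℕ∞) (fun x : Pt => √2 * sinPrimitive (k i) (x i)) :=
    hg.comp (contDiff_apply ℝ ℝ i)
  have hpd : ∀ x, pd i θ x = (k i + 1) * Real.pi * trigProd σ k x -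
      √2 * (1 - Real.cos ((k i + 1) * Real.pi)) * trigProd σ' k' x := by
    intro x
    have h1 : pd i (trigProd σ' k') x = 0 := by
      rw [pd_trigProd (τ := false) (m := 0) (a := 0) fun t => by
        rw [hσ'i, hk'i, zero_mul]; exact hasDerivAt_trig_false_zero t, zero_mul]
    have h2 : pd i (fun y : Pt => √2 * sinPrimitive (k i) (y i)) x =
        √2 * ((k i + 1) * Real.pi * Real.sin ((k i + 1) * Real.pi * x i) -
          (1 - Real.cos ((k i + 1) * Real.pi))) := by
      rw [pd_comp_coord (k := i) (hg.differentiable (by simp)), if_pos rfl]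
      exact ((hasDerivAt_sinPrimitive (k i) (x i)).const_mul (√2)).deriv
    rw [hθ, pd_mul (hgx.differentiable (by simp))
      ((contDiff_trigProd σ' k' (n := 1)).differentiable (by simp)), h1, h2]
    have h3 : trigProd σ k x =
        √2 * Real.sin ((k i + 1) * Real.pi * x i) * trigProd σ' k' x := by
      rw [trigProd, trigProd, ← Finset.mul_prod_erase Finset.univ _ (Finset.mem_univ i),
        ← Finset.mul_prod_erase Finset.univ (fun l => trig (σ' l) _ _) (Finset.mem_univ i),
        hσ'i, hk'i, hσ]
      have h4 : ∏ l ∈ Finset.univ.erase i, trig (σ l) (k l) (x l) =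
          ∏ l ∈ Finset.univ.erase i, trig (σ' l) (k' l) (x l) := by
        refine Finset.prod_congr rfl fun l hl => ?_
        have := Finset.ne_of_mem_erase hl
        simp [hσ', hk', this]
      rw [h4]
      simp [trig]
    rw [h3]
    ring
  have key := h.integral_eq (L2_integrable w) (L2_integrable v)
    (hgx.mul (contDiff_trigProd σ' k'))
    (fun x hx => by simp [hx, sinPrimitive]) (fun x hx => by simp [hx, sinPrimitive])
  have hi : ∀ σ k, Integrable (fun x => trigProd σ k x * w x) volOmega := fun σ k =>
    (integrable_mul_of_continuous (L2_integrable w) (continuous_trigProd σ k)).congr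
      (Filter.Eventually.of_forall fun x => mul_comm _ _)
  rw [trigCoeff_eq_integral, trigCoeff_eq_integral, trigCoeff_eq_integral,
    ← integral_const_mul, ← integral_const_mul, eq_sub_iff_add_eq, ← eq_sub_iff_add_eq',
    ← integral_sub ((hi _ _).const_mul _) ((hi _ _).const_mul _)]
  have e1 : ∫ x in Omega, trigProd σ' k' x * (mulL2 (fun x => √2 * sinPrimitive (k i) (x i))
          (continuous_const.mul ((contDiff_sinPrimitive (k i) (n := 0)).continuous.comp
            (continuous_apply i))) v) x = ∫ x in Omega, θ x * v x := by
    refine integral_congr_ae ?_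
    filter_upwards [coeFn_mulL2 (fun x => √2 * sinPrimitive (k i) (x i))
          (continuous_const.mul ((contDiff_sinPrimitive (k i) (n := 0)).continuous.comp
            (continuous_apply i))) v] with x hx
    rw [hx, hθ]
    ring
  rw [e1, ← neg_eq_iff_eq_neg.2 key, ← integral_neg]
  refine integral_congr_ae (Filter.Eventually.of_forall fun x => ?_)
  have := hpd x
  simp only [hθ] at this ⊢
  rw [this]
  ring

/-- For a fixed sine frequency `m + 1` in the coordinate `i`, Bessel's inequality applies in the
other two coordinates to `w` and to the product of `v` with the primitive of the sine. -/
lemma sum_slice_le {i : Fin 3} {w v : L2Omega} (h : HasWeakPartial i w v)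
    {σ : Fin 3 → Bool} (hσ : σ i = true) {m : ℕ} {S : Finset (Fin 3 → ℕ)} (hS : ∀ k ∈ S, k i = m) :
    ∑ k ∈ S, trigCoeff σ w k ^ 2 ≤ (16 * ‖w‖ ^ 2 + 36 * ‖v‖ ^ 2) * (((m + 1 : ℕ) : ℝ) ^ 2)⁻¹ := by
  set gv := mulL2 (fun x => √2 * sinPrimitive m (x i))
    (continuous_const.mul ((contDiff_sinPrimitive m (n := 0)).continuous.comp
      (continuous_apply i))) v with hgv
  have hgv2 : ‖gv‖ ^ 2 ≤ 18 * ‖v‖ ^ 2 := by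
    have h1 : ‖gv‖ ≤ (√2 * 3) * ‖v‖ := norm_mulL2_le _ (fun x hx => by
      rw [abs_mul, abs_of_nonneg (Real.sqrt_nonneg 2)]
      exact mul_le_mul_of_nonneg_left (abs_sinPrimitive_le m (hx.1 i) (hx.2 i))
        (Real.sqrt_nonneg 2)) v
    refine (pow_le_pow_left₀ (norm_nonneg _) h1 2).trans_eq ?_
    rw [mul_pow, mul_pow, Real.sq_sqrt zero_le_two]
    norm_num
  have hinj : Set.InjOn (fun k : Fin 3 → ℕ => Function.update k i 0) S := by
    intro k hk l hl hkl
    funext j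
    by_cases hj : j = i
    · rw [hj, hS k hk, hS l hl]
    · simpa [hj] using congrFun hkl j
  have hbes : ∀ u : L2Omega, ∑ k ∈ S,
      trigCoeff (Function.update σ i false) u (Function.update k i 0) ^ 2 ≤ ‖u‖ ^ 2 := fun u => by
    have := sum_trigCoeff_sq_le (Function.update σ i false) u
      (S.image fun k : Fin 3 → ℕ => Function.update k i 0)
    rwa [Finset.sum_image hinj] at this
  have hterm : ∀ k ∈ S, ((m + 1 : ℕ) : ℝ) ^ 2 * trigCoeff σ w k ^ 2 ≤
      16 * trigCoeff (Function.update σ i false) w (Function.update k i 0) ^ 2 +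
        2 * trigCoeff (Function.update σ i false) gv (Function.update k i 0) ^ 2 := by
    intro k hk
    have e := mul_trigCoeff_eq h hσ k
    rw [hS k hk, ← hgv] at e
    set a := trigCoeff (Function.update σ i false) w (Function.update k i 0)
    set b := trigCoeff (Function.update σ i false) gv (Function.update k i 0)
    set c := trigCoeff σ w k
    have hs := abs_le.1 (Real.abs_cos_le_one ((m + 1) * Real.pi))
    set s := Real.cos ((m + 1) * Real.pi)
    have h2 : (√2) ^ 2 = 2 := Real.sq_sqrt zero_le_two
    have h3 : (√2 * (1 - s) * a) ^ 2 ≤ 8 * a ^ 2 := by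
      rw [mul_pow, mul_pow, h2]
      have : (1 - s) ^ 2 ≤ 4 := by nlinarith
      nlinarith [sq_nonneg a]
    have h4 : ((m + 1 : ℕ) : ℝ) ^ 2 * c ^ 2 ≤ ((m + 1) * Real.pi * c) ^ 2 := by
      push_cast
      rw [← mul_pow, mul_right_comm, mul_pow _ Real.pi]
      refine le_mul_of_one_le_right (sq_nonneg _) ?_
      nlinarith [Real.pi_gt_three]
    rw [e] at h4
    nlinarith [sq_nonneg (√2 * (1 - s) * a + b)]
  have hsum := Finset.sum_le_sum hterm
  rw [← Finset.mul_sum, Finset.sum_add_distrib, ← Finset.mul_sum, ← Finset.mul_sum] at hsum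
  have hm : (0 : ℝ) < ((m + 1 : ℕ) : ℝ) ^ 2 := by positivity
  rw [← div_eq_mul_inv, le_div_iff₀ hm]
  linarith [hbes w, hbes gv]

/-- The tail over high sine frequencies in the coordinate `i` is only `O(1/r)`, not `O(1/r²)`, since
`w` need not vanish on the boundary. -/
lemma sum_trigCoeff_sq_le_of_sin {i : Fin 3} {w v : L2Omega} (h : HasWeakPartial i w v)
    {σ : Fin 3 → Bool} (hσ : σ i = true) {r : ℕ} (hr : 1 ≤ r) {S : Finset (Fin 3 → ℕ)}
    (hS : ∀ k ∈ S, r ≤ k i) :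
    ∑ k ∈ S, trigCoeff σ w k ^ 2 ≤ (16 * ‖w‖ ^ 2 + 36 * ‖v‖ ^ 2) / r := by
  set M := max r (S.sup fun k => k i + 1) with hM
  have hmaps : ∀ k ∈ S, k i + 1 ∈ Finset.Ioc r M := fun k hk => Finset.mem_Ioc.2
    ⟨Nat.lt_succ_of_le (hS k hk),
      (Finset.le_sup (f := fun k : Fin 3 → ℕ => k i + 1) hk).trans (le_max_right _ _)⟩
  rw [← Finset.sum_fiberwise_of_maps_to hmaps]
  have h1 : ∀ m ∈ Finset.Ioc r M, ∑ k ∈ S with k i + 1 = m, trigCoeff σ w k ^ 2 ≤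
      (16 * ‖w‖ ^ 2 + 36 * ‖v‖ ^ 2) * ((m : ℝ) ^ 2)⁻¹ := by
    intro m hm
    obtain ⟨m, rfl⟩ : ∃ l, m = l + 1 :=
      Nat.exists_eq_succ_of_ne_zero (by have := (Finset.mem_Ioc.1 hm).1; omega)
    refine sum_slice_le h hσ fun k hk => ?_
    have := (Finset.mem_filter.1 hk).2
    omega
  refine (Finset.sum_le_sum h1).trans ?_
  rw [← Finset.mul_sum, div_eq_mul_inv]
  refine mul_le_mul_of_nonneg_left ?_ (by positivity)
  have h2 := sum_Ioc_inv_sq_le_sub (α := ℝ) (k := r) (n := M) (by omega) (le_max_left _ _)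
  have h3 : (0 : ℝ) ≤ (M : ℝ)⁻¹ := by positivity
  linarith

/-- Sine in the coordinate `i`, cosines in the others. -/
def sinAt (i : Fin 3) : Fin 3 → Bool := Function.update (fun _ => false) i true

/-- The frequency bounds of the `i`-th derivative of a cosine sum with frequencies at most `r`; as
the sine functions are indexed from `0`, the bound in the coordinate `i` drops by one. -/
def gradBox (r : ℕ) (i : Fin 3) : Fin 3 → ℕ := Function.update (fun _ => r + 1) i r

lemma norm_cosSum_sub_sq_le {w : L2Omega} {V : Fin 3 → L2Omega} (h : ∀ i, HasWeakPartial i w (V i))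
    {r : ℕ} (hr : 1 ≤ r) :
    ‖trigSum (fun _ => false) w (fun _ => r + 1) - w‖ ^ 2 ≤ (∑ i, ‖V i‖ ^ 2) / (r : ℝ) ^ 2 := by
  rw [Finset.sum_div]
  exact norm_trigSum_sub_sq_le fun j S hS => sum_trigCoeff_sq_le_of_hasWeakPartial (h j) rfl hr
    fun k hk => (Nat.le_succ r).trans (hS k hk)

lemma norm_gradSum_sub_sq_le {i : Fin 3} {w : L2Omega} {V : Fin 3 → L2Omega}
    (h : ∀ l, HasWeakPartial l w (V l)) {r : ℕ} (hr : 1 ≤ r) :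
    ‖trigSum (sinAt i) w (gradBox r i) - w‖ ^ 2 ≤
      (∑ l, (16 * ‖w‖ ^ 2 + 36 * ‖V l‖ ^ 2)) / r := by
  have hr1 : (1 : ℝ) ≤ r := by exact_mod_cast hr
  rw [Finset.sum_div]
  refine norm_trigSum_sub_sq_le fun j S hS => ?_
  by_cases hj : j = i
  · subst hj
    exact sum_trigCoeff_sq_le_of_sin (h j) (by simp [sinAt]) hr fun k hk => by
      simpa [gradBox] using hS k hk
  · refine (sum_trigCoeff_sq_le_of_hasWeakPartial (h j) (by simp [sinAt, hj]) hr fun k hk => ?_).trans ?_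
    · have := hS k hk
      simp [gradBox, hj] at this
      omega
    · have h1 : (r : ℝ) ≤ (r : ℝ) ^ 2 := by nlinarith
      have h2 : ‖V j‖ ^ 2 ≤ 16 * ‖w‖ ^ 2 + 36 * ‖V j‖ ^ 2 := by
        linarith [sq_nonneg ‖w‖, sq_nonneg ‖V j‖]
      gcongr

/-- The derivative of a partial cosine sum is the partial sum of the expansion of the weak
derivative. -/
lemma sum_mul_pd_trigProd {i : Fin 3} {w v : L2Omega} (h : HasWeakPartial i w v) (r : ℕ) (x : Pt) :
    ∑ k ∈ box fun _ => r + 1, trigCoeff (fun _ => false) w k * pd i (trigProd (fun _ => false) k) x =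
      ∑ k ∈ box (gradBox r i), trigCoeff (sinAt i) v k * trigProd (sinAt i) k x := by
  have hinj : Set.InjOn (fun k : Fin 3 → ℕ => Function.update k i (k i + 1)) (box (gradBox r i)) := by
    intro k hk l hl hkl
    funext j
    have := congrFun hkl j
    by_cases hj : j = i
    · subst hj; simpa using this
    · simpa [hj] using this
  have hsub : (box (gradBox r i)).image (fun k : Fin 3 → ℕ => Function.update k i (k i + 1)) ⊆
      box fun _ => r + 1 := by
    intro k hk
    obtain ⟨l, hl, rfl⟩ := Finset.mem_image.1 hk
    rw [mem_box] at hl ⊢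
    intro j
    have := hl j
    by_cases hj : j = i
    · subst hj; simpa [gradBox] using this
    · simpa [gradBox, hj] using this
  rw [← Finset.sum_subset hsub, Finset.sum_image hinj]
  · refine Finset.sum_congr rfl fun k _ => ?_
    rw [sinAt, trigCoeff_of_hasWeakPartial h rfl k,
      pd_trigProd (τ := true) (m := k i) (a := -((k i + 1) * Real.pi)) fun t => by
        simpa using hasDerivAt_trig_false (k i) t, Function.update_idem, Function.update_eq_self]
    ring
  · intro k hk hk'
    have hki : k i = 0 := by
      by_contra hne
      refine hk' (Finset.mem_image.2 ⟨Function.update k i (k i - 1), ?_, ?_⟩)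
      · rw [mem_box] at hk ⊢
        intro j
        have := hk j
        by_cases hj : j = i
        · subst hj; simp [gradBox]; omega
        · simpa [gradBox, hj] using this
      · simp only [Function.update_self, Function.update_idem]
        rw [Nat.sub_add_cancel (Nat.one_le_iff_ne_zero.2 hne), Function.update_eq_self]
    rw [pd_trigProd (τ := false) (m := 0) (a := 0) fun t => by
      rw [hki, zero_mul]; exact hasDerivAt_trig_false_zero t, zero_mul, mul_zero]

/-! ### The regularized solution as a perturbed partial sum -/

/-- The factor by which `trigProd (fun _ => false) k` differs from `cosProd k`. -/
def cosScale (k : Fin 3 → ℕ) : ℝ := ∏ i, if k i = 0 then 1 else √2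

lemma trigProd_false (k : Fin 3 → ℕ) (x : Pt) :
    trigProd (fun _ => false) k x = cosScale k * cosProd k x := by
  simp only [trigProd, cosScale, cosProd, ← Finset.prod_mul_distrib, trig, Bool.false_eq_true,
    if_false]

lemma trigCoeff_false (v : L2Omega) (k : Fin 3 → ℕ) :
    trigCoeff (fun _ => false) v k = cosScale k * cosCoeff v k := by
  rw [trigCoeff_eq_integral, cosCoeff, ← integral_const_mul]
  simp only [trigProd_false, mul_assoc]

lemma prod_le_three {a : Fin 3 → ℝ} (h0 : ∀ i, 0 ≤ a i) (h : ∀ i, a i ≤ √2) : ∏ i, a i ≤ 3 := by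
  refine (Finset.prod_le_prod (fun i _ => h0 i) fun i _ => h i).trans ?_
  have h2 : (√2) ^ 2 = 2 := Real.sq_sqrt zero_le_two
  have h3 : √2 ≤ 3 / 2 := Real.sqrt_le_iff.2 ⟨by norm_num, by norm_num⟩
  simp
  nlinarith

lemma one_le_sqrt_two : (1 : ℝ) ≤ √2 := Real.one_le_sqrt.2 one_le_two

lemma cosScale_nonneg (k : Fin 3 → ℕ) : 0 ≤ cosScale k :=
  Finset.prod_nonneg fun i _ => by split_ifs <;> positivity

lemma cosScale_le (k : Fin 3 → ℕ) : cosScale k ≤ 3 :=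
  prod_le_three (fun i => by split_ifs <;> positivity)
    fun i => by split_ifs; exacts [one_le_sqrt_two, le_rfl]

lemma abs_trigProd_le (σ : Fin 3 → Bool) (k : Fin 3 → ℕ) (x : Pt) : |trigProd σ k x| ≤ 3 := by
  rw [trigProd, Finset.abs_prod]
  refine prod_le_three (fun i => abs_nonneg _) fun i => ?_
  have h1 := Real.abs_sin_le_one ((k i + 1) * Real.pi * x i)
  have h2 := Real.abs_cos_le_one (k i * Real.pi * x i)
  have h3 : 0 ≤ √2 := Real.sqrt_nonneg 2
  unfold trig
  split_ifs
  · rw [abs_mul, abs_of_nonneg h3]; exact mul_le_of_le_one_right h3 h1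
  · rw [one_mul]; exact h2.trans one_le_sqrt_two
  · rw [abs_mul, abs_of_nonneg h3]; exact mul_le_of_le_one_right h3 h2

lemma abs_pd_trigProd_le {r : ℕ} {k : Fin 3 → ℕ} (i : Fin 3) (hk : k i ≤ r) (x : Pt) :
    |pd i (trigProd (fun _ => false) k) x| ≤ 10 * r := by
  obtain h0 | ⟨m, hm⟩ : k i = 0 ∨ ∃ m, k i = m + 1 :=
    (Nat.eq_zero_or_eq_succ_pred (k i)).imp_right fun h => ⟨_, h⟩
  · rw [pd_trigProd (τ := false) (m := 0) (a := 0) fun t => by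
      rw [h0, zero_mul]; exact hasDerivAt_trig_false_zero t, zero_mul, abs_zero]
    positivity
  · rw [pd_trigProd (τ := true) (m := m) (a := -((m + 1) * Real.pi)) fun t => by
      rw [hm]; simpa using hasDerivAt_trig_false m t, abs_mul, abs_neg,
      abs_of_nonneg (by positivity)]
    have h1 := abs_trigProd_le (Function.update (fun _ => false) i true) (Function.update k i m) x
    have h2 : (m + 1 : ℝ) ≤ r := by rw [hm] at hk; exact_mod_cast hk
    calc _ ≤ ((r : ℝ) * 3.15) * 3 := by
          gcongr
          exact (Real.pi_lt_d2).le
      _ ≤ _ := by linarith [Nat.cast_nonneg (α := ℝ) r]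

lemma kappa_eq_cosScale_sq (m n p : ℕ) : kappa m n p = (cosScale ![m, n, p] : ℂ) ^ 2 := by
  have h2 : ((√2 : ℝ) : ℂ) ^ 2 = 2 := by
    rw [← Complex.ofReal_pow, Real.sq_sqrt zero_le_two]; norm_num
  have h : ∀ l : ℕ, (1 + if l ≠ 0 then 1 else 0 : ℂ) = (((if l = 0 then 1 else √2 : ℝ)) : ℂ) ^ 2 := by
    intro l
    by_cases hl : l = 0
    · simp [hl]
    · simp only [hl, ne_eq, not_false_eq_true, if_true, if_false, h2]; norm_num
  rw [kappa, h, h, h, cosScale, Fin.prod_univ_three, ← mul_pow, ← mul_pow, Complex.ofReal_mul,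
    Complex.ofReal_mul]
  rfl

lemma sum_box_eq {M : Type*} [AddCommMonoid M] (r : ℕ) (F : (Fin 3 → ℕ) → M) :
    ∑ k ∈ box fun _ => r + 1, F k = ∑ m ∈ Finset.range (r + 1), ∑ n ∈ Finset.range (r + 1),
      ∑ p ∈ Finset.range (r + 1), F ![m, n, p] := by
  have e : ∀ k : Fin 3 → ℕ, ![k 0, k 1, k 2] = k := fun k => by
    funext i; fin_cases i <;> rfl
  simp only [← Finset.sum_product']
  refine Finset.sum_bij' (fun k _ => (k 0, k 1, k 2)) (fun q _ => ![q.1, q.2.1, q.2.2]) ?_ ?_ ?_ ?_ ?_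
  · intro k hk
    rw [mem_box] at hk
    simp only [Finset.mem_product, Finset.mem_range]
    exact ⟨hk 0, hk 1, hk 2⟩
  · intro q hq
    simp only [Finset.mem_product, Finset.mem_range] at hq
    rw [mem_box]
    intro j
    fin_cases j
    exacts [hq.1, hq.2.1, hq.2.2]
  · exact fun k _ => e k
  · exact fun q _ => rfl
  · exact fun k _ => by rw [e]

lemma card_box (r : ℕ) : (box fun _ => r + 1).card = (r + 1) ^ 3 := by
  simp [box, Fintype.card_piFinset]

/-- The coefficients of the regularized solution with respect to the normalized cosines. -/
def regCoeff {T : ℝ} (lam mu : ℝ) (I : Data T) (ε : ℝ) (j : Fin 3) (k : Fin 3 → ℕ) : ℂ :=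
  cosScale k * FEps lam mu I j ε (k 0) (k 1) (k 2)

lemma fEps_eq_sum {T : ℝ} (lam mu : ℝ) (I : Data T) (ε : ℝ) (j : Fin 3) (x : Pt) :
    fEps lam mu I ε j x = ∑ k ∈ box fun _ => rEps ε + 1,
      regCoeff lam mu I ε j k * (trigProd (fun _ => false) k x : ℂ) := by
  rw [sum_box_eq, fEps]
  refine Finset.sum_congr rfl fun m _ => Finset.sum_congr rfl fun n _ =>
    Finset.sum_congr rfl fun p _ => ?_
  rw [trigProd_false, regCoeff, kappa_eq_cosScale_sq]
  have : G 0 0 ![(m : ℂ) * (Real.pi : ℂ), (n : ℂ) * (Real.pi : ℂ), (p : ℂ) * (Real.pi : ℂ)] x =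
      (cosProd ![m, n, p] x : ℂ) := by
    simp [G, cosProd, Fin.prod_univ_three]
  rw [this]
  rw [Complex.ofReal_mul]
  change (cosScale ![m, n, p] : ℂ) ^ 2 * FEps lam mu I j ε m n p * _ =
    (cosScale ![m, n, p] : ℂ) * FEps lam mu I j ε m n p * _
  ring

lemma contDiff_fEps {T : ℝ} (lam mu : ℝ) (I : Data T) (ε : ℝ) (j : Fin 3) :
    ContDiff ℝ ((⊤ : ℕ∞) : WithTop ℕ∞) (fEps lam mu I ε j) := by
  rw [show fEps lam mu I ε j = _ from funext (fEps_eq_sum lam mu I ε j)]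
  exact ContDiff.sum fun k _ => contDiff_const.mul
    (Complex.ofRealCLM.contDiff.comp (contDiff_trigProd (fun _ => false) k))

lemma pd_fEps {T : ℝ} (lam mu : ℝ) (I : Data T) (ε : ℝ) (j i : Fin 3) (x : Pt) :
    pd i (fEps lam mu I ε j) x = ∑ k ∈ box fun _ => rEps ε + 1,
      regCoeff lam mu I ε j k * ((pd i (trigProd (fun _ => false) k) x : ℝ) : ℂ) := by
  have h : ∀ k : Fin 3 → ℕ, HasFDerivAt
      (fun x => regCoeff lam mu I ε j k * (trigProd (fun _ => false) k x : ℂ))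
      (regCoeff lam mu I ε j k • (Complex.ofRealCLM.comp
        (fderiv ℝ (trigProd (fun _ => false) k) x))) x := fun k =>
    ((Complex.ofRealCLM.hasFDerivAt (x := trigProd (fun _ => false) k x)).comp x
      (((contDiff_trigProd (fun _ => false) k (n := 1)).differentiable
        (by simp)) x).hasFDerivAt).const_mul _
  have h2 := HasFDerivAt.fun_sum (u := box fun _ => rEps ε + 1) fun k _ => h k
  rw [pd, show fEps lam mu I ε j = _ from funext (fEps_eq_sum lam mu I ε j), h2.fderiv]
  simp [pd]

lemma eLpNorm_ofReal_L2 (v : L2Omega) :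
    eLpNorm (fun x => ((v x : ℝ) : ℂ)) 2 volOmega = ENNReal.ofReal ‖v‖ := by
  rw [eLpNorm_congr_norm_ae (g := v) (Filter.Eventually.of_forall fun x => Complex.norm_real _),
    ← Lp.enorm_def, ofReal_norm]

lemma coeFn_trigSum_sub (σ : Fin 3 → Bool) (v : L2Omega) (N : Fin 3 → ℕ) :
    (trigSum σ v N - v : L2Omega) =ᵐ[volOmega]
      fun x => (∑ k ∈ box N, trigCoeff σ v k * trigProd σ k x) - v x := by
  have h1 : ∀ᵐ x ∂volOmega, ∀ k ∈ box N,
      (trigCoeff σ v k • trigL2 σ k : L2Omega) x = trigCoeff σ v k * trigProd σ k x := by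
    refine (Filter.eventually_all_finset _).2 fun k _ => ?_
    filter_upwards [Lp.coeFn_smul (trigCoeff σ v k) (trigL2 σ k),
      ((continuous_trigProd σ k).memLp_volOmega 2).coeFn_toLp] with x h h'
    rw [h, Pi.smul_apply, smul_eq_mul, trigL2, contToL2, h']
  filter_upwards [Lp.coeFn_sub (trigSum σ v N) v,
    Lp.coeFn_fun_finsetSum (box N) fun k => (trigCoeff σ v k • trigL2 σ k : L2Omega), h1]
    with x hx hx2 hx3
  rw [hx, Pi.sub_apply, trigSum, hx2, Finset.sum_congr rfl hx3]

/-- If the coefficients `a k` are close to `c k`, and the functions `q k` with the coefficients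
`c k` add up to a partial sum of `v`, then `∑ a k q k - v` is bounded by the coefficient error and the
distance of `v` from its partial sum. -/
lemma eLpNorm_sum_sub_le {ι : Type*} {S : Finset ι} {a : ι → ℂ} {c : ι → ℝ} {q : ι → Pt → ℝ}
    {σ : Fin 3 → Bool} {v : L2Omega} {N : Fin 3 → ℕ} {δ M : ℝ}
    (hδ : ∀ k ∈ S, ‖a k - c k‖ ≤ δ) (hM : ∀ k ∈ S, ∀ x, |q k x| ≤ M) (hq : ∀ k, Continuous (q k))
    (hsum : ∀ x, ∑ k ∈ S, c k * q k x = ∑ k ∈ box N, trigCoeff σ v k * trigProd σ k x) :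
    eLpNorm (fun x => (∑ k ∈ S, a k * (q k x : ℂ)) - ((v x : ℝ) : ℂ)) 2 volOmega ≤
      ENNReal.ofReal (S.card * (δ * M)) + ENNReal.ofReal ‖trigSum σ v N - v‖ := by
  have e : (fun x => (∑ k ∈ S, a k * (q k x : ℂ)) - ((v x : ℝ) : ℂ)) =ᵐ[volOmega]
      (fun x => ∑ k ∈ S, (a k - c k) * (q k x : ℂ)) +
        fun x => (((trigSum σ v N - v : L2Omega) x : ℝ) : ℂ) := by
    filter_upwards [coeFn_trigSum_sub σ v N] with x hx
    rw [Pi.add_apply, hx, ← hsum]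
    push_cast
    simp only [sub_mul, Finset.sum_sub_distrib]
    ring
  rw [eLpNorm_congr_ae e, ← eLpNorm_ofReal_L2]
  have hc : Continuous (fun x => ∑ k ∈ S, (a k - c k) * (q k x : ℂ)) :=
    continuous_finsetSum _ fun k _ => continuous_const.mul (Complex.continuous_ofReal.comp (hq k))
  refine (eLpNorm_add_le hc.aestronglyMeasurable
    (Complex.continuous_ofReal.comp_aestronglyMeasurable (L2_memLp _).1) (by norm_num)).trans ?_
  gcongr
  refine (eLpNorm_le_of_ae_bound (C := S.card * (δ * M))
    (Filter.Eventually.of_forall fun x => ?_)).trans_eq (by simp)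
  refine (norm_sum_le_of_le _ fun k hk => ?_).trans_eq (by rw [Finset.sum_const, nsmul_eq_mul])
  rw [norm_mul, Complex.norm_real]
  exact mul_le_mul (hδ k hk) (hM k hk x) (abs_nonneg _) ((norm_nonneg _).trans (hδ k hk))

lemma H1norm_le_add {w : Pt → ℂ} {v : Fin 3 → Pt → ℂ} (h : HasL2Gradient w v) :
    H1norm w ≤ eLpNorm w 2 volOmega + ∑ i, eLpNorm (v i) 2 volOmega := by
  refine (iInf₂_le v h).trans ?_
  set a := eLpNorm w 2 volOmega
  set b := fun i => eLpNorm (v i) 2 volOmega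
  have h1 : ∑ i, b i ^ 2 ≤ (∑ i, b i) ^ 2 := by
    rw [sq, Finset.sum_mul]
    refine Finset.sum_le_sum fun i _ => ?_
    rw [sq]
    exact mul_le_mul_right (Finset.single_le_sum (f := b) (fun _ _ => zero_le) (Finset.mem_univ i)) _
  have h2 : a ^ 2 + ∑ i, b i ^ 2 ≤ (a + ∑ i, b i) ^ 2 := by
    refine (add_le_add_right h1 _).trans ?_
    rw [add_sq]
    gcongr
    exact le_self_add
  calc _ ≤ ((a + ∑ i, b i) ^ 2) ^ (1 / 2 : ℝ) := ENNReal.rpow_le_rpow h2 (by norm_num)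
    _ = _ := by rw [← ENNReal.rpow_natCast, ← ENNReal.rpow_mul]; norm_num

lemma hasL2Gradient_err {T : ℝ} (lam mu : ℝ) (I : Data T) (ε : ℝ) {f : Fin 3 → L2Omega} {j : Fin 3}
    {V : Fin 3 → L2Omega} (hV : ∀ i, HasWeakPartial i (f j) (V i)) :
    HasL2Gradient (err lam mu I ε f j)
      fun i x => pd i (fEps lam mu I ε j) x - ((V i x : ℝ) : ℂ) := by
  have hc := contDiff_fEps lam mu I ε j
  have h1 := hc.continuous.memLp_volOmega 2
  have h2 : ∀ i, MemLp (pd i (fEps lam mu I ε j)) 2 volOmega := fun i =>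
    hc.pd.continuous.memLp_volOmega 2
  have h3 : ∀ v : L2Omega, MemLp (fun x => ((v x : ℝ) : ℂ)) 2 volOmega := fun v =>
    (L2_memLp v).ofReal
  refine ⟨h1.sub (h3 _), fun i => ⟨(h2 i).sub (h3 _), ?_⟩⟩
  exact (hasWeakPartial_of_contDiff hc).sub (hV i).ofReal (h1.integrable (by norm_num))
    ((h2 i).integrable (by norm_num)) ((h3 _).integrable (by norm_num))
    ((h3 _).integrable (by norm_num))

/-- The error of the regularized solution is, up to `O(1/r)`, that of the partial sums of the
cosine series of the source. -/
theorem IsSolution.exists_err_bound {lam mu T : ℝ} (hT : 0 < T) (hmu : 0 < mu)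
    (hlam : 0 < lam + 2 * mu) {I₀ : Data T} (hW : W1 I₀) (hW2 : W2' lam mu T)
    {u : Fin 3 → ℝ → L2Omega} {f : Fin 3 → L2Omega} (hsol : IsSolution lam mu T I₀ u f) :
    ∃ C > 0, ∃ R₀ : ℝ, ∀ ε ∈ Ioo (0 : ℝ) 1, R₀ ≤ rEps ε → ∀ I : Data T, Close I₀ I ε → ∀ j : Fin 3,
      eLpNorm (err lam mu I ε f j) 2 volOmega ≤ ENNReal.ofReal (C / rEps ε +
        ‖trigSum (fun _ => false) (f j) (fun _ => rEps ε + 1) - f j‖) ∧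
      ∀ V : Fin 3 → L2Omega, (∀ i, HasWeakPartial i (f j) (V i)) →
        H1norm (err lam mu I ε f j) ≤ ENNReal.ofReal (C / rEps ε +
          (‖trigSum (fun _ => false) (f j) (fun _ => rEps ε + 1) - f j‖ +
            ∑ i, ‖trigSum (sinAt i) (V i) (gradBox (rEps ε) i) - V i‖)) := by
  obtain ⟨C, hC, R₀, h⟩ := hsol.exists_FEps_bound hT hmu hlam hW hW2
  refine ⟨4 * (240 * C * (Nat.factorial 9)), by positivity, R₀, ?_⟩
  intro ε hε hR I hI j
  have hr := one_le_rEps hε.1 hε.2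
  replace h := h ε hε hR I hI j
  have hf : ∀ x, err lam mu I ε f j x = (∑ k ∈ box fun _ => rEps ε + 1,
      regCoeff lam mu I ε j k * (trigProd (fun _ => false) k x : ℂ)) - ((f j x : ℝ) : ℂ) :=
    fun x => by rw [err, fEps_eq_sum]
  have hp := fun i x => pd_fEps lam mu I ε j i x
  have hgr := fun V hV => hasL2Gradient_err lam mu I ε (f := f) (j := j) (V := V) hV
  set r := rEps ε with hrdef
  have hr1 : (1 : ℝ) ≤ r := by exact_mod_cast hr
  have hδ : ∀ k ∈ box fun _ => r + 1, ‖regCoeff lam mu I ε j k -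
      ((trigCoeff (fun _ => false) (f j) k : ℝ) : ℂ)‖ ≤ 3 * (C * (r : ℝ) ^ 4 * Real.exp (-r)) := by
    intro k hk
    rw [mem_box] at hk
    have e : ![k 0, k 1, k 2] = k := by funext i; fin_cases i <;> rfl
    have h1 := h (k 0) (k 1) (k 2) (Nat.lt_succ_iff.1 (hk 0)) (Nat.lt_succ_iff.1 (hk 1))
      (Nat.lt_succ_iff.1 (hk 2))
    rw [e] at h1
    rw [regCoeff, trigCoeff_false, Complex.ofReal_mul, ← mul_sub, norm_mul, Complex.norm_real,
      Real.norm_of_nonneg (cosScale_nonneg k)]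
    exact mul_le_mul (cosScale_le k) h1 (norm_nonneg _) (by norm_num)
  have hcard : ((box fun _ => r + 1).card : ℝ) ≤ 8 * (r : ℝ) ^ 3 := by
    rw [card_box]
    push_cast
    calc (r + 1 : ℝ) ^ 3 ≤ (2 * r) ^ 3 := by gcongr; linarith
      _ = _ := by ring
  have hexp : (r : ℝ) ^ 8 * Real.exp (-r) ≤ (Nat.factorial 9) / r := by
    have h9 := Real.pow_div_factorial_le_exp (r : ℝ) (by positivity) 9
    rw [div_le_iff₀ (by positivity)] at h9
    rw [Real.exp_neg, ← div_eq_mul_inv, div_le_div_iff₀ (Real.exp_pos _) (by positivity)]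
    calc _ = (r : ℝ) ^ 9 := by ring
      _ ≤ _ := by linarith
  -- Both the values and the derivatives of the basis functions are bounded by `10 r`.
  have hsmall : ((box fun _ => r + 1).card : ℝ) *
      (3 * (C * (r : ℝ) ^ 4 * Real.exp (-r)) * (10 * r)) ≤ 240 * C * (Nat.factorial 9) / r := by
    calc _ ≤ (8 * (r : ℝ) ^ 3) * (3 * (C * (r : ℝ) ^ 4 * Real.exp (-r)) * (10 * r)) := by gcongr
      _ = 240 * C * ((r : ℝ) ^ 8 * Real.exp (-r)) := by ring
      _ ≤ 240 * C * ((Nat.factorial 9) / r) := by gcongr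
      _ = _ := by ring
  have hval : eLpNorm (err lam mu I ε f j) 2 volOmega ≤
      ENNReal.ofReal (240 * C * (Nat.factorial 9) / r) +
        ENNReal.ofReal ‖trigSum (fun _ => false) (f j) (fun _ => r + 1) - f j‖ := by
    rw [show err lam mu I ε f j = _ from funext hf]
    refine (eLpNorm_sum_sub_le (M := 10 * r) hδ
      (fun k _ x => (abs_trigProd_le _ k x).trans (by linarith))
      (fun k => continuous_trigProd _ k) fun _ => rfl).trans ?_
    gcongr
  have hq0 : 0 ≤ 240 * C * (Nat.factorial 9) / r := by positivity
  refine ⟨hval.trans ?_, fun V hV => ?_⟩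
  · rw [← ENNReal.ofReal_add hq0 (norm_nonneg _)]
    refine ENNReal.ofReal_le_ofReal ?_
    have : 4 * (240 * C * (Nat.factorial 9)) / r = 4 * (240 * C * (Nat.factorial 9) / r) := by ring
    rw [this]
    linarith
  · refine (H1norm_le_add (hgr V hV)).trans ?_
    have hgrad : ∀ i, eLpNorm (fun x => pd i (fEps lam mu I ε j) x - ((V i x : ℝ) : ℂ)) 2 volOmega ≤
        ENNReal.ofReal (240 * C * (Nat.factorial 9) / r +
          ‖trigSum (sinAt i) (V i) (gradBox r i) - V i‖) := by
      intro i
      rw [ENNReal.ofReal_add hq0 (norm_nonneg _)]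
      simp only [hp]
      refine (eLpNorm_sum_sub_le (M := 10 * r) hδ (fun k hk x => abs_pd_trigProd_le i
        (Nat.lt_succ_iff.1 (mem_box.1 hk i)) x)
        (fun k => (contDiff_trigProd _ k).pd.continuous)
        fun x => sum_mul_pd_trigProd (hV i) r x).trans ?_
      gcongr
    refine (add_le_add hval (Finset.sum_le_sum fun i _ => hgrad i)).trans ?_
    rw [← ENNReal.ofReal_sum_of_nonneg fun i _ => add_nonneg hq0 (norm_nonneg _),
      ← ENNReal.ofReal_add hq0 (norm_nonneg _),
      ← ENNReal.ofReal_add (add_nonneg hq0 (norm_nonneg _))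
        (Finset.sum_nonneg fun i _ => add_nonneg hq0 (norm_nonneg _))]
    refine ENNReal.ofReal_le_ofReal (le_of_eq ?_)
    rw [Finset.sum_add_distrib, Finset.sum_const, Finset.card_univ, Fintype.card_fin]
    simp only [nsmul_eq_mul]
    push_cast
    ring

/-! ### Convergence and rates in terms of the noise level -/

lemma le_rEps {R ε : ℝ} (h0 : 0 < ε) (h : ε < Real.exp (-(60 * R))) : R ≤ rEps ε := by
  have h1 := lt_sixty_mul_rEps (ε := ε)
  have h2 := (Real.log_lt_iff_lt_exp h0).2 h
  rw [Real.log_inv] at h1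
  linarith

lemma exists_forall_rEps {b : ℕ → ℝ} (hb : Filter.Tendsto b Filter.atTop (nhds 0)) (R₀ : ℝ)
    {δ : ENNReal} (hδ : 0 < δ) : ∃ ε₁ > (0 : ℝ), ∀ ε ∈ Ioo 0 ε₁,
      ε ∈ Ioo (0 : ℝ) 1 ∧ R₀ ≤ rEps ε ∧ ENNReal.ofReal (b (rEps ε)) < δ := by
  have h := ENNReal.tendsto_ofReal hb
  rw [ENNReal.ofReal_zero] at h
  obtain ⟨N, hN⟩ := Filter.eventually_atTop.1 (h.eventually (gt_mem_nhds hδ))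
  refine ⟨min 1 (Real.exp (-(60 * max R₀ N))), by positivity, fun ε hε => ?_⟩
  have hr := le_rEps hε.1 (hε.2.trans_le (min_le_right _ _))
  exact ⟨⟨hε.1, hε.2.trans_le (min_le_left _ _)⟩, (le_max_left _ _).trans hr,
    hN _ (by exact_mod_cast (le_max_right _ _).trans hr)⟩

lemma rpow_neg_rEps_le {ε a : ℝ} (hε : ε ∈ Ioo (0 : ℝ) 1) (ha0 : 0 ≤ a) (ha1 : a ≤ 1) :
    (rEps ε : ℝ) ^ (-a) ≤ 60 * Real.log ε⁻¹ ^ (-a) := by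
  have hL : 0 < Real.log ε⁻¹ := Real.log_pos ((one_lt_inv₀ hε.1).2 hε.2)
  have h1 : Real.log ε⁻¹ / 60 ≤ rEps ε := by linarith [lt_sixty_mul_rEps (ε := ε)]
  calc _ ≤ (Real.log ε⁻¹ / 60) ^ (-a) :=
        Real.rpow_le_rpow_of_nonpos (by positivity) h1 (by linarith)
    _ = 60 ^ a * Real.log ε⁻¹ ^ (-a) := by
        rw [Real.div_rpow hL.le (by norm_num), Real.rpow_neg (by norm_num : (0 : ℝ) ≤ 60),
          div_inv_eq_mul, mul_comm]
    _ ≤ 60 ^ (1 : ℝ) * Real.log ε⁻¹ ^ (-a) := by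
        gcongr
        norm_num
    _ = _ := by rw [Real.rpow_one]

lemma inv_sqrt_rEps_le {ε a : ℝ} (hε : ε ∈ Ioo (0 : ℝ) 1) (ha0 : 0 ≤ a) (ha1 : a ≤ 1 / 2) :
    (√(rEps ε : ℝ))⁻¹ ≤ 60 * Real.log ε⁻¹ ^ (-a) := by
  have hr : (1 : ℝ) ≤ rEps ε := by exact_mod_cast one_le_rEps hε.1 hε.2
  refine le_trans ?_ (rpow_neg_rEps_le hε ha0 (by linarith))
  rw [Real.sqrt_eq_rpow, ← Real.rpow_neg (by linarith)]
  exact Real.rpow_le_rpow_of_exponent_le hr (by linarith)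

lemma MemH1.exists_L2 {w : L2Omega} (h : MemH1 (w : Pt → ℝ)) :
    ∃ V : Fin 3 → L2Omega, ∀ i, HasWeakPartial i w (V i) := by
  obtain ⟨v, -, hv⟩ := h
  exact ⟨fun i => (hv i).1.toLp, fun i =>
    (hv i).2.congr Filter.EventuallyEq.rfl (hv i).1.coeFn_toLp.symm⟩

lemma MemH2.exists_L2 {w : L2Omega} (h : MemH2 (w : Pt → ℝ)) :
    ∃ (V : Fin 3 → L2Omega) (W : Fin 3 → Fin 3 → L2Omega),
      (∀ i, HasWeakPartial i w (V i)) ∧ ∀ i l, HasWeakPartial l (V i) (W i l) := by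
  obtain ⟨v, ⟨-, hv⟩, h2⟩ := h
  choose z hz using h2
  exact ⟨fun i => (hv i).1.toLp, fun i l => ((hz i).2 l).1.toLp, fun i =>
    (hv i).2.congr Filter.EventuallyEq.rfl (hv i).1.coeFn_toLp.symm, fun i l =>
    ((hz i).2 l).2.congr (hv i).1.coeFn_toLp.symm ((hz i).2 l).1.coeFn_toLp.symm⟩

lemma tendsto_norm_trigSum_sub (σ : Fin 3 → Bool) (v : L2Omega) {N : ℕ → Fin 3 → ℕ}
    (hN : ∀ j, Filter.Tendsto (fun r => N r j) Filter.atTop Filter.atTop) :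
    Filter.Tendsto (fun r => ‖trigSum σ v (N r) - v‖) Filter.atTop (nhds 0) := by
  simpa using ((tendsto_trigSum σ v hN).sub_const v).norm

lemma tendsto_norm_cosSum_sub (v : L2Omega) : Filter.Tendsto
    (fun r => ‖trigSum (fun _ => false) v (fun _ => r + 1) - v‖) Filter.atTop (nhds 0) :=
  tendsto_norm_trigSum_sub _ v fun _ => Filter.tendsto_add_atTop_nat 1

lemma tendsto_norm_gradSum_sub (i : Fin 3) (v : L2Omega) : Filter.Tendsto
    (fun r => ‖trigSum (sinAt i) v (gradBox r i) - v‖) Filter.atTop (nhds 0) :=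
  tendsto_norm_trigSum_sub _ v fun j => by
    by_cases hj : j = i
    · subst hj; simp only [gradBox, Function.update_self]; exact Filter.tendsto_id
    · simpa [gradBox, hj] using Filter.tendsto_add_atTop_nat 1

lemma norm_cosSum_sub_le {w : L2Omega} {V : Fin 3 → L2Omega} (h : ∀ i, HasWeakPartial i w (V i))
    {r : ℕ} (hr : 1 ≤ r) :
    ‖trigSum (fun _ => false) w (fun _ => r + 1) - w‖ ≤ √(∑ i, ‖V i‖ ^ 2) * (√(r : ℝ))⁻¹ := by
  have hr1 : (1 : ℝ) ≤ r := by exact_mod_cast hr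
  have hA : 0 ≤ ∑ i, ‖V i‖ ^ 2 := Finset.sum_nonneg fun _ _ => sq_nonneg _
  rw [← div_eq_mul_inv, ← Real.sqrt_div hA]
  refine Real.le_sqrt_of_sq_le ((norm_cosSum_sub_sq_le h hr).trans ?_)
  gcongr
  nlinarith

lemma norm_gradSum_sub_le {i : Fin 3} {w : L2Omega} {V : Fin 3 → L2Omega}
    (h : ∀ l, HasWeakPartial l w (V l)) {r : ℕ} (hr : 1 ≤ r) :
    ‖trigSum (sinAt i) w (gradBox r i) - w‖ ≤
      √(∑ l, (16 * ‖w‖ ^ 2 + 36 * ‖V l‖ ^ 2)) * (√(r : ℝ))⁻¹ := by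
  have hA : 0 ≤ ∑ l, (16 * ‖w‖ ^ 2 + 36 * ‖V l‖ ^ 2) := Finset.sum_nonneg fun _ _ => by positivity
  rw [← div_eq_mul_inv, ← Real.sqrt_div hA]
  exact Real.le_sqrt_of_sq_le (norm_gradSum_sub_sq_le h hr)

lemma inv_le_inv_sqrt {r : ℕ} (hr : 1 ≤ r) : ((r : ℝ))⁻¹ ≤ (√(r : ℝ))⁻¹ := by
  have hr1 : (1 : ℝ) ≤ r := by exact_mod_cast hr
  have := Real.sqrt_pos.2 (zero_lt_one.trans_le hr1)
  gcongr
  exact Real.sqrt_le_iff.2 ⟨by linarith, by nlinarith⟩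

/-- Convergence of the regularized solutions in `L²(Ω)`. -/
theorem IsSolution.tendsto_err {lam mu T : ℝ} (hT : 0 < T) (hmu : 0 < mu)
    (hlam : 0 < lam + 2 * mu) {I₀ : Data T} (hW : W1 I₀) (hW2 : W2' lam mu T)
    {u : Fin 3 → ℝ → L2Omega} {f : Fin 3 → L2Omega} (hsol : IsSolution lam mu T I₀ u f)
    (j : Fin 3) {δ : ENNReal} (hδ : 0 < δ) : ∃ ε₁ > (0 : ℝ), ∀ ε ∈ Ioo 0 ε₁, ∀ I : Data T,
      Close I₀ I ε → eLpNorm (err lam mu I ε f j) 2 volOmega < δ := by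
  obtain ⟨C, -, R₀, h⟩ := hsol.exists_err_bound hT hmu hlam hW hW2
  have hlim := (tendsto_const_div_atTop_nhds_zero_nat C).add (tendsto_norm_cosSum_sub (f j))
  rw [add_zero] at hlim
  obtain ⟨ε₁, hε₁, h1⟩ := exists_forall_rEps hlim R₀ hδ
  refine ⟨ε₁, hε₁, fun ε hε I hI => ?_⟩
  obtain ⟨ha, hb, hc⟩ := h1 ε hε
  exact (h ε ha hb I hI j).1.trans_lt hc

/-- Convergence of the regularized solutions in `H¹(Ω)`. -/
theorem IsSolution.tendsto_err_H1 {lam mu T : ℝ} (hT : 0 < T) (hmu : 0 < mu)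
    (hlam : 0 < lam + 2 * mu) {I₀ : Data T} (hW : W1 I₀) (hW2 : W2' lam mu T)
    {u : Fin 3 → ℝ → L2Omega} {f : Fin 3 → L2Omega} (hsol : IsSolution lam mu T I₀ u f)
    {j : Fin 3} (hf : MemH1 (f j : Pt → ℝ)) {δ : ENNReal} (hδ : 0 < δ) :
    ∃ ε₁ > (0 : ℝ), ∀ ε ∈ Ioo 0 ε₁, ∀ I : Data T,
      Close I₀ I ε → H1norm (err lam mu I ε f j) < δ := by
  obtain ⟨C, -, R₀, h⟩ := hsol.exists_err_bound hT hmu hlam hW hW2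
  obtain ⟨V, hV⟩ := hf.exists_L2
  have hlim := (tendsto_const_div_atTop_nhds_zero_nat C).add
    ((tendsto_norm_cosSum_sub (f j)).add
      (tendsto_finsetSum Finset.univ fun i _ => tendsto_norm_gradSum_sub i (V i)))
  rw [Finset.sum_const_zero, add_zero, add_zero] at hlim
  obtain ⟨ε₁, hε₁, h1⟩ := exists_forall_rEps hlim R₀ hδ
  refine ⟨ε₁, hε₁, fun ε hε I hI => ?_⟩
  obtain ⟨ha, hb, hc⟩ := h1 ε hε
  exact ((h ε ha hb I hI j).2 V hV).trans_lt hc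

/-- Convergence rates for sources in `H¹(Ω)` and in `H²(Ω)`. -/
theorem IsSolution.exists_rate {lam mu T : ℝ} (hT : 0 < T) (hmu : 0 < mu)
    (hlam : 0 < lam + 2 * mu) {I₀ : Data T} (hW : W1 I₀) (hW2 : W2' lam mu T)
    {u : Fin 3 → ℝ → L2Omega} {f : Fin 3 → L2Omega} (hsol : IsSolution lam mu T I₀ u f) :
    ∃ ε₀ > (0 : ℝ), ∃ C₀ > (0 : ℝ), ∀ j : Fin 3, ∀ ε ∈ Ioo 0 ε₀, ∀ I : Data T, Close I₀ I ε →
      (MemH1 (f j : Pt → ℝ) → eLpNorm (err lam mu I ε f j) 2 volOmega ≤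
        ENNReal.ofReal (C₀ * Real.log ε⁻¹ ^ (-(1 / 2) : ℝ))) ∧
      (MemH2 (f j : Pt → ℝ) → H1norm (err lam mu I ε f j) ≤
        ENNReal.ofReal (C₀ * Real.log ε⁻¹ ^ (-(1 / 4) : ℝ))) := by
  obtain ⟨C, hC, R₀, h⟩ := hsol.exists_err_bound hT hmu hlam hW hW2
  have h1 : ∀ j, ∃ A : ℝ, 0 ≤ A ∧ (MemH1 (f j : Pt → ℝ) → ∀ r : ℕ, 1 ≤ r →
      C / r + ‖trigSum (fun _ => false) (f j) (fun _ => r + 1) - f j‖ ≤ A * (√(r : ℝ))⁻¹) := by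
    intro j
    by_cases hf : MemH1 (f j : Pt → ℝ)
    · obtain ⟨V, hV⟩ := hf.exists_L2
      refine ⟨C + √(∑ i, ‖V i‖ ^ 2), by positivity, fun _ r hr => ?_⟩
      rw [add_mul, div_eq_mul_inv]
      exact add_le_add (mul_le_mul_of_nonneg_left (inv_le_inv_sqrt hr) hC.le)
        (norm_cosSum_sub_le hV hr)
    · exact ⟨0, le_rfl, fun hf' => absurd hf' hf⟩
  have h2 : ∀ j, ∃ A : ℝ, 0 ≤ A ∧ (MemH2 (f j : Pt → ℝ) → ∃ V : Fin 3 → L2Omega,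
      (∀ i, HasWeakPartial i (f j) (V i)) ∧ ∀ r : ℕ, 1 ≤ r →
        C / r + (‖trigSum (fun _ => false) (f j) (fun _ => r + 1) - f j‖ +
          ∑ i, ‖trigSum (sinAt i) (V i) (gradBox r i) - V i‖) ≤ A * (√(r : ℝ))⁻¹) := by
    intro j
    by_cases hf : MemH2 (f j : Pt → ℝ)
    · obtain ⟨V, W, hV, hVW⟩ := hf.exists_L2
      refine ⟨C + (√(∑ i, ‖V i‖ ^ 2) + ∑ i, √(∑ l, (16 * ‖V i‖ ^ 2 + 36 * ‖W i l‖ ^ 2))),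
        by positivity, fun _ => ⟨V, hV, fun r hr => ?_⟩⟩
      rw [add_mul, add_mul, div_eq_mul_inv, Finset.sum_mul]
      exact add_le_add (mul_le_mul_of_nonneg_left (inv_le_inv_sqrt hr) hC.le)
        (add_le_add (norm_cosSum_sub_le hV hr)
          (Finset.sum_le_sum fun i _ => norm_gradSum_sub_le (hVW i) hr))
    · exact ⟨0, le_rfl, fun hf' => absurd hf' hf⟩
  choose A hA0 hA using h1
  choose B hB0 hB using h2
  have hAj : ∀ j, A j ≤ ∑ l, A l := fun j =>
    Finset.single_le_sum (f := A) (fun l _ => hA0 l) (Finset.mem_univ j)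
  have hBj : ∀ j, B j ≤ ∑ l, B l := fun j =>
    Finset.single_le_sum (f := B) (fun l _ => hB0 l) (Finset.mem_univ j)
  have hsA : 0 ≤ ∑ l, A l := Finset.sum_nonneg fun l _ => hA0 l
  have hsB : 0 ≤ ∑ l, B l := Finset.sum_nonneg fun l _ => hB0 l
  refine ⟨min 1 (Real.exp (-(60 * R₀))), by positivity, (∑ l, A l + ∑ l, B l + 1) * 60,
    by positivity, fun j ε hε I hI => ?_⟩
  have hε1 : ε ∈ Ioo (0 : ℝ) 1 := ⟨hε.1, hε.2.trans_le (min_le_left _ _)⟩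
  have hr := one_le_rEps hε1.1 hε1.2
  obtain ⟨hL, hH⟩ := h ε hε1 (le_rEps hε.1 (hε.2.trans_le (min_le_right _ _))) I hI j
  have hlog : ∀ a : ℝ, 0 ≤ a → a ≤ 1 / 2 → ∀ D ≤ ∑ l, A l + ∑ l, B l + 1,
      D * (√(rEps ε : ℝ))⁻¹ ≤ (∑ l, A l + ∑ l, B l + 1) * 60 * Real.log ε⁻¹ ^ (-a) := by
    intro a ha0 ha1 D hD
    rw [mul_assoc]
    exact mul_le_mul hD (inv_sqrt_rEps_le hε1 ha0 ha1) (by positivity) (by positivity)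
  refine ⟨fun hf => hL.trans (ENNReal.ofReal_le_ofReal ((hA j hf _ hr).trans
    (hlog (1 / 2) (by norm_num) le_rfl _ (by linarith [hAj j])))), fun hf => ?_⟩
  obtain ⟨V, hV, hb⟩ := hB j hf
  exact (hH V hV).trans (ENNReal.ofReal_le_ofReal ((hb _ hr).trans
    (hlog (1 / 4) (by norm_num) (by norm_num) _ (by linarith [hBj j]))))

lemma Close.refl {T : ℝ} (I : Data T) {ε : ℝ} (hε : 0 ≤ ε) : Close I I ε := by
  simp [Close, hε]

/-- The data determine the source, as the regularized solutions for the exact data converge to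
it. -/
theorem IsSolution.unique {lam mu T : ℝ} (hT : 0 < T) (hmu : 0 < mu)
    (hlam : 0 < lam + 2 * mu) {I₀ : Data T} (hW : W1 I₀) (hW2 : W2' lam mu T)
    {u u' : Fin 3 → ℝ → L2Omega} {f f' : Fin 3 → L2Omega} (hsol : IsSolution lam mu T I₀ u f)
    (hsol' : IsSolution lam mu T I₀ u' f') : f = f' := by
  funext j
  rw [← sub_eq_zero, ← norm_le_zero_iff]
  refine le_of_forall_pos_le_add fun δ hδ => ?_
  have hδ' : 0 < ENNReal.ofReal (δ / 2) := ENNReal.ofReal_pos.2 (by positivity)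
  obtain ⟨ε₁, hε₁, h1⟩ := hsol.tendsto_err hT hmu hlam hW hW2 j hδ'
  obtain ⟨ε₂, hε₂, h2⟩ := hsol'.tendsto_err hT hmu hlam hW hW2 j hδ'
  set ε := min ε₁ ε₂ / 2 with hε
  have hm : 0 < min ε₁ ε₂ := lt_min hε₁ hε₂
  have hε0 : 0 < ε := by positivity
  have hc := Close.refl I₀ hε0.le
  have ha := h1 ε ⟨hε0, by linarith [min_le_left ε₁ ε₂]⟩ I₀ hc
  have hb := h2 ε ⟨hε0, by linarith [min_le_right ε₁ ε₂]⟩ I₀ hc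
  have hmeas : ∀ g : Fin 3 → L2Omega, AEStronglyMeasurable (err lam mu I₀ ε g j) volOmega := fun g =>
    (contDiff_fEps lam mu I₀ ε j).continuous.aestronglyMeasurable.sub
      (Complex.continuous_ofReal.comp_aestronglyMeasurable (L2_memLp _).1)
  have e : (fun x => (((f j - f' j : L2Omega) x : ℝ) : ℂ)) =ᵐ[volOmega]
      err lam mu I₀ ε f' j - err lam mu I₀ ε f j := by
    filter_upwards [Lp.coeFn_sub (f j) (f' j)] with x hx
    rw [hx, Pi.sub_apply, Pi.sub_apply, err, err]
    push_cast
    ring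
  have hle : ENNReal.ofReal ‖f j - f' j‖ ≤ ENNReal.ofReal δ := by
    rw [← eLpNorm_ofReal_L2, eLpNorm_congr_ae e]
    refine (eLpNorm_sub_le (hmeas _) (hmeas _) (by norm_num)).trans
      ((add_le_add hb.le ha.le).trans_eq ?_)
    rw [← ENNReal.ofReal_add (by positivity) (by positivity), add_halves]
  rw [zero_add]
  exact (ENNReal.ofReal_le_ofReal_iff hδ.le).1 hle

end
end Lame

theorem theorem2 (lam mu T : ℝ) (hmu : 0 < mu) (hlam : 0 < lam + 2 * mu)
    (I₀ : Lame.Data T) (hW1 : Lame.W1 I₀) (hW2 : Lame.W2' lam mu T) :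
    ∃ ε₀ > (0 : ℝ), ∃ C₀ > (0 : ℝ),
    ∀ (u₀ : Fin 3 → ℝ → Lame.L2Omega) (f₀ : Fin 3 → Lame.L2Omega),
      Lame.IsSolution lam mu T I₀ u₀ f₀ → ∀ j : Fin 3,
      -- (i)
      ((∀ ε > (0 : ℝ), ∀ I : Lame.Data T, Lame.Close I₀ I ε →
          ContDiff ℝ ((⊤ : ℕ∞) : WithTop ℕ∞) (Lame.fEps lam mu I ε j)) ∧
        (∀ δ > (0 : ENNReal), ∃ ε₁ > (0 : ℝ), ∀ ε ∈ Set.Ioo 0 ε₁, ∀ I : Lame.Data T,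
          Lame.Close I₀ I ε →
            MeasureTheory.eLpNorm (Lame.err lam mu I ε f₀ j) 2 Lame.volOmega < δ)) ∧
      -- (ii)
      (Lame.MemH1 (f₀ j) →
        (∀ δ > (0 : ENNReal), ∃ ε₁ > (0 : ℝ), ∀ ε ∈ Set.Ioo 0 ε₁, ∀ I : Lame.Data T,
          Lame.Close I₀ I ε → Lame.H1norm (Lame.err lam mu I ε f₀ j) < δ) ∧
        (∀ ε ∈ Set.Ioo 0 ε₀, ∀ I : Lame.Data T, Lame.Close I₀ I ε →
          MeasureTheory.eLpNorm (Lame.err lam mu I ε f₀ j) 2 Lame.volOmega ≤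
            ENNReal.ofReal (C₀ * Real.log ε⁻¹ ^ (-(1 / 2) : ℝ)))) ∧
      -- (iii)
      (Lame.MemH2 (f₀ j) →
        ∀ ε ∈ Set.Ioo 0 ε₀, ∀ I : Lame.Data T, Lame.Close I₀ I ε →
          Lame.H1norm (Lame.err lam mu I ε f₀ j) ≤
            ENNReal.ofReal (C₀ * Real.log ε⁻¹ ^ (-(1 / 4) : ℝ))) := by
  obtain ⟨Λ, hΛ, -⟩ := id hW1
  have hT : 0 < T := hΛ.1.trans hΛ.2
  by_cases hex : ∃ u f, Lame.IsSolution lam mu T I₀ u f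
  · obtain ⟨u, f, hsol⟩ := hex
    obtain ⟨ε₀, hε₀, C₀, hC₀, hrate⟩ := hsol.exists_rate hT hmu hlam hW1 hW2
    refine ⟨ε₀, hε₀, C₀, hC₀, fun u₀ f₀ hsol₀ j => ?_⟩
    -- The source is unique, so that the constants found for `f` serve for every solution.
    obtain rfl := hsol.unique hT hmu hlam hW1 hW2 hsol₀
    exact ⟨⟨fun ε _ I _ => Lame.contDiff_fEps lam mu I ε j,
      fun δ hδ => hsol.tendsto_err hT hmu hlam hW1 hW2 j hδ⟩,
      fun hf => ⟨fun δ hδ => hsol.tendsto_err_H1 hT hmu hlam hW1 hW2 hf hδ,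
        fun ε hε I hI => (hrate j ε hε I hI).1 hf⟩,
      fun hf ε hε I hI => (hrate j ε hε I hI).2 hf⟩
  · exact ⟨1, one_pos, 1, one_pos, fun u₀ f₀ hsol₀ => absurd ⟨u₀, f₀, hsol₀⟩ hex⟩
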